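/- **Setting.** For an array of pairwise distinct values and a range of its positions, the sorted Top-$k$ query on the range returns the positions of the $k$ largest values in the range, listed by decreasing value (all positions of the range, if it has fewer than $k$). For a 1D array $a[1..n]$, a sorted 2-sided query asks for a range $a[i..j]$, $1\le i\le j\le n$; for a $2\times n$ array $A$, a sorted 4-sided query asks for a range $A[i..j][a..b]$, $1\le i\le j\le 2$, $1\le a\le b\le n$. The model is the word RAM with words of $\Theta(\lg n)$ bits; array elements are integers of $O(\lg n)$ bits. A program receives $n$ and $k$ as part of its input, and memory is initially zero. An encoding of an array is a bit string that a construction program writes, given the array; a query program, given only the string, its length, $n$, $k$ and the query, answers every query. Up to $w$ consecutive bits of the string can be written or read in one step, where $w$ is the word size, and the length of the string fits in a word. **Theorem.** Let $S,T,C:\mathbb N\times\mathbb N\to\mathbb N$. Suppose that there is an encoding of 1D arrays that, for all $1\le k\le n$, uses exactly $S(n,k)$ bits for every array of $n$ distinct elements, answers every sorted 2-sided Top-$k$ query on the array in at most $T(n,k)$ time, and can be constructed in at most $C(n,k)$ time. For $k>n$ put $S(n,k)=S(n,n)$, $T(n,k)=T(n,n)$ and $C(n,k)=C(n,n)$. Then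 there is an encoding of $2\times n$ arrays that, for all $n\ge 1$ and $1\le k\le 2n$, uses exactly $2S(n,k)+4n$ bits for every $2\times n$ array $A$ of distinct elements, answers every sorted 4-sided Top-$k$ query on $A$ (no bound on the query time is claimed), and can be constructed in $$O\bigl(C(n,k)+k^2n^2+k\,n\,T(n,k)\bigr)$$ time, where the constant in the $O$ is absolute. -/

import Mathlib

/-! ### The word RAM

A program is a fixed finite text, independent of the size of its input.  It uses finitely many
registers and finitely many zero-initialised memory banks (a constant number of banks can be
interleaved in a single memory with constant overhead).  All numbers that occur in a run on
`w`-bit words have to be smaller than `2 ^ w`: a run that would produce a larger number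
has no derivation in `Cmd.Exec`.  Every arithmetic, logical, memory or input/output operation costs
one unit of time. -/

namespace WordRAM

/-- The binary operations on words; comparisons return `0` or `1`. -/
inductive BinOp where
  | add | sub | mul | div | mod | land | lor | xor | shl | shr | lt | eq

/-- The meaning of the operations (`sub` is truncated at `0`, division by `0` gives `0`). -/
def BinOp.eval : BinOp → ℕ → ℕ → ℕ
  | .add, x, y => x + y
  | .sub, x, y => x - y
  | .mul, x, y => x * y
  | .div, x, y => x / y
  | .mod, x, y => x % y
  | .land, x, y => x &&& y
  | .lor, x, y => x ||| y
  | .xor, x, y => x ^^^ y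
  | .shl, x, y => x <<< y
  | .shr, x, y => x >>> y
  | .lt, x, y => if x < y then 1 else 0
  | .eq, x, y => if x = y then 1 else 0

/-- Expressions: constants, registers, operations, memory cells (`load b e` is cell `e` of bank `b`),
and `probe p l`, the number formed by the `l` consecutive bits of the stored encoding that start at
position `p`. -/
inductive Expr where
  | const (c : ℕ)
  | reg (r : ℕ)
  | bin (op : BinOp) (e₁ e₂ : Expr)
  | load (bank : ℕ) (addr : Expr)
  | probe (pos len : Expr)

/-- Programs. `emit v l` appends the `l` lowest bits of the word `v` to the output string. -/
inductive Cmd where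
  | skip
  | assign (r : ℕ) (e : Expr)
  | store (bank : ℕ) (addr val : Expr)
  | emit (val len : Expr)
  | seq (p q : Cmd)
  | ite (e : Expr) (p q : Cmd)
  | loop (e : Expr) (p : Cmd)

/-- A machine state: registers, memory banks, and the bits written to the output so far. -/
structure State where
  reg : ℕ → ℕ
  mem : ℕ → ℕ → ℕ
  out : List Bool

/-- The number with the given binary digits, least significant digit first. -/
def bitsToNat : List Bool → ℕ
  | [] => 0
  | b :: l => b.toNat + 2 * bitsToNat l

/-- The `l` lowest binary digits of `v`, least significant digit first. -/
def lowBits (v l : ℕ) : List Bool := (List.range l).map fun i => v.testBit i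

/-- A number is a legal word if it has at most `w` bits. -/
def word (w v : ℕ) : Option ℕ := if v < 2 ^ w then some v else none

/-- The value of an expression on a machine with `w`-bit words and read-only encoding `enc`;
`none` if some intermediate result is not a word, or if a probe asks for more than `w` bits or
leaves the encoding. -/
def Expr.eval (w : ℕ) (enc : List Bool) (σ : State) : Expr → Option ℕ
  | .const c => word w c
  | .reg r => word w (σ.reg r)
  | .bin op e₁ e₂ => do
      let x ← e₁.eval w enc σ
      let y ← e₂.eval w enc σ
      word w (op.eval x y)
  | .load b e => do
      let a ← e.eval w enc σ
      word w (σ.mem b a)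
  | .probe p l => do
      let a ← p.eval w enc σ
      let m ← l.eval w enc σ
      if m ≤ w ∧ a + m ≤ enc.length then some (bitsToNat ((enc.drop a).take m)) else none

/-- The time to evaluate an expression: the number of its nodes. -/
def Expr.cost : Expr → ℕ
  | .const _ => 1
  | .reg _ => 1
  | .bin _ e₁ e₂ => e₁.cost + e₂.cost + 1
  | .load _ e => e.cost + 1
  | .probe p l => p.cost + l.cost + 1

/-- The state after an assignment to a register. -/
def State.setReg (σ : State) (r v : ℕ) : State :=
  { σ with reg := Function.update σ.reg r v }

/-- The state after a write to cell `a` of bank `b`. -/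
def State.setMem (σ : State) (b a v : ℕ) : State :=
  { σ with mem := Function.update σ.mem b (Function.update (σ.mem b) a v) }

/-- `Cmd.Exec w enc p σ τ t`: on a machine with `w`-bit words and read-only encoding `enc`, the
program `p` started in state `σ` halts in state `τ` after exactly `t` steps, without overflow. -/
inductive Cmd.Exec (w : ℕ) (enc : List Bool) : Cmd → State → State → ℕ → Prop
  | skip (σ : State) : Cmd.Exec w enc .skip σ σ 1
  | assign (σ : State) (r : ℕ) (e : Expr) (v : ℕ) (hv : e.eval w enc σ = some v) :
      Cmd.Exec w enc (.assign r e) σ (σ.setReg r v) (e.cost + 1)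
  | store (σ : State) (b : ℕ) (ea ev : Expr) (a v : ℕ)
      (ha : ea.eval w enc σ = some a) (hv : ev.eval w enc σ = some v) :
      Cmd.Exec w enc (.store b ea ev) σ (σ.setMem b a v) (ea.cost + ev.cost + 1)
  | emit (σ : State) (ev el : Expr) (v l : ℕ)
      (hv : ev.eval w enc σ = some v) (hl : el.eval w enc σ = some l) (hlw : l ≤ w) :
      Cmd.Exec w enc (.emit ev el) σ { σ with out := σ.out ++ lowBits v l }
        (ev.cost + el.cost + 1)
  | seq (p q : Cmd) (σ τ ρ : State) (s t : ℕ)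
      (hp : Cmd.Exec w enc p σ τ s) (hq : Cmd.Exec w enc q τ ρ t) :
      Cmd.Exec w enc (.seq p q) σ ρ (s + t)
  | iteTrue (e : Expr) (p q : Cmd) (σ τ : State) (v t : ℕ)
      (he : e.eval w enc σ = some v) (hv : v ≠ 0) (hp : Cmd.Exec w enc p σ τ t) :
      Cmd.Exec w enc (.ite e p q) σ τ (e.cost + 1 + t)
  | iteFalse (e : Expr) (p q : Cmd) (σ τ : State) (t : ℕ)
      (he : e.eval w enc σ = some 0) (hq : Cmd.Exec w enc q σ τ t) :
      Cmd.Exec w enc (.ite e p q) σ τ (e.cost + 1 + t)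
  | loopStop (e : Expr) (p : Cmd) (σ : State) (he : e.eval w enc σ = some 0) :
      Cmd.Exec w enc (.loop e p) σ σ (e.cost + 1)
  | loopStep (e : Expr) (p : Cmd) (σ τ ρ : State) (v s t : ℕ)
      (he : e.eval w enc σ = some v) (hv : v ≠ 0)
      (hp : Cmd.Exec w enc p σ τ s) (hl : Cmd.Exec w enc (.loop e p) τ ρ t) :
      Cmd.Exec w enc (.loop e p) σ ρ (e.cost + 1 + s + t)

/-- The initial state with given contents of the first registers and of the first memory banks;
all other registers and memory cells are `0`, and nothing has been output. -/
def State.init (regs : List ℕ) (banks : List (List ℕ)) : State where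
  reg := fun r => regs.getD r 0
  mem := fun b i => (banks.getD b []).getD i 0
  out := []

/-- Words of `Θ(lg n)` bits, with constant factor `c`. -/
def wordSize (c n : ℕ) : ℕ := c * (Nat.log 2 n + 1)

end WordRAM

/-! ### Range top-k queries -/

/-- `L` is the answer to the sorted top-`k` query on the range `R`: it lists, by decreasing value,
the positions of the `k` largest values in `R` (all positions of `R`, if there are fewer
than `k`). -/
def IsSortedTopK {P : Type*} (v : P → ℕ) (R : Finset P) (k : ℕ) (L : List P) : Prop :=
  L.Pairwise (fun p q => v q < v p) ∧
  L.length = min k R.card ∧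
  (∀ p ∈ L, p ∈ R) ∧
  ∀ p ∈ L, ∀ q ∈ R, q ∉ L → v q < v p

open WordRAM in
/-- The program `B` builds the encoding `e` of the one-dimensional array `a` in time at most `t`.
It finds `n` and `k` in registers `0`, `1` and the array in memory bank `0`. -/
def Builds1D (w : ℕ) (B : Cmd) (n k : ℕ) (a : Fin n → ℕ) (e : List Bool) (t : ℕ) : Prop :=
  ∃ τ s, Cmd.Exec w [] B (State.init [n, k] [List.ofFn a]) τ s ∧ τ.out = e ∧ s ≤ t

open WordRAM in
/-- With access to `e` but not to `a`, the program `Q` answers the sorted top-`k` query on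
`a[i..j]` in time at most `t`.  It finds `n`, `k`, `i`, `j` and the length of `e` in its first
registers, and writes the answer to memory bank `0`. -/
def Answers1D (w : ℕ) (Q : Cmd) (n k : ℕ) (a : Fin n → ℕ) (e : List Bool) (i j : Fin n)
    (t : ℕ) : Prop :=
  ∃ τ s, Cmd.Exec w e Q (State.init [n, k, i, j, e.length] []) τ s ∧ s ≤ t ∧
    ∃ L : List (Fin n), IsSortedTopK a (Finset.Icc i j) k L ∧
      ∀ l (h : l < L.length), τ.mem 0 l = (L[l] : ℕ)

open WordRAM in
/-- There is an `S(n,k)`-bit encoding that answers sorted 2-sided top-`k` queries on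
one-dimensional arrays of `n` distinct elements in `T(n,k)` time and that is constructed in
`C(n,k)` time, `1 ≤ k ≤ n`, on a word RAM with words of `Θ(lg n)` bits.
The elements are integers of `u * (⌊lg n⌋ + 1)` bits. -/
def HasEncoding1D (u : ℕ) (S T C : ℕ → ℕ → ℕ) : Prop :=
  ∃ (B Q : Cmd) (c : ℕ), ∀ n k : ℕ, 1 ≤ k → k ≤ n →
    ∀ a : Fin n → ℕ, Function.Injective a → (∀ x, a x < 2 ^ wordSize u n) →
      ∃ e : List Bool, e.length = S n k ∧ e.length < 2 ^ wordSize c n ∧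
        Builds1D (wordSize c n) B n k a e (C n k) ∧
        ∀ i j : Fin n, i ≤ j → Answers1D (wordSize c n) Q n k a e i j (T n k)

open WordRAM in
/-- The program `B` builds the encoding `e` of the `2 × n` array `A` in time at most `t`.
It finds `n` and `k` in registers `0`, `1` and the two rows in memory banks `0`, `1`. -/
def Builds2D (w : ℕ) (B : Cmd) (n k : ℕ) (A : Fin 2 → Fin n → ℕ) (e : List Bool) (t : ℕ) : Prop :=
  ∃ τ s, Cmd.Exec w [] B (State.init [n, k] [List.ofFn (A 0), List.ofFn (A 1)]) τ s ∧
    τ.out = e ∧ s ≤ t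

open WordRAM in
/-- With access to `e` but not to `A`, the program `Q` answers the sorted top-`k` query on
`A[i..j][a..b]`.  It finds `n`, `k`, `i`, `j`, `a`, `b` and the length of `e` in its first
registers, and writes the rows of the answer to memory bank `0` and the columns to
memory bank `1`. -/
def Answers2D (w : ℕ) (Q : Cmd) (n k : ℕ) (A : Fin 2 → Fin n → ℕ) (e : List Bool)
    (i j : Fin 2) (a b : Fin n) : Prop :=
  ∃ τ s, Cmd.Exec w e Q (State.init [n, k, i, j, a, b, e.length] []) τ s ∧
    ∃ L : List (Fin 2 × Fin n),
      IsSortedTopK (fun p => A p.1 p.2) (Finset.Icc i j ×ˢ Finset.Icc a b) k L ∧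
      ∀ l (h : l < L.length), τ.mem 0 l = (L[l].1 : ℕ) ∧ τ.mem 1 l = (L[l].2 : ℕ)

/-!
Suppose the top-`K` answers of the two rows are known, `K = min k n`. It remains to merge, for every
range, the answer of the first row with the answer of the second row, and for this it suffices to know
the comparisons between columns `p` of one row and `q` of the other row that can meet: on the range
spanned by `p` and `q`, fewer than `k` columns of the two rows together are above `p` in its row
or above `q` in its row (`RowOrder.Meet`; the ranks `RowOrder.rk` are indices in the answers of a row).
The encoding consists of the two encodings of the rows and of some of these comparisons, one bit each.

That `4 * n` bits suffice is a matter of choosing the order of the comparisons. The answers of a row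
reveal some comparisons inside the row (`RowOrder.Known`, an acyclic relation), and `RowOrder.ord`
lists the columns in a linear extension of this relation, which encoder and decoder both compute
from the rank table. The two cases `p ≤ q` and `q ≤ p` are treated separately. In the first of them,
the pairs that can meet are gone through in lexicographic order of the positions in the two lists. If
`p` has been found larger than an earlier partner `q'` which it can meet, then it is larger than
the present `q`: both `q` and `q'` have fewer than `K` larger columns of their row between themselves and
`p`, so the answers reveal which of the two is larger (`RowOrder.known_of_meet_right`), and as `q'` comes
first, it is `q'` (`RowOrder.gtAt_of_lt`). Likewise, if `q` has won against an earlier `p'`,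
it wins against `p` (`RowOrder.not_gtAt_of_lt`). So a bit is written only if neither has happened, and
every bit written is the first win of `p` or the first win of `q`, which makes at most `2 * n` bits in
each of the two cases (`Questions.length_bits_le`).

The two programs share the code that makes the comparisons, `WordRAM.compareAll`; it calls a program
`ask` when a bit is needed, which compares the two values and emits the result in the encoder
(`WordRAM.askArray`), and probes the encoding in the decoder (`WordRAM.askString`). The encoder
computes the rank tables from the array in quadratic time; the decoder reads them off the answers to
all queries to the single rows. The programs for one row are run inside the larger programs by
renaming their registers and memory banks (`WordRAM.SimEnv.exec`), with probes shifted to the part of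
the string that encodes the row.
-/

/-! ### A program logic for the word RAM -/

namespace WordRAM

/-- `Run w enc p σ Q`: the program `p` halts from `σ`, and `Q τ t` holds for the final state `τ` and
the running time `t`. -/
def Run (w : ℕ) (enc : List Bool) (p : Cmd) (σ : State) (Q : State → ℕ → Prop) : Prop :=
  ∃ τ t, Cmd.Exec w enc p σ τ t ∧ Q τ t

variable {w : ℕ} {enc : List Bool} {σ : State} {Q : State → ℕ → Prop}

theorem Run.mono {p : Cmd} {Q' : State → ℕ → Prop} (h : Run w enc p σ Q')
    (hQ : ∀ τ t, Q' τ t → Q τ t) : Run w enc p σ Q := by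
  obtain ⟨τ, t, h1, h2⟩ := h
  exact ⟨τ, t, h1, hQ _ _ h2⟩

theorem run_skip : Run w enc .skip σ Q ↔ Q σ 1 := by
  constructor
  · rintro ⟨τ, t, h, hq⟩
    cases h
    exact hq
  · exact fun h => ⟨_, _, .skip σ, h⟩

theorem run_assign {r : ℕ} {e : Expr} : Run w enc (.assign r e) σ Q ↔
    ∃ v, e.eval w enc σ = some v ∧ Q (σ.setReg r v) (e.cost + 1) := by
  constructor
  · rintro ⟨τ, t, h, hq⟩
    cases h with
    | assign _ _ _ v hv => exact ⟨v, hv, hq⟩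
  · rintro ⟨v, hv, h⟩
    exact ⟨_, _, .assign σ r e v hv, h⟩

theorem run_store {b : ℕ} {ea ev : Expr} : Run w enc (.store b ea ev) σ Q ↔
    ∃ a, ea.eval w enc σ = some a ∧ ∃ v, ev.eval w enc σ = some v ∧
      Q (σ.setMem b a v) (ea.cost + ev.cost + 1) := by
  constructor
  · rintro ⟨τ, t, h, hq⟩
    cases h with
    | store _ _ _ _ a v ha hv => exact ⟨a, ha, v, hv, hq⟩
  · rintro ⟨a, ha, v, hv, h⟩
    exact ⟨_, _, .store σ b ea ev a v ha hv, h⟩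

theorem run_emit {ev el : Expr} : Run w enc (.emit ev el) σ Q ↔
    ∃ v, ev.eval w enc σ = some v ∧ ∃ l, el.eval w enc σ = some l ∧ l ≤ w ∧
      Q { σ with out := σ.out ++ lowBits v l } (ev.cost + el.cost + 1) := by
  constructor
  · rintro ⟨τ, t, h, hq⟩
    cases h with
    | emit _ _ _ v l hv hl hlw => exact ⟨v, hv, l, hl, hlw, hq⟩
  · rintro ⟨v, hv, l, hl, hlw, h⟩
    exact ⟨_, _, .emit σ ev el v l hv hl hlw, h⟩

theorem run_seq {p q : Cmd} : Run w enc (.seq p q) σ Q ↔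
    Run w enc p σ fun τ s => Run w enc q τ fun ρ t => Q ρ (s + t) := by
  constructor
  · rintro ⟨τ, t, h, hq⟩
    cases h with
    | seq _ _ _ τ' _ s t hp hq' => exact ⟨τ', s, hp, τ, t, hq', hq⟩
  · rintro ⟨τ, s, h1, ρ, t, h2, h⟩
    exact ⟨_, _, .seq p q σ τ ρ s t h1 h2, h⟩

theorem run_ite {e : Expr} {p q : Cmd} : Run w enc (.ite e p q) σ Q ↔
    ∃ v, e.eval w enc σ = some v ∧
      if v ≠ 0 then Run w enc p σ fun τ t => Q τ (e.cost + 1 + t)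
      else Run w enc q σ fun τ t => Q τ (e.cost + 1 + t) := by
  constructor
  · rintro ⟨τ, t, h, hq⟩
    cases h with
    | iteTrue _ _ _ _ _ v t he hv hp =>
      exact ⟨v, he, by rw [if_pos hv]; exact ⟨_, _, hp, hq⟩⟩
    | iteFalse _ _ _ _ _ t he hp =>
      exact ⟨0, he, by rw [if_neg (by simp)]; exact ⟨_, _, hp, hq⟩⟩
  · rintro ⟨v, hv, h⟩
    split_ifs at h with h0
    · obtain ⟨τ, t, h1, h2⟩ := h
      exact ⟨_, _, .iteTrue e p q σ τ v t hv h0 h1, h2⟩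
    · obtain ⟨τ, t, h1, h2⟩ := h
      rw [not_not] at h0
      subst h0
      exact ⟨_, _, .iteFalse e p q σ τ t hv h1, h2⟩

/-- The rule for `loop`: `Inv d` is an invariant indexed by an upper bound for the number of
remaining rounds. -/
theorem Run.loop {e : Expr} {p : Cmd} {c : ℕ} (Inv : ℕ → State → Prop) (N : ℕ)
    (h0 : Inv N σ)
    (hstep : ∀ d τ, Inv d τ → ∃ v, e.eval w enc τ = some v ∧
      (v ≠ 0 → ∃ d', d = d' + 1 ∧ Run w enc p τ fun τ' t => t ≤ c ∧ Inv d' τ')) :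
    Run w enc (.loop e p) σ fun τ t =>
      t ≤ N * (c + e.cost + 1) + e.cost + 1 ∧ e.eval w enc τ = some 0 ∧ ∃ d, Inv d τ := by
  induction N generalizing σ with
  | zero =>
    obtain ⟨v, hv, h⟩ := hstep _ _ h0
    by_cases hv0 : v = 0
    · subst hv0
      exact ⟨_, _, .loopStop e p σ hv, by simp, hv, _, h0⟩
    · obtain ⟨d', hd, -⟩ := h hv0
      omega
  | succ N ih =>
    obtain ⟨v, hv, h⟩ := hstep _ _ h0
    by_cases hv0 : v = 0
    · subst hv0
      exact ⟨_, _, .loopStop e p σ hv, by nlinarith, hv, _, h0⟩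
    · obtain ⟨d', hd, τ, s, hex, hs, hI⟩ := h hv0
      obtain rfl : N = d' := by omega
      obtain ⟨ρ, t, hex', ht, h3⟩ := ih hI
      refine ⟨ρ, _, .loopStep e p σ τ ρ v s t hv hv0 hex hex', ?_, h3⟩
      nlinarith

/-- Counting loop: `p` is run with register `i` equal to `0, 1, …` below the value of `e`. -/
def Cmd.for (i : ℕ) (e : Expr) (p : Cmd) : Cmd :=
  .seq (.assign i (.const 0)) (.loop (.bin .lt (.reg i) e)
    (.seq p (.assign i (.bin .add (.reg i) (.const 1)))))

theorem word_eq {w v : ℕ} (h : v < 2 ^ w) : word w v = some v := if_pos h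

@[simp]
theorem BinOp.eval_add (x y : ℕ) : BinOp.add.eval x y = x + y := rfl

@[simp]
theorem BinOp.eval_sub (x y : ℕ) : BinOp.sub.eval x y = x - y := rfl

@[simp]
theorem BinOp.eval_mul (x y : ℕ) : BinOp.mul.eval x y = x * y := rfl

@[simp]
theorem BinOp.eval_lt (x y : ℕ) : BinOp.lt.eval x y = if x < y then 1 else 0 := rfl

@[simp]
theorem BinOp.eval_eq (x y : ℕ) : BinOp.eq.eval x y = if x = y then 1 else 0 := rfl

@[simp]
theorem eval_const {c : ℕ} : (Expr.const c).eval w enc σ = word w c := rfl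

@[simp]
theorem eval_reg {r : ℕ} : (Expr.reg r).eval w enc σ = word w (σ.reg r) := rfl

@[simp]
theorem eval_bin {op : BinOp} {e₁ e₂ : Expr} : (Expr.bin op e₁ e₂).eval w enc σ =
    (e₁.eval w enc σ).bind fun x => (e₂.eval w enc σ).bind fun y => word w (op.eval x y) := rfl

@[simp]
theorem eval_load {b : ℕ} {e : Expr} : (Expr.load b e).eval w enc σ =
    (e.eval w enc σ).bind fun a => word w (σ.mem b a) := rfl

@[simp]
theorem State.setReg_reg (σ : State) (r v r' : ℕ) :
    (σ.setReg r v).reg r' = if r' = r then v else σ.reg r' := by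
  simp [State.setReg, Function.update_apply]

@[simp]
theorem State.setReg_mem (σ : State) (r v : ℕ) : (σ.setReg r v).mem = σ.mem := rfl

@[simp]
theorem State.setReg_out (σ : State) (r v : ℕ) : (σ.setReg r v).out = σ.out := rfl

@[simp]
theorem State.setMem_reg (σ : State) (b a v : ℕ) : (σ.setMem b a v).reg = σ.reg := rfl

@[simp]
theorem State.setMem_out (σ : State) (b a v : ℕ) : (σ.setMem b a v).out = σ.out := rfl

theorem State.setMem_mem (σ : State) (b a v b' a' : ℕ) :
    (σ.setMem b a v).mem b' a' = if b' = b ∧ a' = a then v else σ.mem b' a' := by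
  simp only [State.setMem, Function.update_apply]
  by_cases h : b' = b
  · subst h
    simp [Function.update_apply]
  · simp [h]

theorem State.setMem_mem_of_ne (σ : State) {b b' : ℕ} (a v : ℕ) (h : b' ≠ b) :
    (σ.setMem b a v).mem b' = σ.mem b' := by
  simp [State.setMem, h]

theorem Run.for {i N c : ℕ} {e : Expr} {p : Cmd} (Inv : ℕ → State → Prop)
    (hN : N < 2 ^ w)
    (h0 : Inv 0 (σ.setReg i 0))
    (he : ∀ j τ, j ≤ N → Inv j τ → τ.reg i = j ∧ e.eval w enc τ = some N)
    (hstep : ∀ j τ, j < N → τ.reg i = j → Inv j τ → Run w enc p τ fun τ' t =>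
      t ≤ c ∧ τ'.reg i = j ∧ Inv (j + 1) (τ'.setReg i (j + 1)))
    (hQ : ∀ τ t, t ≤ N * (c + e.cost + 7) + e.cost + 5 → Inv N τ → Q τ t) :
    Run w enc (.for i e p) σ Q := by
  have hpos : 0 < 2 ^ w := by positivity
  unfold Cmd.for
  rw [run_seq, run_assign]
  refine ⟨0, by rw [eval_const, word_eq hpos], ?_⟩
  refine Run.mono (Run.loop (c := c + 4) (fun d τ => ∃ j, j + d = N ∧ Inv j τ) N
    ⟨0, by simp, h0⟩ ?_) ?_
  · rintro d τ ⟨j, hj, hI⟩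
    obtain ⟨hi, hev⟩ := he j τ (by omega) hI
    have hlt : (if j < N then 1 else 0) < 2 ^ w := by
      split_ifs
      · omega
      · exact hpos
    refine ⟨if j < N then 1 else 0, ?_, ?_⟩
    · rw [eval_bin, eval_reg, hi, hev, word_eq (by omega)]
      exact word_eq hlt
    · intro hv
      have hjN : j < N := by
        by_contra h
        simp [h] at hv
      refine ⟨d - 1, by omega, ?_⟩
      rw [run_seq]
      refine Run.mono (hstep j τ hjN hi hI) ?_
      rintro τ' t ⟨ht, hi', hI'⟩
      rw [run_assign]
      refine ⟨j + 1, ?_, ?_, j + 1, by omega, hI'⟩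
      · rw [eval_bin, eval_reg, eval_const, hi', word_eq (by omega), word_eq (by omega)]
        exact word_eq (show j + 1 < 2 ^ w by omega)
      · simp only [Expr.cost]
        omega
  · rintro τ t ⟨ht, hev, d, j, hj, hI⟩
    obtain ⟨hi, hev'⟩ := he j τ (by omega) hI
    have : j = N := by
      by_contra hne
      have hjN : j < N := by omega
      rw [eval_bin, eval_reg, hi, hev', word_eq (by omega)] at hev
      simp only [Option.bind_some, BinOp.eval, hjN, if_true] at hev
      rw [word_eq (by omega)] at hev
      simp at hev
    subst this
    refine hQ _ _ ?_ hI
    simp only [Expr.cost] at ht ⊢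
    have : j * (c + 4 + (1 + e.cost + 1) + 1) = j * (c + e.cost + 7) := by ring
    omega

end WordRAM

/-! ### Running a program inside a larger one -/

namespace WordRAM

/-- All registers and banks named in the expression are smaller than `R`. -/
def Expr.Bdd (R : ℕ) : Expr → Prop
  | .const _ => True
  | .reg r => r < R
  | .bin _ e₁ e₂ => e₁.Bdd R ∧ e₂.Bdd R
  | .load b e => b < R ∧ e.Bdd R
  | .probe p l => p.Bdd R ∧ l.Bdd R

/-- All registers and banks named in the program are smaller than `R`. -/
def Cmd.Bdd (R : ℕ) : Cmd → Prop
  | .skip => True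
  | .assign r e => r < R ∧ e.Bdd R
  | .store b ea ev => b < R ∧ ea.Bdd R ∧ ev.Bdd R
  | .emit ev el => ev.Bdd R ∧ el.Bdd R
  | .seq p q => p.Bdd R ∧ q.Bdd R
  | .ite e p q => e.Bdd R ∧ p.Bdd R ∧ q.Bdd R
  | .loop e p => e.Bdd R ∧ p.Bdd R

theorem Expr.Bdd.mono {R R' : ℕ} (h : R ≤ R') (e : Expr) : e.Bdd R → e.Bdd R' := by
  induction e <;> simp only [Expr.Bdd] <;> grind

theorem Cmd.Bdd.mono {R R' : ℕ} (h : R ≤ R') (p : Cmd) : p.Bdd R → p.Bdd R' := by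
  have := fun e => Expr.Bdd.mono h e
  induction p <;> simp only [Cmd.Bdd] <;> grind

theorem Expr.exists_bdd (e : Expr) : ∃ R, e.Bdd R := by
  induction e with
  | const c => exact ⟨0, trivial⟩
  | reg r => exact ⟨r + 1, Nat.lt_succ_self r⟩
  | bin op e₁ e₂ h₁ h₂ =>
    obtain ⟨R₁, h₁⟩ := h₁
    obtain ⟨R₂, h₂⟩ := h₂
    exact ⟨max R₁ R₂, .mono (le_max_left _ _) _ h₁, .mono (le_max_right _ _) _ h₂⟩
  | load b e h =>
    obtain ⟨R, h⟩ := h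
    exact ⟨max (b + 1) R, lt_max_of_lt_left b.lt_succ_self, .mono (le_max_right _ _) _ h⟩
  | probe e₁ e₂ h₁ h₂ =>
    obtain ⟨R₁, h₁⟩ := h₁
    obtain ⟨R₂, h₂⟩ := h₂
    exact ⟨max R₁ R₂, .mono (le_max_left _ _) _ h₁, .mono (le_max_right _ _) _ h₂⟩

theorem Cmd.exists_bdd (p : Cmd) : ∃ R, p.Bdd R := by
  induction p with
  | skip => exact ⟨0, trivial⟩
  | assign r e =>
    obtain ⟨R, h⟩ := e.exists_bdd
    exact ⟨max (r + 1) R, lt_max_of_lt_left r.lt_succ_self, .mono (le_max_right _ _) _ h⟩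
  | store b ea ev =>
    obtain ⟨R₁, h₁⟩ := ea.exists_bdd
    obtain ⟨R₂, h₂⟩ := ev.exists_bdd
    exact ⟨max (b + 1) (max R₁ R₂), lt_max_of_lt_left b.lt_succ_self, .mono (by simp) _ h₁,
      .mono (by simp) _ h₂⟩
  | emit ea ev =>
    obtain ⟨R₁, h₁⟩ := ea.exists_bdd
    obtain ⟨R₂, h₂⟩ := ev.exists_bdd
    exact ⟨max R₁ R₂, .mono (by simp) _ h₁, .mono (by simp) _ h₂⟩
  | seq p q h₁ h₂ =>
    obtain ⟨R₁, h₁⟩ := h₁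
    obtain ⟨R₂, h₂⟩ := h₂
    exact ⟨max R₁ R₂, .mono (by simp) _ h₁, .mono (by simp) _ h₂⟩
  | ite e p q h₁ h₂ =>
    obtain ⟨R, h⟩ := e.exists_bdd
    obtain ⟨R₁, h₁⟩ := h₁
    obtain ⟨R₂, h₂⟩ := h₂
    exact ⟨max R (max R₁ R₂), .mono (by simp) _ h, .mono (by simp) _ h₁, .mono (by simp) _ h₂⟩
  | loop e p h₁ =>
    obtain ⟨R, h⟩ := e.exists_bdd
    obtain ⟨R₁, h₁⟩ := h₁
    exact ⟨max R R₁, .mono (by simp) _ h, .mono (by simp) _ h₁⟩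

/-- Renaming of registers by `ρ` and of banks by `β`; probes are shifted by the contents of
register `base`. -/
def Expr.ren (ρ β : ℕ → ℕ) (base : ℕ) : Expr → Expr
  | .const c => .const c
  | .reg r => .reg (ρ r)
  | .bin op e₁ e₂ => .bin op (e₁.ren ρ β base) (e₂.ren ρ β base)
  | .load b e => .load (β b) (e.ren ρ β base)
  | .probe p l => .probe (.bin .add (.reg base) (p.ren ρ β base)) (l.ren ρ β base)

/-- Renaming of registers by `ρ` and of banks by `β`; probes are shifted by the contents of
register `base`. -/
def Cmd.ren (ρ β : ℕ → ℕ) (base : ℕ) : Cmd → Cmd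
  | .skip => .skip
  | .assign r e => .assign (ρ r) (e.ren ρ β base)
  | .store b ea ev => .store (β b) (ea.ren ρ β base) (ev.ren ρ β base)
  | .emit ev el => .emit (ev.ren ρ β base) (el.ren ρ β base)
  | .seq p q => .seq (p.ren ρ β base) (q.ren ρ β base)
  | .ite e p q => .ite (e.ren ρ β base) (p.ren ρ β base) (q.ren ρ β base)
  | .loop e p => .loop (e.ren ρ β base) (p.ren ρ β base)

theorem Expr.cost_ren_le (ρ β : ℕ → ℕ) (base : ℕ) (e : Expr) :
    (e.ren ρ β base).cost ≤ 3 * e.cost := by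
  induction e <;> simp only [Expr.ren, Expr.cost] <;> omega

/-- The state `σ'` contains a renamed copy of the registers and banks of `σ` below `R`, as far as
cells with addresses below `M` are concerned. -/
structure Embeds (M R : ℕ) (ρ β : ℕ → ℕ) (σ σ' : State) : Prop where
  reg : ∀ r < R, σ'.reg (ρ r) = σ.reg r
  mem : ∀ b < R, ∀ a < M, σ'.mem (β b) a = σ.mem b a

theorem bitsToNat_lt (l : List Bool) : bitsToNat l < 2 ^ l.length := by
  induction l with
  | nil => simp [bitsToNat]
  | cons b l ih =>
    have : b.toNat ≤ 1 := Bool.toNat_le b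
    simp only [bitsToNat, List.length_cons, pow_succ]
    omega

theorem word_eq_some {w v x : ℕ} (h : word w v = some x) : v = x ∧ x < 2 ^ w := by
  unfold word at h
  split_ifs at h with h1
  simp only [Option.some.injEq] at h
  exact ⟨h, h ▸ h1⟩

theorem Expr.eval_lt {w : ℕ} {enc : List Bool} {σ : State} {e : Expr} {v : ℕ}
    (h : e.eval w enc σ = some v) : v < 2 ^ w := by
  cases e with
  | const c => exact (word_eq_some h).2
  | reg r => exact (word_eq_some h).2
  | bin op e₁ e₂ =>
    simp only [eval_bin, Option.bind_eq_some_iff] at h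
    obtain ⟨x, -, y, -, h⟩ := h
    exact (word_eq_some h).2
  | load b e =>
    simp only [eval_load, Option.bind_eq_some_iff] at h
    obtain ⟨x, -, h⟩ := h
    exact (word_eq_some h).2
  | probe p l =>
    simp only [Expr.eval, Option.bind_eq_bind, Option.bind_eq_some_iff] at h
    obtain ⟨a, -, m, -, h⟩ := h
    split_ifs at h with h1
    simp only [Option.some.injEq] at h
    rw [← h]
    refine (bitsToNat_lt _).trans_le (Nat.pow_le_pow_right (by norm_num) ?_)
    simp only [List.length_take]
    omega

/-- The standing assumptions of a simulation: the simulated machine has shorter words, and its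
encoding is the part of the actual one that starts at the address stored in register `base`. -/
structure SimEnv (w w' : ℕ) (enc enc' : List Bool) (ρ β : ℕ → ℕ) (base off : ℕ) : Prop where
  le : w ≤ w'
  inj_reg : Function.Injective ρ
  inj_bank : Function.Injective β
  base_notMem : ∀ r, ρ r ≠ base
  length_lt : enc'.length < 2 ^ w'
  length_le : off + enc.length ≤ enc'.length
  part : (enc'.drop off).take enc.length = enc

variable {w w' : ℕ} {enc enc' : List Bool} {ρ β : ℕ → ℕ} {base off R M : ℕ}

theorem SimEnv.word (hS : SimEnv w w' enc enc' ρ β base off) {v x : ℕ}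
    (h : word w v = some x) : word w' v = some x := by
  obtain ⟨rfl, h⟩ := word_eq_some h
  exact word_eq (h.trans_le (Nat.pow_le_pow_right (by norm_num) hS.le))

theorem SimEnv.eval (hS : SimEnv w w' enc enc' ρ β base off) (hM : 2 ^ w ≤ M) {σ σ' : State}
    (hE : Embeds M R ρ β σ σ') (hb : σ'.reg base = off) (e : Expr) (he : e.Bdd R) {v : ℕ}
    (h : e.eval w enc σ = some v) : (e.ren ρ β base).eval w' enc' σ' = some v := by
  induction e generalizing v with
  | const c => exact hS.word h
  | reg r =>
    rw [Expr.ren, eval_reg, hE.reg r he]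
    exact hS.word h
  | bin op e₁ e₂ h₁ h₂ =>
    simp only [eval_bin, Option.bind_eq_some_iff] at h
    obtain ⟨x, hx, y, hy, h⟩ := h
    rw [Expr.ren, eval_bin, h₁ he.1 hx, h₂ he.2 hy]
    exact hS.word h
  | load b e ih =>
    simp only [eval_load, Option.bind_eq_some_iff] at h
    obtain ⟨x, hx, h⟩ := h
    rw [Expr.ren, eval_load, ih he.2 hx, Option.bind_some, hE.mem b he.1 x ((Expr.eval_lt hx).trans_le hM)]
    exact hS.word h
  | probe p l h₁ h₂ =>
    simp only [Expr.eval, Option.bind_eq_bind, Option.bind_eq_some_iff] at h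
    obtain ⟨a, ha, m, hm, h⟩ := h
    split_ifs at h with h1
    have h3 := hS.length_le
    have h4 := hS.length_lt
    simp only [Expr.ren, Expr.eval, Option.bind_eq_bind, h₁ he.1 ha, h₂ he.2 hm, hb,
      Option.bind_some, BinOp.eval]
    rw [word_eq (by omega), Option.bind_some, word_eq (by omega), Option.bind_some,
      if_pos ⟨h1.1.trans hS.le, by omega⟩, ← h]
    congr 2
    conv_rhs => rw [← hS.part]
    rw [List.drop_take, List.drop_drop, List.take_take, min_eq_left (by omega)]

theorem Embeds.setReg (hi : Function.Injective ρ) {σ σ' : State} (h : Embeds M R ρ β σ σ')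
    (r v : ℕ) : Embeds M R ρ β (σ.setReg r v) (σ'.setReg (ρ r) v) where
  reg r' hr' := by
    simp only [State.setReg_reg, hi.eq_iff, h.reg r' hr']
  mem := h.mem

theorem Embeds.setMem (hi : Function.Injective β) {σ σ' : State} (h : Embeds M R ρ β σ σ')
    (b a v : ℕ) : Embeds M R ρ β (σ.setMem b a v) (σ'.setMem (β b) a v) where
  reg := h.reg
  mem b' hb' a' ha' := by
    simp only [State.setMem_mem, hi.eq_iff, h.mem b' hb' a' ha']

/-- What a simulated run leaves alone, and what it appends to the output. -/
structure SimFrame (M R : ℕ) (ρ β : ℕ → ℕ) (l : List Bool) (τ σ' τ' : State) : Prop where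
  embeds : Embeds M R ρ β τ τ'
  reg : ∀ r, (∀ s, ρ s ≠ r) → τ'.reg r = σ'.reg r
  mem : ∀ b, (∀ s, β s ≠ b) → τ'.mem b = σ'.mem b
  out : τ'.out = σ'.out ++ l

theorem SimFrame.trans {l₁ l₂ : List Bool} {τ₁ τ₂ σ₀ σ₁ σ₂ : State}
    (h₁ : SimFrame M R ρ β l₁ τ₁ σ₀ σ₁) (h₂ : SimFrame M R ρ β l₂ τ₂ σ₁ σ₂) :
    SimFrame M R ρ β (l₁ ++ l₂) τ₂ σ₀ σ₂ where
  embeds := h₂.embeds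
  reg r hr := (h₂.reg r hr).trans (h₁.reg r hr)
  mem b hb := (h₂.mem b hb).trans (h₁.mem b hb)
  out := by rw [h₂.out, h₁.out, List.append_assoc]

/-- A renamed program simulates the original one with constant slowdown. -/
theorem SimEnv.exec (hS : SimEnv w w' enc enc' ρ β base off) (hM : 2 ^ w ≤ M) {p : Cmd} {σ τ : State} {t : ℕ}
    (h : Cmd.Exec w enc p σ τ t) (hp : p.Bdd R) (σ' : State) (hE : Embeds M R ρ β σ σ')
    (hb : σ'.reg base = off) :
    ∃ l, τ.out = σ.out ++ l ∧ Run w' enc' (p.ren ρ β base) σ' fun τ' t' =>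
      t' ≤ 3 * t ∧ SimFrame M R ρ β l τ σ' τ' := by
  have hcost := Expr.cost_ren_le ρ β base
  induction h generalizing σ' with
  | skip σ =>
    exact ⟨[], by simp, _, _, .skip _, by norm_num, hE, by simp, by simp, by simp⟩
  | assign σ r e v hv =>
    refine ⟨[], by simp [State.setReg], _, _, .assign σ' (ρ r) _ v (hS.eval hM hE hb e hp.2 hv),
      by have := hcost e; omega, hE.setReg hS.inj_reg r v, ?_, by simp [State.setReg],
      by simp [State.setReg]⟩
    intro r' hr'
    rw [State.setReg_reg, if_neg (fun h => hr' r h.symm)]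
  | store σ b ea ev a v ha hv =>
    refine ⟨[], by simp [State.setMem], _, _, .store σ' (β b) _ _ a v (hS.eval hM hE hb ea hp.2.1 ha)
      (hS.eval hM hE hb ev hp.2.2 hv), by have := hcost ea; have := hcost ev; omega,
      hE.setMem hS.inj_bank b a v, by simp [State.setMem], ?_, by simp [State.setMem]⟩
    intro b' hb'
    rw [State.setMem_mem_of_ne _ _ _ (fun h => hb' b h.symm)]
  | emit σ ev el v l hv hl hlw =>
    exact ⟨lowBits v l, rfl, _, _, .emit σ' _ _ v l (hS.eval hM hE hb ev hp.1 hv)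
      (hS.eval hM hE hb el hp.2 hl) (hlw.trans hS.le),
      by have := hcost ev; have := hcost el; omega, ⟨hE.reg, hE.mem⟩, by simp, by simp, rfl⟩
  | seq p q σ τ ρ' s t _ _ ih₁ ih₂ =>
    obtain ⟨l₁, hl₁, τ', s', hex₁, hs, hF₁⟩ := ih₁ hp.1 σ' hE hb
    obtain ⟨l₂, hl₂, ρ'', t', hex₂, ht, hF₂⟩ := ih₂ hp.2 τ' hF₁.embeds
      ((hF₁.reg base hS.base_notMem).trans hb)
    exact ⟨l₁ ++ l₂, by rw [hl₂, hl₁, List.append_assoc], _, _, .seq _ _ _ _ _ _ _ hex₁ hex₂,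
      by omega, hF₁.trans hF₂⟩
  | iteTrue e p q σ τ v t he hv _ ih =>
    obtain ⟨l, hl, τ', t', hex, ht, hF⟩ := ih hp.2.1 σ' hE hb
    exact ⟨l, hl, _, _, .iteTrue _ _ _ _ _ v _ (hS.eval hM hE hb e hp.1 he) hv hex,
      by have := hcost e; omega, hF⟩
  | iteFalse e p q σ τ t he _ ih =>
    obtain ⟨l, hl, τ', t', hex, ht, hF⟩ := ih hp.2.2 σ' hE hb
    exact ⟨l, hl, _, _, .iteFalse _ _ _ _ _ _ (hS.eval hM hE hb e hp.1 he) hex,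
      by have := hcost e; omega, hF⟩
  | loopStop e p σ he =>
    exact ⟨[], by simp, _, _, .loopStop _ _ _ (hS.eval hM hE hb e hp.1 he),
      by have := hcost e; omega, hE, by simp, by simp, by simp⟩
  | loopStep e p σ τ ρ' v s t he hv _ _ ih₁ ih₂ =>
    obtain ⟨l₁, hl₁, τ', s', hex₁, hs, hF₁⟩ := ih₁ hp.2 σ' hE hb
    obtain ⟨l₂, hl₂, ρ'', t', hex₂, ht, hF₂⟩ := ih₂ hp τ' hF₁.embeds
      ((hF₁.reg base hS.base_notMem).trans hb)
    exact ⟨l₁ ++ l₂, by rw [hl₂, hl₁, List.append_assoc], _, _,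
      .loopStep _ _ _ _ _ v _ _ (hS.eval hM hE hb e hp.1 he) hv hex₁ hex₂,
      by have := hcost e; omega, hF₁.trans hF₂⟩

end WordRAM

/-! ### Ranks of columns and the comparisons that one row determines -/

namespace RowOrder

/-- The number of columns between `p` and `q` whose value is larger than the value at `p`. -/
def above (A : ℕ → ℕ) (p q : ℕ) : ℕ := ((Finset.uIcc p q).filter fun c => A p < A c).card

/-- The number `above A p q`, cut off at `K`. It is the index of `p` in the sorted top-`K` list of the
range spanned by `p` and `q`, or `K` if `p` is not in this list. -/
def rk (A : ℕ → ℕ) (K p q : ℕ) : ℕ := min K (above A p q)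

/-- The top-`K` answers of the row reveal that the value at `c'` is larger than the value at `c`. -/
def Known (A : ℕ → ℕ) (K c' c : ℕ) : Prop := rk A K c' c < rk A K c c'

theorem above_le {A : ℕ → ℕ} {p q p' q' : ℕ} (hp : A p' ≤ A p)
    (hs : Finset.uIcc p q ⊆ Finset.uIcc p' q') : above A p q ≤ above A p' q' := by
  apply Finset.card_le_card
  intro c
  simp only [Finset.mem_filter]
  exact fun h => ⟨hs h.1, hp.trans_lt h.2⟩

theorem above_lt {A : ℕ → ℕ} {p q : ℕ} (h : A p < A q) : above A q p < above A p q := by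
  apply Finset.card_lt_card
  rw [Finset.ssubset_iff_of_subset]
  · exact ⟨q, by simp [h], by simp⟩
  · intro c
    simp only [Finset.mem_filter, Finset.uIcc_comm q p]
    exact fun h' => ⟨h'.1, h.trans h'.2⟩

theorem known_iff {A : ℕ → ℕ} {K c' c : ℕ} :
    Known A K c' c ↔ A c < A c' ∧ above A c' c < K := by
  unfold Known rk
  rcases lt_or_ge (A c) (A c') with h | h
  · have := above_lt h
    simp only [h, true_and]
    omega
  · have : above A c c' ≤ above A c' c := above_le h (by rw [Finset.uIcc_comm])
    simp only [not_lt.mpr h, false_and, iff_false]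
    omega

theorem above_lt_of_lt {A : ℕ → ℕ} {n p q : ℕ} (hp : p < n) (hq : q < n) : above A p q < n := by
  have : above A p q < (Finset.range n).card := by
    apply Finset.card_lt_card
    rw [Finset.ssubset_iff_of_subset]
    · exact ⟨p, by simp [hp], by simp⟩
    · intro c
      simp only [Finset.mem_filter, Finset.mem_uIcc, Finset.mem_range]
      omega
  simpa using this

/-! ### Extending the known comparisons of a row to a linear order -/

variable (G : ℕ → ℕ → Prop) (n : ℕ)

/-- The least column outside `U` that no column outside `U` has to precede, where `G c' c` means that
`c'` has to precede `c`. -/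
noncomputable def next (U : Finset ℕ) : ℕ := sInf {m | m ∉ U ∧ ∀ c < n, c ∉ U → ¬G c m}

/-- The columns chosen in the first rounds. -/
noncomputable def taken : ℕ → Finset ℕ
  | 0 => ∅
  | s + 1 => insert (next G n (taken s)) (taken s)

/-- The column chosen in round `s`. On `0, …, n - 1` this is a permutation in which `c'` precedes `c`
whenever `G c' c`. -/
noncomputable def order (s : ℕ) : ℕ := next G n (taken G n s)

variable {G n} {A : ℕ → ℕ}

theorem next_spec (hG : ∀ c' c, G c' c → A c < A c') {U : Finset ℕ} (hU : U.card < n) :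
    next G n U < n ∧ next G n U ∉ U ∧ (∀ c < n, c ∉ U → ¬G c (next G n U)) ∧
      ∀ m < next G n U, m ∉ U → ∃ c < n, c ∉ U ∧ G c m := by
  obtain ⟨c₀, hc₀, hc₀U⟩ : ∃ c ∈ Finset.range n, c ∉ U :=
    Finset.exists_mem_notMem_of_card_lt_card (by simpa using hU)
  -- a column of largest value outside `U` is preceded by none outside `U`
  obtain ⟨m, hm, hmax⟩ := ((Finset.range n) \ U).exists_max_image A ⟨c₀, by simp_all⟩
  simp only [Finset.mem_sdiff, Finset.mem_range] at hm hmax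
  have hmem : m ∈ {m | m ∉ U ∧ ∀ c < n, c ∉ U → ¬G c m} :=
    ⟨hm.2, fun c hc hcU h => absurd (hG _ _ h) (not_lt.mpr (hmax c ⟨hc, hcU⟩))⟩
  have hs := Nat.sInf_mem ⟨m, hmem⟩
  refine ⟨(Nat.sInf_le hmem).trans_lt hm.1, hs.1, hs.2, fun m' hm' hm'U => ?_⟩
  by_contra! hcon
  exact absurd (Nat.sInf_le (s := {m | m ∉ U ∧ ∀ c < n, c ∉ U → ¬G c m}) ⟨hm'U, hcon⟩)
    (not_le.mpr hm')

theorem taken_eq (s : ℕ) : taken G n s = (Finset.range s).image (order G n) := by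
  induction s with
  | zero => simp [taken]
  | succ s ih => rw [taken, Finset.range_add_one, Finset.image_insert, ← ih]; rfl

theorem card_taken (hG : ∀ c' c, G c' c → A c < A c') {s : ℕ} (hs : s ≤ n) :
    (taken G n s).card = s := by
  induction s with
  | zero => simp [taken]
  | succ s ih =>
    have h := ih (by omega)
    rw [taken, Finset.card_insert_of_notMem (next_spec hG (by omega)).2.1, h]

theorem order_spec (hG : ∀ c' c, G c' c → A c < A c') {s : ℕ} (hs : s < n) :
    order G n s < n ∧ order G n s ∉ taken G n s ∧
      (∀ c < n, c ∉ taken G n s → ¬G c (order G n s)) ∧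
      ∀ m < order G n s, m ∉ taken G n s → ∃ c < n, c ∉ taken G n s ∧ G c m :=
  next_spec hG (by rw [card_taken hG hs.le]; exact hs)

theorem order_inj (hG : ∀ c' c, G c' c → A c < A c') {s t : ℕ} (hs : s < n) (ht : t < n)
    (h : order G n s = order G n t) : s = t := by
  wlog hst : s < t generalizing s t
  · rcases (not_lt.mp hst).lt_or_eq with h' | h'
    · exact (this ht hs h.symm h').symm
    · exact h'.symm
  · refine absurd ?_ (order_spec hG ht).2.1
    rw [taken_eq, Finset.mem_image]
    exact ⟨s, by simpa using hst, h⟩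

theorem lt_of_order (hG : ∀ c' c, G c' c → A c < A c') {s t : ℕ} (hs : s < n) (ht : t < n)
    (h : G (order G n t) (order G n s)) : t < s := by
  by_contra hts
  refine (order_spec hG hs).2.2.1 _ (order_spec hG ht).1 ?_ h
  rw [taken_eq, Finset.mem_image]
  rintro ⟨t', ht', h'⟩
  rw [Finset.mem_range] at ht'
  have := order_inj hG (by omega) ht h'
  omega

theorem exists_order (hG : ∀ c' c, G c' c → A c < A c') {p : ℕ} (hp : p < n) :
    ∃ s < n, order G n s = p := by
  have h : taken G n n = Finset.range n := by
    apply Finset.eq_of_subset_of_card_le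
    · rw [taken_eq]
      intro c
      simp only [Finset.mem_image, Finset.mem_range]
      rintro ⟨s, hs, rfl⟩
      exact (order_spec hG hs).1
    · simp [card_taken hG le_rfl]
  have hp' : p ∈ taken G n n := by simpa [h] using hp
  rw [taken_eq, Finset.mem_image] at hp'
  obtain ⟨s, hs, h⟩ := hp'
  exact ⟨s, by simpa using hs, h⟩

end RowOrder

/-! ### Comparing two chains of columns with few questions -/

namespace Questions

/-- Rows `s` and columns `t` of a grid of comparisons. `N s t` says that the outcome of the
comparison is needed, `G s t` that `s` wins. The needed comparison is asked unless `s` has won against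
an earlier `t'` or `t` has won against an earlier `s'`. -/
def Asked (N G : ℕ → ℕ → Prop) (s t : ℕ) : Prop :=
  N s t ∧ (∀ t' < t, N s t' → ¬G s t') ∧ ∀ s' < s, N s' t → G s' t

open Classical in
/-- The answers to the questions about `s` and the columns before `T`. -/
noncomputable def rowBits (N G : ℕ → ℕ → Prop) (s T : ℕ) : List Bool :=
  (List.range T).flatMap fun t => if Asked N G s t then [decide (G s t)] else []

/-- The answers to the questions about all rows before `S`, in lexicographic order. -/
noncomputable def bits (N G : ℕ → ℕ → Prop) (n S : ℕ) : List Bool :=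
  (List.range S).flatMap fun s => rowBits N G s n

variable {N G : ℕ → ℕ → Prop}

open Classical in
theorem rowBits_succ (s T : ℕ) : rowBits N G s (T + 1) =
    rowBits N G s T ++ if Asked N G s T then [decide (G s T)] else [] := by
  simp [rowBits, List.range_succ]

theorem bits_succ (n S : ℕ) : bits N G n (S + 1) = bits N G n S ++ rowBits N G S n := by
  simp [bits, List.range_succ]

theorem rowBits_prefix {s T T' : ℕ} (h : T ≤ T') : rowBits N G s T <+: rowBits N G s T' := by
  induction T', h using Nat.le_induction with
  | base => exact List.prefix_rfl
  | succ T' _ ih => exact ih.trans (by rw [rowBits_succ]; exact List.prefix_append _ _)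

theorem bits_prefix {n S S' : ℕ} (h : S ≤ S') : bits N G n S <+: bits N G n S' := by
  induction S', h using Nat.le_induction with
  | base => exact List.prefix_rfl
  | succ S' _ ih => exact ih.trans (by rw [bits_succ]; exact List.prefix_append _ _)

theorem bits_append_rowBits_prefix {n s T : ℕ} (hs : s < n) (hT : T ≤ n) :
    bits N G n s ++ rowBits N G s T <+: bits N G n n := by
  refine List.IsPrefix.trans ?_ (bits_prefix (Nat.succ_le_of_lt hs))
  rw [bits_succ]
  exact (List.prefix_append_right_inj _).mpr (rowBits_prefix hT)

open Classical in
/-- Every answer is the first win of `s` or the first win of `t`. -/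
theorem length_bits_le (n : ℕ) : (bits N G n n).length ≤ 2 * n := by
  have h1 : (bits N G n n).length = ((Finset.range n ×ˢ Finset.range n).filter
      fun x => Asked N G x.1 x.2).card := by
    have hrow : ∀ s T, (rowBits N G s T).length =
        ∑ t ∈ Finset.range T, if Asked N G s t then 1 else 0 := by
      intro s T
      induction T with
      | zero => rfl
      | succ T ih =>
        rw [rowBits_succ, List.length_append, ih, Finset.sum_range_succ]
        split_ifs <;> rfl
    have hall : ∀ S, (bits N G n S).length =
        ∑ s ∈ Finset.range S, ∑ t ∈ Finset.range n, if Asked N G s t then 1 else 0 := by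
      intro S
      induction S with
      | zero => rfl
      | succ S ih => rw [bits_succ, List.length_append, ih, Finset.sum_range_succ, hrow]
    rw [Finset.card_filter, Finset.sum_product, hall]
  rw [h1, ← Finset.card_filter_add_card_filter_not (fun x => G x.1 x.2), two_mul]
  gcongr
  · rw [Finset.filter_filter]
    conv_rhs => rw [← Finset.card_range n]
    refine Finset.card_le_card_of_injOn Prod.fst ?_ ?_
    · intro x
      simp +contextual
    · rintro ⟨s, t⟩ h ⟨s', t'⟩ h' (rfl : s = s')
      replace h := (Finset.mem_filter.mp h).2
      replace h' := (Finset.mem_filter.mp h').2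
      rcases lt_trichotomy t t' with hlt | rfl | hlt
      · exact absurd h.2 (h'.1.2.1 t hlt h.1.1)
      · rfl
      · exact absurd h'.2 (h.1.2.1 t' hlt h'.1.1)
  · rw [Finset.filter_filter]
    conv_rhs => rw [← Finset.card_range n]
    refine Finset.card_le_card_of_injOn Prod.snd ?_ ?_
    · intro x
      simp +contextual
    · rintro ⟨s, t⟩ h ⟨s', t'⟩ h' (rfl : t = t')
      replace h := (Finset.mem_filter.mp h).2
      replace h' := (Finset.mem_filter.mp h').2
      rcases lt_trichotomy s s' with hlt | rfl | hlt
      · exact absurd (h'.1.2.2 s hlt h.1.1) h.2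
      · rfl
      · exact absurd (h.1.2.2 s' hlt h'.1.1) h'.2

end Questions

namespace RowOrder

/-- The columns `p` of row `A` and `q` of row `A'` may meet as the heads of the two lists
when top-`k` lists are merged. -/
def Meet (A A' : ℕ → ℕ) (k K p q : ℕ) : Prop := p ≤ q ∧ rk A K p q + rk A' K q p < k

variable {A A' : ℕ → ℕ} {k n K : ℕ}

theorem above_lt_of_rk_lt {p q : ℕ} (hK : K = min k n) (hp : p < n) (hq : q < n)
    (h : rk A K p q < k) : above A p q < K := by
  have := above_lt_of_lt (A := A) hp hq
  unfold rk at h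
  omega

/-- The columns to the right of `p` that may meet `p` are totally ordered by known comparisons. -/
theorem known_of_meet_right (hK : K = min k n) {p q q' : ℕ} (hp : p < n) (hq : q < n)
    (hq' : q' < n) (h : Meet A A' k K p q) (h' : Meet A A' k K p q') (hlt : A' q' < A' q) :
    Known A' K q q' := by
  rw [known_iff]
  refine ⟨hlt, ?_⟩
  have h1 := above_lt_of_rk_lt hK hq hp (A := A') (lt_of_le_of_lt (Nat.le_add_left _ _) h.2)
  have h2 := above_lt_of_rk_lt hK hq' hp (A := A') (lt_of_le_of_lt (Nat.le_add_left _ _) h'.2)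
  have hpq := h.1
  have hpq' := h'.1
  rcases le_total q' q with hle | hle
  · refine lt_of_le_of_lt (above_le le_rfl ?_) h1
    intro c
    simp only [Finset.mem_uIcc]
    omega
  · refine lt_of_le_of_lt (above_le hlt.le ?_) h2
    intro c
    simp only [Finset.mem_uIcc]
    omega

/-- The columns to the left of `q` that may meet `q` are totally ordered by known comparisons. -/
theorem known_of_meet_left (hK : K = min k n) {p p' q : ℕ} (hp : p < n) (hp' : p' < n)
    (hq : q < n) (h : Meet A A' k K p q) (h' : Meet A A' k K p' q) (hlt : A p' < A p) :
    Known A K p p' := by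
  rw [known_iff]
  refine ⟨hlt, ?_⟩
  have h1 := above_lt_of_rk_lt hK hp hq (A := A) (lt_of_le_of_lt (Nat.le_add_right _ _) h.2)
  have h2 := above_lt_of_rk_lt hK hp' hq (A := A) (lt_of_le_of_lt (Nat.le_add_right _ _) h'.2)
  have hpq := h.1
  have hpq' := h'.1
  rcases le_total p p' with hle | hle
  · refine lt_of_le_of_lt (above_le le_rfl ?_) h1
    intro c
    simp only [Finset.mem_uIcc]
    omega
  · refine lt_of_le_of_lt (above_le hlt.le ?_) h2
    intro c
    simp only [Finset.mem_uIcc]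
    omega

theorem known_imp {A : ℕ → ℕ} {K : ℕ} (c' c : ℕ) (h : Known A K c' c) : A c < A c' :=
  (known_iff.mp h).1

/-- The columns of a row in the order in which they are compared with the other row. -/
noncomputable def ord (A : ℕ → ℕ) (K n : ℕ) : ℕ → ℕ := order (Known A K) n

theorem ord_lt {s : ℕ} (hs : s < n) : ord A K n s < n := (order_spec known_imp hs).1

theorem ord_inj {s t : ℕ} (hs : s < n) (ht : t < n) (h : ord A K n s = ord A K n t) : s = t :=
  order_inj known_imp hs ht h

/-- `Meet` for the columns with given positions in the orders of their rows. -/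
def MeetAt (A A' : ℕ → ℕ) (k K n s t : ℕ) : Prop :=
  Meet A A' k K (ord A K n s) (ord A' K n t)

/-- The comparison of the columns with given positions in the orders of their rows. -/
def GtAt (A A' : ℕ → ℕ) (K n s t : ℕ) : Prop := A' (ord A' K n t) < A (ord A K n s)

theorem gtAt_of_lt (hK : K = min k n) {s t t' : ℕ} (hs : s < n)
    (ht : t < n) (htt : t' < t) (h' : MeetAt A A' k K n s t') (hG : GtAt A A' K n s t')
    (h : MeetAt A A' k K n s t) : GtAt A A' K n s t := by
  refine lt_of_le_of_lt ?_ hG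
  by_contra! hlt
  have := lt_of_order known_imp (htt.trans ht) ht (known_of_meet_right hK (ord_lt hs) (ord_lt ht)
    (ord_lt (htt.trans ht)) h h' hlt)
  omega

theorem not_gtAt_of_lt (hK : K = min k n) {s s' t : ℕ} (hs : s < n)
    (ht : t < n) (hss : s' < s) (h' : MeetAt A A' k K n s' t) (hG : ¬GtAt A A' K n s' t)
    (h : MeetAt A A' k K n s t) : ¬GtAt A A' K n s t := by
  unfold GtAt at *
  rw [not_lt] at *
  refine le_trans ?_ hG
  by_contra! hlt
  have := lt_of_order known_imp (hss.trans hs) hs (known_of_meet_left hK (ord_lt hs)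
    (ord_lt (hss.trans hs)) (ord_lt ht) h h' hlt)
  omega

/-! ### Sorted top-k lists of a row -/

/-- The first `min K (b + 1 - a)` values of `f` are the sorted top-`K` list of the range from `a`
to `b`. -/
structure IsTop (A : ℕ → ℕ) (K a b : ℕ) (f : ℕ → ℕ) : Prop where
  mem : ∀ l < min K (b + 1 - a), a ≤ f l ∧ f l ≤ b
  anti : ∀ l < min K (b + 1 - a), ∀ l' < l, A (f l) < A (f l')
  lt_of_ne : ∀ c, a ≤ c → c ≤ b → (∀ l < min K (b + 1 - a), f l ≠ c) →
    ∀ l < min K (b + 1 - a), A c < A (f l)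

theorem IsTop.inj {a b : ℕ} {f : ℕ → ℕ} (h : IsTop A K a b f) {l l' : ℕ}
    (hl : l < min K (b + 1 - a)) (hl' : l' < min K (b + 1 - a)) (he : f l = f l') : l = l' := by
  rcases lt_trichotomy l l' with hlt | rfl | hlt
  · have := h.anti l' hl' l hlt
    rw [he] at this
    omega
  · rfl
  · have := h.anti l hl l' hlt
    rw [he] at this
    omega

theorem IsTop.filter_eq {a b : ℕ} {f : ℕ → ℕ} (h : IsTop A K a b f) {l : ℕ}
    (hl : l < min K (b + 1 - a)) :
    ((Finset.Icc a b).filter fun c => A (f l) < A c) = (Finset.range l).image f := by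
  ext c
  simp only [Finset.mem_filter, Finset.mem_Icc, Finset.mem_image, Finset.mem_range]
  constructor
  · rintro ⟨⟨h1, h2⟩, h3⟩
    by_contra! hcon
    by_cases hex : ∃ l' < min K (b + 1 - a), f l' = c
    · obtain ⟨l', hl', rfl⟩ := hex
      rcases lt_trichotomy l' l with hlt | rfl | hlt
      · exact hcon l' hlt rfl
      · omega
      · have := h.anti l' hl' l hlt
        omega
    · push Not at hex
      have := h.lt_of_ne c h1 h2 hex l hl
      omega
  · rintro ⟨l', hl', rfl⟩
    exact ⟨h.mem l' (by omega), h.anti l hl l' hl'⟩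

theorem IsTop.card_filter {a b : ℕ} {f : ℕ → ℕ} (h : IsTop A K a b f) {l : ℕ}
    (hl : l < min K (b + 1 - a)) :
    ((Finset.Icc a b).filter fun c => A (f l) < A c).card = l := by
  rw [h.filter_eq hl, Finset.card_image_of_injOn, Finset.card_range]
  intro x hx y hy hxy
  simp only [Finset.coe_range, Set.mem_Iio] at hx hy
  exact h.inj (by omega) (by omega) hxy

theorem IsTop.exists_of_le {a b : ℕ} {f : ℕ → ℕ} (h : IsTop A K a b f) (hK : b + 1 - a ≤ K)
    {c : ℕ} (h1 : a ≤ c) (h2 : c ≤ b) : ∃ l < min K (b + 1 - a), f l = c := by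
  have himg : (Finset.range (min K (b + 1 - a))).image f = Finset.Icc a b := by
    apply Finset.eq_of_subset_of_card_le
    · intro c
      simp only [Finset.mem_image, Finset.mem_range, Finset.mem_Icc]
      rintro ⟨l, hl, rfl⟩
      exact h.mem l hl
    · rw [Finset.card_image_of_injOn]
      · simp [hK]
      · intro x hx y hy hxy
        simp only [Finset.coe_range, Set.mem_Iio] at hx hy
        exact h.inj hx hy hxy
  have : c ∈ Finset.Icc a b := Finset.mem_Icc.mpr ⟨h1, h2⟩
  rw [← himg] at this
  simpa using this

/-- The index of `p` in the top-`K` list of a range ending in `p` is its rank. -/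
theorem IsTop.rk_of_eq {p q : ℕ} {f : ℕ → ℕ} (h : IsTop A K (min p q) (max p q) f) {l : ℕ}
    (hl : l < min K (max p q + 1 - min p q)) (he : f l = p) : rk A K p q = l := by
  have := h.card_filter hl
  rw [he] at this
  have h' : above A p q = l := this
  unfold rk
  omega

theorem IsTop.rk_of_ne {p q : ℕ} {f : ℕ → ℕ} (h : IsTop A K (min p q) (max p q) f)
    (hne : ∀ l < min K (max p q + 1 - min p q), f l ≠ p) : rk A K p q = K := by
  have hK : K < max p q + 1 - min p q := by
    by_contra hK
    obtain ⟨l, hl, he⟩ := h.exists_of_le (not_lt.mp hK) (min_le_left p q) (le_max_left p q)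
    exact hne l hl he
  have hmin : min K (max p q + 1 - min p q) = K := by omega
  have : K ≤ above A p q := by
    have hsub : (Finset.range K).image f ⊆ (Finset.uIcc p q).filter fun c => A p < A c := by
      intro c
      simp only [Finset.mem_image, Finset.mem_range, Finset.mem_filter]
      rintro ⟨l, hl, rfl⟩
      exact ⟨Finset.mem_Icc.mpr (h.mem l (by omega)), h.lt_of_ne p (min_le_left p q) (le_max_left p q)
        hne l (by omega)⟩
    have := Finset.card_le_card hsub
    rwa [Finset.card_image_of_injOn, Finset.card_range] at this
    intro x hx y hy hxy
    simp only [Finset.coe_range, Set.mem_Iio] at hx hy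
    exact h.inj (by omega) (by omega) hxy
  unfold rk
  omega

theorem IsTop.rk_le {a b : ℕ} {f : ℕ → ℕ} (h : IsTop A K a b f) {l q : ℕ}
    (hl : l < min K (b + 1 - a)) (hq : a ≤ q) (hq' : q ≤ b) : rk A K (f l) q ≤ l := by
  conv_rhs => rw [← h.card_filter hl]
  refine (min_le_right _ _).trans (Finset.card_le_card ?_)
  intro c
  have := h.mem l hl
  simp only [Finset.mem_filter, Finset.mem_uIcc, Finset.mem_Icc]
  omega

end RowOrder

/-! ### Rank tables -/

namespace WordRAM

/-- The address of an entry of an `n × n` table, where `n` is the contents of register `0`. -/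
def Expr.idx (r s : ℕ) : Expr := .bin .add (.bin .mul (.reg r) (.reg 0)) (.reg s)

/-- Registers below `20`, banks outside `B` and the output are unchanged. -/
structure Frame (B : Set ℕ) (σ τ : State) : Prop where
  reg : ∀ r < 20, τ.reg r = σ.reg r
  mem : ∀ b ∉ B, τ.mem b = σ.mem b
  out : τ.out = σ.out

theorem Frame.refl (B : Set ℕ) (σ : State) : Frame B σ σ := ⟨by simp, by simp, rfl⟩

theorem Frame.trans {B : Set ℕ} {σ τ ρ : State} (h : Frame B σ τ) (h' : Frame B τ ρ) :
    Frame B σ ρ :=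
  ⟨fun r hr => (h'.reg r hr).trans (h.reg r hr), fun b hb => (h'.mem b hb).trans (h.mem b hb),
    h'.out.trans h.out⟩

theorem Frame.mono {B B' : Set ℕ} {σ τ : State} (h : Frame B σ τ) (hB : B ⊆ B') :
    Frame B' σ τ :=
  ⟨h.reg, fun b hb => h.mem b fun hb' => hb (hB hb'), h.out⟩

theorem Frame.setReg {B : Set ℕ} {σ τ : State} (h : Frame B σ τ) {r : ℕ} (hr : 20 ≤ r) (v : ℕ) :
    Frame B σ (τ.setReg r v) :=
  ⟨fun r' hr' => by rw [State.setReg_reg, if_neg (by omega)]; exact h.reg r' hr', h.mem, h.out⟩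

theorem Frame.setMem {B : Set ℕ} {σ τ : State} (h : Frame B σ τ) {b : ℕ} (hb : b ∈ B) (a v : ℕ) :
    Frame B σ (τ.setMem b a v) :=
  ⟨h.reg, fun b' hb' => by
    rw [State.setMem_mem_of_ne _ _ _ (fun he => hb' (by rwa [he]))]; exact h.mem b' hb', h.out⟩

theorem idx_lt {n p q : ℕ} (hp : p < n) (hq : q < n) : p * n + q < n * n := by
  have : (p + 1) * n ≤ n * n := Nat.mul_le_mul_right _ hp
  linarith [add_mul p 1 n]

theorem idx_inj {n p q p' q' : ℕ} (hq : q < n) (hq' : q' < n) :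
    p * n + q = p' * n + q' ↔ p = p' ∧ q = q' := by
  constructor
  · intro h
    have h1 : (p * n + q) / n = (p' * n + q') / n := by rw [h]
    have h2 : (p * n + q) % n = (p' * n + q') % n := by rw [h]
    rw [Nat.add_comm, Nat.add_comm (p' * n), Nat.add_mul_div_right _ _ (by omega),
      Nat.add_mul_div_right _ _ (by omega), Nat.div_eq_of_lt hq, Nat.div_eq_of_lt hq'] at h1
    rw [Nat.mul_add_mod_self_right, Nat.mul_add_mod_self_right, Nat.mod_eq_of_lt hq,
      Nat.mod_eq_of_lt hq'] at h2
    omega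
  · rintro ⟨rfl, rfl⟩
    rfl

/-- Runs through columns to one side of the column in register `22`, counts the larger values,
and stores the ranks. -/
def scan (src dst : ℕ) (op : BinOp) (lim : Expr) : Cmd :=
  .for 23 lim (.seq (.assign 25 (.bin op (.reg 22) (.reg 23)))
    (.seq (.assign 24 (.bin .add (.reg 24)
        (.bin .lt (.load src (.reg 22)) (.load src (.reg 25)))))
      (.store dst (.idx 22 25) (.bin .sub (.reg 2) (.bin .sub (.reg 2) (.reg 24))))))

/-- Writes the rank table of the row in bank `src` to bank `dst`. -/
def rankTable (src dst : ℕ) : Cmd :=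
  .for 22 (.reg 0) (.seq (.assign 24 (.const 0)) (.seq (scan src dst .add (.bin .sub (.reg 0) (.reg 22)))
    (.seq (.assign 24 (.const 0)) (scan src dst .sub (.bin .add (.reg 22) (.const 1))))))

open RowOrder

variable {w : ℕ} {enc : List Bool} {n K : ℕ}

theorem run_scan {σ : State} {src dst p N : ℕ} {op : BinOp} {e : Expr} {A : ℕ → ℕ}
    (hW : n * n + 4 * n + 4 ≤ 2 ^ w) (h0 : σ.reg 0 = n) (h2 : σ.reg 2 = K) (h22 : σ.reg 22 = p)
    (h24 : σ.reg 24 = 0)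
    (hp : p < n) (hK : K ≤ n) (hsd : src ≠ dst) (hA : ∀ c < n, σ.mem src c = A c ∧ A c < 2 ^ w)
    (hN : N ≤ n) (he : ∀ τ : State, τ.reg 0 = n → τ.reg 22 = p → e.eval w enc τ = some N)
    (hg : ∀ j < N, op.eval p j < n)
    (hab : ∀ j < N, above A p (op.eval p j) =
      ((Finset.range (j + 1)).filter fun d => A p < A (op.eval p d)).card) :
    Run w enc (scan src dst op e) σ fun τ t => t ≤ n * (e.cost + 40) + e.cost + 5 ∧
      Frame {dst} σ τ ∧ τ.reg 22 = p ∧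
      (∀ j < N, τ.mem dst (p * n + op.eval p j) = rk A K p (op.eval p j)) ∧
      ∀ a, (∀ j < N, a ≠ p * n + op.eval p j) → τ.mem dst a = σ.mem dst a := by
  refine Run.for (c := 33) (N := N) (fun j τ => Frame {dst} σ τ ∧ τ.reg 22 = p ∧ τ.reg 23 = j ∧
    τ.reg 24 = ((Finset.range j).filter fun d => A p < A (op.eval p d)).card ∧
      (∀ i < j, τ.mem dst (p * n + op.eval p i) = rk A K p (op.eval p i)) ∧
      ∀ a, (∀ i < j, a ≠ p * n + op.eval p i) → τ.mem dst a = σ.mem dst a) (by omega) ?_ ?_ ?_ ?_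
  · refine ⟨(Frame.refl _ _).setReg (by norm_num) _, ?_⟩
    simp [State.setReg_reg, State.setReg_mem, h22, h24]
  · rintro j τ hj ⟨hF, h22, h23, -⟩
    exact ⟨h23, he τ (by rw [hF.reg 0 (by norm_num), h0]) h22⟩
  · rintro j τ hj - ⟨hF, h22, h23, h24, htab, hrest⟩
    have h0' : τ.reg 0 = n := by rw [hF.reg 0 (by norm_num), h0]
    have h2' : τ.reg 2 = K := by rw [hF.reg 2 (by norm_num), h2]
    have hsrc : τ.mem src = σ.mem src := hF.mem src (by simpa using hsd)
    have hq := hg j hj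
    have hidx := idx_lt hp hq
    have hcard : ((Finset.range j).filter fun d => A p < A (op.eval p d)).card ≤ j :=
      (Finset.card_filter_le _ _).trans (by simp)
    have hpn : p * n ≤ p * n + op.eval p j := Nat.le_add_right _ _
    have hlt : (if A p < A (op.eval p j) then 1 else 0) ≤ 1 := by split_ifs <;> simp
    have hab' := hab j hj
    rw [Finset.range_add_one, Finset.filter_insert] at hab'
    have hsucc : ((Finset.range (j + 1)).filter fun d => A p < A (op.eval p d)).card =
        ((Finset.range j).filter fun d => A p < A (op.eval p d)).card +
          if A p < A (op.eval p j) then 1 else 0 := by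
      rw [Finset.range_add_one, Finset.filter_insert]
      split_ifs
      · rw [Finset.card_insert_of_notMem (by simp)]
      · rfl
    obtain ⟨hp1, hp2⟩ := hA p hp
    obtain ⟨hq1, hq2⟩ := hA _ hq
    refine run_seq.mpr (run_assign.mpr ⟨op.eval p j, ?_, run_seq.mpr (run_assign.mpr
      ⟨((Finset.range (j + 1)).filter fun d => A p < A (op.eval p d)).card, ?_,
      run_store.mpr ⟨p * n + op.eval p j, ?_, rk A K p (op.eval p j), ?_, ?_, ?_, ?_⟩⟩)⟩)
    · simp (disch := omega) [h22, h23, word_eq]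
    · simp (disch := omega) [h22, h24, hsrc, hp1, hq1, word_eq, hsucc]
    · simp (disch := omega) [Expr.idx, h22, h0', word_eq]
    · rw [rk, hab j hj]
      simp (disch := omega) [h2', word_eq]
      omega
    · simp [Expr.cost, Expr.idx]
    · simp [h23]
    · refine ⟨(((hF.setReg (by norm_num) _).setReg (by norm_num) _).setMem (by simp) _ _).setReg
        (by norm_num) _, by simp [h22], by simp, by simp, fun i hi => ?_, fun a ha => ?_⟩
      · rw [State.setReg_mem, State.setMem_mem]
        by_cases hij : op.eval p i = op.eval p j
        · simp [hij]
        · have : i < j := by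
            rcases Nat.lt_succ_iff_lt_or_eq.mp hi with h | rfl
            · exact h
            · exact absurd rfl hij
          simp [hij, htab i this]
      · rw [State.setReg_mem, State.setMem_mem, if_neg (by simp [ha j (by omega)])]
        exact hrest a fun i hi => ha i (by omega)
  · rintro τ t ht ⟨hF, h22, h23, h24, htab, hrest⟩
    refine ⟨ht.trans ?_, hF, h22, htab, hrest⟩
    have : N * (33 + e.cost + 7) ≤ n * (e.cost + 40) := Nat.mul_le_mul hN (by omega)
    omega

theorem above_add {A : ℕ → ℕ} (p j : ℕ) : above A p (p + j) =
    ((Finset.range (j + 1)).filter fun d => A p < A (p + d)).card := by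
  unfold above
  symm
  refine Finset.card_bij (fun d _ => p + d) ?_ ?_ ?_
  · intro d
    simp only [Finset.mem_filter, Finset.mem_range, Finset.mem_uIcc]
    omega
  · intro d _ d' _ h
    omega
  · intro c
    simp only [Finset.mem_filter, Finset.mem_range, Finset.mem_uIcc]
    rintro ⟨h, h'⟩
    have hc : p + (c - p) = c := by omega
    exact ⟨c - p, ⟨by omega, by rwa [hc]⟩, hc⟩

theorem above_sub {A : ℕ → ℕ} (p j : ℕ) (hj : j ≤ p) : above A p (p - j) =
    ((Finset.range (j + 1)).filter fun d => A p < A (p - d)).card := by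
  unfold above
  symm
  refine Finset.card_bij (fun d _ => p - d) ?_ ?_ ?_
  · intro d
    simp only [Finset.mem_filter, Finset.mem_range, Finset.mem_uIcc]
    omega
  · intro d hd d' hd' h
    simp only [Finset.mem_filter, Finset.mem_range] at hd hd'
    omega
  · intro c
    simp only [Finset.mem_filter, Finset.mem_range, Finset.mem_uIcc]
    rintro ⟨h, h'⟩
    have hc : p - (p - c) = c := by omega
    exact ⟨p - c, ⟨by omega, by rwa [hc]⟩, hc⟩

theorem run_rankTable {σ : State} {src dst : ℕ} {A : ℕ → ℕ}
    (hW : n * n + 4 * n + 4 ≤ 2 ^ w) (h0 : σ.reg 0 = n) (h2 : σ.reg 2 = K)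
    (hK : K ≤ n) (hsd : src ≠ dst) (hA : ∀ c < n, σ.mem src c = A c ∧ A c < 2 ^ w) :
    Run w enc (rankTable src dst) σ fun τ t => t ≤ 90 * (n * n) + 60 * n + 10 ∧ Frame {dst} σ τ ∧
      ∀ p < n, ∀ q < n, τ.mem dst (p * n + q) = rk A K p q := by
  refine Run.for (c := 90 * n + 40) (N := n) (fun j τ => Frame {dst} σ τ ∧ τ.reg 22 = j ∧
    ∀ p < j, ∀ q < n, τ.mem dst (p * n + q) = rk A K p q) (by omega) ?_ ?_ ?_ ?_
  · exact ⟨(Frame.refl _ _).setReg (by norm_num) _, by simp, by simp⟩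
  · rintro j τ hj ⟨hF, h22, -⟩
    have h0' : τ.reg 0 = n := by rw [hF.reg 0 (by norm_num), h0]
    exact ⟨h22, by simp (disch := omega) [h0', word_eq]⟩
  · rintro p τ hp - ⟨hF, h22, htab⟩
    refine run_seq.mpr (run_assign.mpr ⟨0, by simp (disch := omega) [word_eq], run_seq.mpr ?_⟩)
    have hF1 := hF.setReg (r := 24) (by norm_num) 0
    set σ₁ := τ.setReg 24 0 with hσ₁
    have hmem : ∀ {σ₁ : State}, Frame {dst} σ σ₁ → σ₁.reg 0 = n ∧ σ₁.reg 2 = K ∧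
        ∀ c < n, σ₁.mem src c = A c ∧ A c < 2 ^ w := by
      intro σ₁ hF1
      refine ⟨by rw [hF1.reg 0 (by norm_num), h0], by rw [hF1.reg 2 (by norm_num), h2], ?_⟩
      rw [hF1.mem src (by simpa using hsd)]
      exact hA
    refine Run.mono (run_scan (N := n - p) (A := A) hW (hmem hF1).1 (hmem hF1).2.1
      (by simp [hσ₁, h22]) (by simp [hσ₁]) hp hK hsd (hmem hF1).2.2 (by omega) ?_ ?_ ?_) ?_
    · intro τ h0 h22
      simp (disch := omega) [h0, h22, word_eq]
    · intro j hj
      simp only [BinOp.eval_add]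
      omega
    · intro j hj
      exact above_add p j
    rintro σ₂ t₂ ⟨ht₂, hF2, h22₂, hup, hrest⟩
    refine run_seq.mpr (run_assign.mpr ⟨0, by simp (disch := omega) [word_eq], ?_⟩)
    have hF3 := (hF1.trans hF2).setReg (r := 24) (by norm_num) 0
    set σ₃ := σ₂.setReg 24 0 with hσ₃
    refine Run.mono (run_scan (N := p + 1) (A := A) hW (hmem hF3).1 (hmem hF3).2.1
      (by simp [hσ₃, h22₂]) (by simp [hσ₃]) hp hK hsd (hmem hF3).2.2 (by omega) ?_ ?_ ?_) ?_
    · intro τ h0 h22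
      simp (disch := omega) [h22, word_eq]
    · intro j hj
      simp only [BinOp.eval_sub]
      omega
    · intro j hj
      exact above_sub p j (by omega)
    rintro σ₄ t₄ ⟨ht₄, hF4, h22₄, hdown, hrest'⟩
    simp only [BinOp.eval_add, BinOp.eval_sub, Expr.cost] at ht₂ ht₄ hup hdown hrest hrest' ⊢
    refine ⟨by omega, h22₄, (hF3.trans hF4).setReg (by norm_num) _, by simp, ?_⟩
    intro p' hp' q hq
    rw [State.setReg_mem]
    by_cases hpp : p' = p
    · subst hpp
      by_cases hqp : q ≤ p'
      · have := hdown (p' - q) (by omega)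
        rwa [show p' - (p' - q) = q by omega] at this
      · rw [hrest' _ (by intro j hj; omega), hσ₃, State.setReg_mem]
        have := hup (q - p') (by omega)
        rwa [show p' + (q - p') = q by omega] at this
    · have hne : ∀ q' < n, p' * n + q ≠ p * n + q' := by
        intro q' hq' h
        exact hpp ((idx_inj hq hq').mp h).1
      rw [hrest' _ (fun j hj => hne _ (by omega)), hσ₃, State.setReg_mem,
        hrest _ (fun j hj => hne _ (by omega)), hσ₁, State.setReg_mem]
      exact htab p' (by omega) q hq
  · rintro τ t ht ⟨hF, -, htab⟩
    refine ⟨ht.trans ?_, hF, htab⟩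
    simp only [Expr.cost]
    nlinarith

end WordRAM

/-! ### Computing the order of the columns of a row -/

namespace RowOrder

/-- The number of columns outside `U` that have to precede `c`, plus one if `c` lies in `U`. -/
def degree (A : ℕ → ℕ) (K n : ℕ) (U : Finset ℕ) (c : ℕ) : ℕ :=
  ((Finset.range n).filter fun c' => c' ∉ U ∧ rk A K c' c < rk A K c c').card +
    if c ∈ U then 1 else 0

variable {A : ℕ → ℕ} {K n : ℕ}

theorem degree_eq_zero_iff {U : Finset ℕ} {c : ℕ} :
    degree A K n U c = 0 ↔ c ∉ U ∧ ∀ c' < n, c' ∉ U → ¬Known A K c' c := by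
  unfold degree Known
  rw [Nat.add_eq_zero_iff, Finset.card_eq_zero, Finset.filter_eq_empty_iff]
  by_cases h : c ∈ U <;> simp [h]

theorem degree_le {U : Finset ℕ} {c : ℕ} : degree A K n U c ≤ n + 1 := by
  have := Finset.card_filter_le (Finset.range n) fun c' => c' ∉ U ∧ rk A K c' c < rk A K c c'
  rw [Finset.card_range] at this
  unfold degree
  split_ifs <;> omega

theorem degree_insert {U : Finset ℕ} {m : ℕ} (hm : m < n) (h0 : degree A K n U m = 0) (c : ℕ) :
    degree A K n (insert m U) c =
      (if c = m then 1 else degree A K n U c) - if rk A K m c < rk A K c m then 1 else 0 := by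
  have hmU := (degree_eq_zero_iff.mp h0).1
  by_cases hc : c = m
  · subst hc
    have : ((Finset.range n).filter fun c' => c' ∉ insert c U ∧ rk A K c' c < rk A K c c') = ∅ := by
      rw [Finset.filter_eq_empty_iff]
      intro c' hc' h
      exact (degree_eq_zero_iff.mp h0).2 c' (by simpa using hc')
        (fun h' => h.1 (Finset.mem_insert_of_mem h')) h.2
    rw [degree, this]
    simp
  · have h1 : ((Finset.range n).filter fun c' => c' ∉ insert m U ∧ rk A K c' c < rk A K c c') =
        ((Finset.range n).filter fun c' => c' ∉ U ∧ rk A K c' c < rk A K c c').erase m := by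
      ext c'
      simp only [Finset.mem_filter, Finset.mem_erase, Finset.mem_insert]
      tauto
    rw [degree, h1, Finset.card_erase_eq_ite, if_neg hc, degree]
    simp only [Finset.mem_insert, hc, false_or, Finset.mem_filter, Finset.mem_range, hm, hmU,
      not_false_eq_true, true_and]
    by_cases hk : rk A K m c < rk A K c m
    · have : 0 < ((Finset.range n).filter fun c' => c' ∉ U ∧ rk A K c' c < rk A K c c').card :=
        Finset.card_pos.mpr ⟨m, by simp [hm, hmU, hk]⟩
      simp only [hk, if_true]
      omega
    · simp [hk]

end RowOrder

namespace WordRAM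

open RowOrder

variable {w : ℕ} {enc : List Bool} {n K : ℕ}

/-- Decides whether the column in register `r` is known to have a larger value than the one in
register `s`. -/
def Expr.known (tab r s : ℕ) : Expr := .bin .lt (.load tab (.idx r s)) (.load tab (.idx s r))

theorem eval_known {τ : State} {tab r s p q : ℕ} {A : ℕ → ℕ} (hW : n * n + 4 * n + 4 ≤ 2 ^ w)
    (h0 : τ.reg 0 = n) (hr : τ.reg r = p) (hs : τ.reg s = q) (hp : p < n) (hq : q < n)
    (hK : K ≤ n) (htab : ∀ p < n, ∀ q < n, τ.mem tab (p * n + q) = rk A K p q) :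
    (Expr.known tab r s).eval w enc τ =
      some (if rk A K p q < rk A K q p then 1 else 0) := by
  have h1 := idx_lt hp hq
  have h2 := idx_lt hq hp
  have h3 : rk A K p q ≤ K := min_le_left _ _
  have h4 : rk A K q p ≤ K := min_le_left _ _
  have h5 : (if rk A K p q < rk A K q p then 1 else 0) ≤ 1 := by split_ifs <;> simp
  have h6 : p * n ≤ p * n + q := Nat.le_add_right _ _
  have h7 : q * n ≤ q * n + p := Nat.le_add_right _ _
  have h8 := htab p hp q hq
  have h9 := htab q hq p hp
  simp (disch := omega) [Expr.known, Expr.idx, h0, hr, hs, word_eq, h8, h9]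

/-- Computes the number of columns that are known to have a larger value, for every column. -/
def degrees (tab deg : ℕ) : Cmd :=
  .for 22 (.reg 0) (.seq (.assign 24 (.const 0))
    (.seq (.for 23 (.reg 0) (.assign 24 (.bin .add (.reg 24) (.known tab 23 22))))
      (.store deg (.reg 22) (.reg 24))))

/-- Chooses the columns one after the other, and keeps the degrees up to date. A column that has been
chosen keeps the degree `1`, so that it is passed over by the search for a column of degree `0`. -/
def choose (tab ord deg : ℕ) : Cmd :=
  .for 22 (.reg 0) (.seq (.assign 24 (.const 0))
    (.seq (.loop (.load deg (.reg 24)) (.assign 24 (.bin .add (.reg 24) (.const 1))))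
      (.seq (.store deg (.reg 24) (.const 1))
        (.seq (.store ord (.reg 22) (.reg 24))
          (.for 23 (.reg 0)
            (.store deg (.reg 23) (.bin .sub (.load deg (.reg 23)) (.known tab 24 23))))))))

theorem run_degrees {σ : State} {tab deg : ℕ} {A : ℕ → ℕ}
    (hW : n * n + 4 * n + 4 ≤ 2 ^ w) (h0 : σ.reg 0 = n) (hK : K ≤ n) (htd : tab ≠ deg)
    (htab : ∀ p < n, ∀ q < n, σ.mem tab (p * n + q) = rk A K p q) :
    Run w enc (degrees tab deg) σ fun τ t => t ≤ 40 * (n * n) + 30 * n + 10 ∧ Frame {deg} σ τ ∧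
      ∀ c < n, τ.mem deg c = degree A K n ∅ c := by
  refine Run.for (c := 25 * n + 20) (N := n) (fun j τ => Frame {deg} σ τ ∧ τ.reg 22 = j ∧
    ∀ c < j, τ.mem deg c = degree A K n ∅ c) (by omega) ?_ ?_ ?_ ?_
  · exact ⟨(Frame.refl _ _).setReg (by norm_num) _, by simp, by simp⟩
  · rintro j τ hj ⟨hF, h22, -⟩
    have h0' : τ.reg 0 = n := by rw [hF.reg 0 (by norm_num), h0]
    exact ⟨h22, by simp (disch := omega) [h0', word_eq]⟩
  · rintro c τ hc - ⟨hF, h22, hdeg⟩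
    refine run_seq.mpr (run_assign.mpr ⟨0, by simp (disch := omega) [word_eq], run_seq.mpr ?_⟩)
    have h0' : τ.reg 0 = n := by rw [hF.reg 0 (by norm_num), h0]
    refine Run.for (c := 17) (N := n) (fun j τ' => Frame {deg} σ τ' ∧ τ'.reg 22 = c ∧
      τ'.reg 23 = j ∧ τ'.mem = τ.mem ∧
      τ'.reg 24 = ((Finset.range j).filter fun c' => rk A K c' c < rk A K c c').card)
      (by omega) ?_ ?_ ?_ ?_
    · exact ⟨(hF.setReg (by norm_num) _).setReg (by norm_num) _, by simp [h22], by simp, rfl,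
        by simp⟩
    · rintro j τ' hj ⟨hF', -, h23, -⟩
      have h0' : τ'.reg 0 = n := by rw [hF'.reg 0 (by norm_num), h0]
      exact ⟨h23, by simp (disch := omega) [h0', word_eq]⟩
    · rintro j τ' hj - ⟨hF', h22', h23', hmem, h24'⟩
      have h0' : τ'.reg 0 = n := by rw [hF'.reg 0 (by norm_num), h0]
      have hev := eval_known (enc := enc) (τ := τ') (tab := tab) (A := A) hW h0' h23' h22' hj hc hK
        (by rw [hF'.mem tab (by simpa using htd)]; exact htab)
      have hcard : ((Finset.range j).filter fun c' => rk A K c' c < rk A K c c').card ≤ j :=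
        (Finset.card_filter_le _ _).trans (by simp)
      have hlt : (if rk A K j c < rk A K c j then 1 else 0) ≤ 1 := by split_ifs <;> simp
      refine run_assign.mpr ⟨((Finset.range (j + 1)).filter fun c' => rk A K c' c < rk A K c c').card,
        ?_, by simp [Expr.cost, Expr.known, Expr.idx], by simp [h23'],
        (hF'.setReg (by norm_num) _).setReg (by norm_num) _, by simp [h22'], by simp,
        hmem, ?_⟩
      · rw [eval_bin, hev, eval_reg, h24', word_eq (by omega), Option.bind_some, Option.bind_some,
          BinOp.eval_add, word_eq (by omega), Finset.range_add_one, Finset.filter_insert]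
        split_ifs
        · rw [Finset.card_insert_of_notMem (by simp)]
        · rfl
      · simp
    · rintro τ' t ht ⟨hF', h22', -, hmem, h24'⟩
      have hcard : ((Finset.range n).filter fun c' => rk A K c' c < rk A K c c').card ≤ n :=
        (Finset.card_filter_le _ _).trans (by simp)
      refine run_store.mpr ⟨c, by simp (disch := omega) [h22', word_eq], _,
        by rw [eval_reg, h24', word_eq (by omega)], ?_, by simp [h22'],
        (hF'.setMem (by simp) _ _).setReg (by norm_num) _, by simp, ?_⟩
      · simp only [Expr.cost] at ht ⊢
        omega
      · intro c' hc'
        rw [State.setReg_mem, State.setMem_mem]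
        by_cases hcc : c' = c
        · simp [hcc, degree]
        · rw [if_neg (by simp [hcc]), hmem]
          exact hdeg c' (by omega)
  · rintro τ t ht ⟨hF, -, hdeg⟩
    refine ⟨ht.trans ?_, hF, hdeg⟩
    simp only [Expr.cost]
    nlinarith

theorem run_choose {σ : State} {tab ord deg : ℕ} {A : ℕ → ℕ}
    (hW : n * n + 4 * n + 4 ≤ 2 ^ w) (h0 : σ.reg 0 = n) (hK : K ≤ n) (htd : tab ≠ deg)
    (hto : tab ≠ ord) (hod : ord ≠ deg)
    (htab : ∀ p < n, ∀ q < n, σ.mem tab (p * n + q) = rk A K p q)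
    (hdeg : ∀ c < n, σ.mem deg c = degree A K n ∅ c) :
    Run w enc (choose tab ord deg) σ fun τ t => t ≤ 60 * (n * n) + 50 * n + 10 ∧
      Frame {ord, deg} σ τ ∧ ∀ s < n, τ.mem ord s = RowOrder.ord A K n s := by
  refine Run.for (c := 40 * n + 40) (N := n) (fun j τ => Frame {ord, deg} σ τ ∧ τ.reg 22 = j ∧
    (∀ s < j, τ.mem ord s = RowOrder.ord A K n s) ∧
    ∀ c < n, τ.mem deg c = degree A K n (taken (Known A K) n j) c) (by omega) ?_ ?_ ?_ ?_
  · exact ⟨(Frame.refl _ _).setReg (by norm_num) _, by simp, by simp, hdeg⟩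
  · rintro j τ hj ⟨hF, h22, -⟩
    have h0' : τ.reg 0 = n := by rw [hF.reg 0 (by norm_num), h0]
    exact ⟨h22, by simp (disch := omega) [h0', word_eq]⟩
  · rintro s τ hs - ⟨hF, h22, hord, hdeg⟩
    obtain ⟨hm, hm1, hm2, hm3⟩ := order_spec (G := Known A K) known_imp hs
    set m := order (Known A K) n s with hm_def
    set U := taken (Known A K) n s with hU
    have hm0 : degree A K n U m = 0 := degree_eq_zero_iff.mpr ⟨hm1, hm2⟩
    refine run_seq.mpr (run_assign.mpr ⟨0, by simp (disch := omega) [word_eq], run_seq.mpr ?_⟩)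
    refine Run.mono (Run.loop (c := 4) (fun d τ' => ∃ v, v + d = m ∧ τ'.reg 24 = v ∧
      Frame {ord, deg} σ τ' ∧ τ'.reg 22 = s ∧ τ'.mem = τ.mem) m
      ⟨0, by simp, by simp, hF.setReg (by norm_num) _, by simp [h22], rfl⟩ ?_) ?_
    · rintro d τ' ⟨v, hv, h24', hF', h22', hmem⟩
      have hle := degree_le (A := A) (K := K) (n := n) (U := U) (c := v)
      have hdv := hdeg v (by omega)
      rw [← hmem] at hdv
      refine ⟨degree A K n U v, by simp (disch := omega) [h24', hdv, word_eq], fun hv0 => ?_⟩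
      have hvm : v ≠ m := fun h => hv0 (h ▸ hm0)
      refine ⟨d - 1, by omega, run_assign.mpr ⟨v + 1, by simp (disch := omega) [h24', word_eq],
        by simp [Expr.cost], v + 1, by omega, by simp, hF'.setReg (by norm_num) _, by simp [h22'],
        hmem⟩⟩
    rintro τ₁ t₁ ⟨ht₁, hev, d, v, hv, h24₁, hF₁, h22₁, hmem₁⟩
    have hvm : v = m := by
      have hle := degree_le (A := A) (K := K) (n := n) (U := U) (c := v)
      have hdv := hdeg v (by omega)
      rw [← hmem₁] at hdv
      rw [eval_load, eval_reg, h24₁, word_eq (by omega), Option.bind_some, hdv,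
        word_eq (by omega), Option.some.injEq, degree_eq_zero_iff] at hev
      by_contra hne
      obtain ⟨c, hc, hcU, hck⟩ := hm3 v (by omega) hev.1
      exact hev.2 c hc hcU hck
    subst hvm
    refine run_seq.mpr (run_store.mpr ⟨m, by simp (disch := omega) [h24₁, word_eq], 1,
      by simp (disch := omega) [word_eq], run_seq.mpr (run_store.mpr ⟨s,
      by simp (disch := omega) [h22₁, word_eq], m, by simp (disch := omega) [h24₁, word_eq], ?_⟩)⟩)
    refine Run.for (c := 18) (N := n) (fun j τ' => Frame {ord, deg} σ τ' ∧ τ'.reg 22 = s ∧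
      τ'.reg 24 = m ∧ τ'.reg 23 = j ∧ (∀ i < s + 1, τ'.mem ord i = RowOrder.ord A K n i) ∧
      ∀ c < n, τ'.mem deg c = if c < j then degree A K n (insert m U) c
        else if c = m then 1 else degree A K n U c) (by omega) ?_ ?_ ?_ ?_
    · refine ⟨((hF₁.setMem (by simp) _ _).setMem (by simp) _ _).setReg (by norm_num) _,
        by simp [h22₁], by simp [h24₁], by simp, ?_, ?_⟩
      · intro i hi
        rw [State.setReg_mem, State.setMem_mem]
        by_cases his : i = s
        · rw [if_pos ⟨rfl, his⟩, his]
          exact hm_def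
        · rw [if_neg (by simp [his]), State.setMem_mem_of_ne _ _ _ hod, hmem₁]
          exact hord i (by omega)
      · intro c hc
        rw [State.setReg_mem, State.setMem_mem_of_ne _ _ _ hod.symm, State.setMem_mem, hmem₁]
        by_cases hcv : c = m
        · simp [hcv]
        · simp [hcv, hdeg c hc]
    · rintro j τ' hj ⟨hF', -, -, h23, -⟩
      have h0' : τ'.reg 0 = n := by rw [hF'.reg 0 (by norm_num), h0]
      exact ⟨h23, by simp (disch := omega) [h0', word_eq]⟩
    · rintro j τ' hj - ⟨hF', h22', h24', h23', hord', hdeg'⟩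
      have h0' : τ'.reg 0 = n := by rw [hF'.reg 0 (by norm_num), h0]
      have hev := eval_known (enc := enc) (τ := τ') (tab := tab) (A := A) hW h0' h24' h23' hm hj hK
        (by rw [hF'.mem tab (by simp [htd, hto])]; exact htab)
      have hle := degree_le (A := A) (K := K) (n := n) (U := U) (c := j)
      have hdj := hdeg' j hj
      rw [if_neg (lt_irrefl j)] at hdj
      have hle' : (if j = m then 1 else degree A K n U j) ≤ n + 1 := by split_ifs <;> omega
      refine run_store.mpr ⟨j, by simp (disch := omega) [h23', word_eq],
        degree A K n (insert m U) j, ?_, by simp [Expr.cost, Expr.known, Expr.idx], by simp [h23'],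
        (hF'.setMem (by simp) _ _).setReg (by norm_num) _, by simp [h22'], by simp [h24'],
        by simp, ?_, ?_⟩
      · rw [eval_bin, hev, eval_load, eval_reg, h23', word_eq (by omega), Option.bind_some, hdj,
          word_eq (by omega), Option.bind_some, Option.bind_some, BinOp.eval_sub,
          word_eq (by omega), degree_insert hm hm0]
      · intro i hi
        rw [State.setReg_mem, State.setMem_mem_of_ne _ _ _ hod]
        exact hord' i hi
      · intro c hc
        rw [State.setReg_mem, State.setMem_mem]
        by_cases hcj : c = j
        · simp [hcj]
        · rw [if_neg (by simp [hcj]), hdeg' c hc]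
          have : c < j + 1 ↔ c < j := by omega
          simp [this]
    · rintro τ' t ht ⟨hF', h22', -, -, hord', hdeg'⟩
      refine ⟨?_, h22', hF'.setReg (by norm_num) _, by simp, hord', ?_⟩
      · simp only [Expr.cost] at ht ht₁ ⊢
        omega
      · intro c hc
        rw [State.setReg_mem, hdeg' c hc, if_pos hc]
        rfl
  · rintro τ t ht ⟨hF, -, hord, -⟩
    refine ⟨ht.trans ?_, hF, hord⟩
    simp only [Expr.cost]
    nlinarith

end WordRAM

/-! ### Asking the questions -/

namespace WordRAM

open RowOrder Questions

/-- What a question writes to the output: the answer if `em` is set, and nothing otherwise. -/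
def outOf (em : Bool) (L : List Bool) : List Bool := if em then L else []

theorem outOf_append (em : Bool) (L L' : List Bool) :
    outOf em (L ++ L') = outOf em L ++ outOf em L' := by
  cases em <;> simp [outOf]

/-- The state with additional output. -/
def State.appendOut (σ : State) (l : List Bool) : State := { σ with out := σ.out ++ l }

/-- The effect of a question with answer `b`: the answer is in register `21`, and register `20`
counts the questions. -/
structure Answered (em b : Bool) (τ τ' : State) : Prop where
  reg : ∀ r, r ≠ 20 → r ≠ 21 → τ'.reg r = τ.reg r
  count : τ'.reg 20 = τ.reg 20 + 1
  bit : τ'.reg 21 = b.toNat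
  mem : τ'.mem = τ.mem
  out : τ'.out = τ.out ++ outOf em [b]

/-- Decides whether the columns in registers `24` and `25` may meet. -/
def Expr.meet (tx ty : ℕ) : Expr :=
  .bin .mul (.bin .sub (.const 1) (.bin .lt (.reg 25) (.reg 24)))
    (.bin .lt (.bin .add (.load tx (.idx 24 25)) (.load ty (.idx 25 24))) (.reg 1))

/-- Treats the pair of columns with positions in registers `22` and `23`; the first of these
columns is in register `24`, and register `26` says whether it has won. -/
def comparePair (tx ty oy won cmp : ℕ) (ask : Cmd) : Cmd :=
  .seq (.assign 25 (.load oy (.reg 23)))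
    (.ite (.meet tx ty)
      (.ite (.reg 26) (.store cmp (.idx 24 25) (.const 1))
        (.ite (.load won (.reg 25)) (.store cmp (.idx 24 25) (.const 0))
          (.seq ask (.seq (.store cmp (.idx 24 25) (.reg 21))
            (.seq (.assign 26 (.reg 21))
              (.store won (.reg 25) (.bin .sub (.const 1) (.reg 21))))))))
      .skip)

/-- Compares the columns of one row with the columns of the other row that are not to their left.
The program `ask` finds out about the pair in registers `24` and `25`. -/
def compareRows (tx ty ox oy won cmp : ℕ) (ask : Cmd) : Cmd :=
  .for 22 (.reg 0) (.seq (.assign 24 (.load ox (.reg 22)))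
    (.seq (.assign 26 (.const 0)) (.for 23 (.reg 0) (comparePair tx ty oy won cmp ask))))

/-- The banks used by `compareRows`, and what they contain in the beginning. -/
structure CompareEnv (A A' : ℕ → ℕ) (K n k tx ty ox oy won cmp : ℕ) (σ : State) : Prop where
  n_eq : σ.reg 0 = n
  k_eq : σ.reg 1 = k
  tx_eq : ∀ p < n, ∀ q < n, σ.mem tx (p * n + q) = rk A K p q
  ty_eq : ∀ p < n, ∀ q < n, σ.mem ty (p * n + q) = rk A' K p q
  ox_eq : ∀ s < n, σ.mem ox s = RowOrder.ord A K n s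
  oy_eq : ∀ s < n, σ.mem oy s = RowOrder.ord A' K n s
  tx_notMem : tx ∉ ({won, cmp} : Set ℕ)
  ty_notMem : ty ∉ ({won, cmp} : Set ℕ)
  ox_notMem : ox ∉ ({won, cmp} : Set ℕ)
  oy_notMem : oy ∉ ({won, cmp} : Set ℕ)
  ne : won ≠ cmp

/-- The invariant of `compareRows`: all pairs up to, and not including, the one with positions `s`
and `j` have been treated. -/
structure CompareInv (A A' : ℕ → ℕ) (K n k won cmp c₀ : ℕ) (em : Bool) (σ : State) (s j : ℕ)
    (τ : State) : Prop where
  frame : Frame {won, cmp} (σ.appendOut (outOf em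
    (bits (MeetAt A A' k K n) (GtAt A A' K n) n s ++
      rowBits (MeetAt A A' k K n) (GtAt A A' K n) s j))) τ
  count : τ.reg 20 = c₀ + (bits (MeetAt A A' k K n) (GtAt A A' K n) n s ++
      rowBits (MeetAt A A' k K n) (GtAt A A' K n) s j).length
  won_le : ∀ t < n, τ.mem won (RowOrder.ord A' K n t) ≤ 1
  won_iff : ∀ t < n, τ.mem won (RowOrder.ord A' K n t) ≠ 0 ↔
    ∃ s', (s' < s ∨ s' = s ∧ t < j) ∧ MeetAt A A' k K n s' t ∧ ¬GtAt A A' K n s' t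
  cmp_eq : ∀ s' < n, ∀ t < n, (s' < s ∨ s' = s ∧ t < j) → MeetAt A A' k K n s' t →
    τ.mem cmp (RowOrder.ord A K n s' * n + RowOrder.ord A' K n t) =
      if A' (RowOrder.ord A' K n t) < A (RowOrder.ord A K n s') then 1 else 0

/-- The program `ask` answers the questions of `compareRows` truthfully. -/
def AskSpec (w : ℕ) (enc : List Bool) (A A' : ℕ → ℕ) (K n k won cmp c₀ : ℕ) (em : Bool)
    (σ : State) (ask : Cmd) : Prop :=
  ∀ (L : List Bool) (b : Bool) (s t : ℕ) (τ : State), s < n → t < n →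
    (b = true ↔ GtAt A A' K n s t) →
    L ++ [b] <+: bits (MeetAt A A' k K n) (GtAt A A' K n) n n →
    τ.reg 20 = c₀ + L.length → τ.reg 24 = RowOrder.ord A K n s →
    τ.reg 25 = RowOrder.ord A' K n t →
    Frame {won, cmp} (σ.appendOut (outOf em L)) τ →
    Run w enc ask τ fun τ' c => c ≤ 40 ∧ Answered em b τ τ'

variable {w : ℕ} {enc : List Bool} {n K k : ℕ}

theorem eval_meet {τ : State} {tx ty p q x y : ℕ} (hW : n * n + 4 * n + 4 ≤ 2 ^ w)
    (h0 : τ.reg 0 = n) (h1 : τ.reg 1 = k) (h24 : τ.reg 24 = p) (h25 : τ.reg 25 = q)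
    (hp : p < n) (hq : q < n) (hx : τ.mem tx (p * n + q) = x) (hy : τ.mem ty (q * n + p) = y)
    (hxn : x ≤ n) (hyn : y ≤ n) (hk : k ≤ 2 * n) :
    (Expr.meet tx ty).eval w enc τ = some (if p ≤ q ∧ x + y < k then 1 else 0) := by
  have i1 := idx_lt hp hq
  have i2 := idx_lt hq hp
  have i3 : p * n ≤ p * n + q := Nat.le_add_right _ _
  have i4 : q * n ≤ q * n + p := Nat.le_add_right _ _
  have h2 : (if q < p then 1 else 0) ≤ 1 := by split_ifs <;> simp
  have h3 : (if x + y < k then 1 else 0) ≤ 1 := by split_ifs <;> simp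
  have e1 : (Expr.bin .sub (.const 1) (.bin .lt (.reg 25) (.reg 24))).eval w enc τ =
      some (1 - if q < p then 1 else 0) := by
    simp (disch := omega) [h24, h25, word_eq]
  have e2 : (Expr.bin .lt (.bin .add (.load tx (.idx 24 25)) (.load ty (.idx 25 24)))
      (.reg 1)).eval w enc τ = some (if x + y < k then 1 else 0) := by
    simp (disch := omega) [Expr.idx, h24, h25, h0, h1, hx, hy, word_eq]
  rw [Expr.meet, eval_bin, e1, e2, Option.bind_some, Option.bind_some, BinOp.eval_mul]
  have : (1 - if q < p then 1 else 0) * (if x + y < k then 1 else 0) =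
      if p ≤ q ∧ x + y < k then 1 else 0 := by
    split_ifs <;> omega
  rw [this, word_eq]
  split_ifs <;> omega

theorem run_comparePair {A A' : ℕ → ℕ} {tx ty ox oy won cmp c₀ : ℕ} {em : Bool} {σ : State}
    {ask : Cmd} (hW : n * n + 4 * n + 4 ≤ 2 ^ w) (hK : K = min k n) (hk : k ≤ 2 * n)
    (hE : CompareEnv A A' K n k tx ty ox oy won cmp σ)
    (hask : AskSpec w enc A A' K n k won cmp c₀ em σ ask) {s t : ℕ} (hs : s < n) (ht : t < n)
    {τ : State} (h22 : τ.reg 22 = s) (h23 : τ.reg 23 = t) (h24 : τ.reg 24 = RowOrder.ord A K n s)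
    (h26 : τ.reg 26 ≤ 1)
    (h26' : τ.reg 26 ≠ 0 ↔ ∃ t' < t, MeetAt A A' k K n s t' ∧ GtAt A A' K n s t')
    (hI : CompareInv A A' K n k won cmp c₀ em σ s t τ) :
    Run w enc (comparePair tx ty oy won cmp ask) τ fun τ' c => c ≤ 120 ∧
      τ'.reg 22 = s ∧ τ'.reg 23 = t ∧ τ'.reg 24 = RowOrder.ord A K n s ∧ τ'.reg 26 ≤ 1 ∧
      (τ'.reg 26 ≠ 0 ↔ ∃ t' < t + 1, MeetAt A A' k K n s t' ∧ GtAt A A' K n s t') ∧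
      CompareInv A A' K n k won cmp c₀ em σ s (t + 1) τ' := by
  obtain ⟨hF, hcount, hwle, hwiff, hcmp⟩ := hI
  set N := MeetAt A A' k K n with hN_def
  set G := GtAt A A' K n with hG_def
  set p := RowOrder.ord A K n s with hp_def
  set q := RowOrder.ord A' K n t with hq_def
  have hp : p < n := ord_lt hs
  have hq : q < n := ord_lt ht
  have h0 : τ.reg 0 = n := (hF.reg 0 (by norm_num)).trans hE.n_eq
  have h1 : τ.reg 1 = k := (hF.reg 1 (by norm_num)).trans hE.k_eq
  have htx : τ.mem tx (p * n + q) = rk A K p q := by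
    rw [hF.mem tx hE.tx_notMem]
    exact hE.tx_eq p hp q hq
  have hty : τ.mem ty (q * n + p) = rk A' K q p := by
    rw [hF.mem ty hE.ty_notMem]
    exact hE.ty_eq q hq p hp
  have hoy : τ.mem oy t = q := by
    rw [hF.mem oy hE.oy_notMem]
    exact hE.oy_eq t ht
  have i1 := idx_lt hp hq
  have i2 := idx_lt hq hp
  have i3 : p * n ≤ p * n + q := Nat.le_add_right _ _
  have i4 : q * n ≤ q * n + p := Nat.le_add_right _ _
  have r1 : rk A K p q ≤ K := min_le_left _ _
  have r2 : rk A' K q p ≤ K := min_le_left _ _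
  have hKn : K ≤ n := by omega
  -- the addresses of the entries of `cmp` are distinct
  have hinj : ∀ s' < n, ∀ t' < n,
      (RowOrder.ord A K n s' * n + RowOrder.ord A' K n t' = p * n + q ↔ s' = s ∧ t' = t) := by
    intro s' hs' t' ht'
    rw [idx_inj (ord_lt ht') hq]
    constructor
    · rintro ⟨h, h'⟩
      exact ⟨ord_inj hs' hs h, ord_inj ht' ht h'⟩
    · rintro ⟨rfl, rfl⟩
      exact ⟨rfl, rfl⟩
  have hNiff : N s t ↔ p ≤ q ∧ rk A K p q + rk A' K q p < k := Iff.rfl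
  have hGiff : G s t ↔ A' q < A p := Iff.rfl
  have hwiff' : (∃ s', (s' < s ∨ s' = s ∧ t < t) ∧ N s' t ∧ ¬G s' t) ↔
      ∃ s' < s, N s' t ∧ ¬G s' t := by simp
  -- facts on the treated pairs extend to the next one
  have hstep : ∀ s' t', (s' < s ∨ s' = s ∧ t' < t + 1) ↔
      (s' < s ∨ s' = s ∧ t' < t) ∨ s' = s ∧ t' = t := by
    intro s' t'
    omega
  have hq' : ∀ t' < n, RowOrder.ord A' K n t' = q → t' = t := fun t' ht' h => ord_inj ht' ht h
  refine run_seq.mpr (run_assign.mpr ⟨q, by simp (disch := omega) [h23, hoy, word_eq], ?_⟩)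
  set τ₁ := τ.setReg 25 q with hτ₁
  have hcond : (Expr.meet tx ty).eval w enc τ₁ =
      some (if p ≤ q ∧ rk A K p q + rk A' K q p < k then 1 else 0) :=
    eval_meet hW (by simp [hτ₁, h0]) (by simp [hτ₁, h1]) (by simp [hτ₁, h24]) (by simp [hτ₁])
      hp hq htx hty (r1.trans hKn) (r2.trans hKn) hk
  have hidx : ∀ τ₂ : State, τ₂.reg 0 = n → τ₂.reg 24 = p → τ₂.reg 25 = q →
      (Expr.idx 24 25).eval w enc τ₂ = some (p * n + q) := by
    intro τ₂ h0 h24 h25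
    simp (disch := omega) [Expr.idx, h0, h24, h25, word_eq]
  have hF₁ := hF.setReg (r := 25) (by norm_num) q
  rw [← hτ₁] at hF₁
  refine run_ite.mpr ⟨_, hcond, ?_⟩
  have hcost : (Expr.meet tx ty).cost = 21 := by simp [Expr.meet, Expr.cost, Expr.idx]
  rw [hcost]
  by_cases hN : N s t
  swap
  · -- the comparison is not needed
    rw [if_neg (by simpa using hNiff.not.mp hN)]
    have hbits : rowBits N G s (t + 1) = rowBits N G s t := by
      rw [rowBits_succ, if_neg (fun h => hN h.1), List.append_nil]
    refine run_skip.mpr ⟨by simp [Expr.cost], by simp [hτ₁, h22], by simp [hτ₁, h23],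
      by simp [hτ₁, h24], by simpa [hτ₁] using h26, ?_, ?_⟩
    · rw [hτ₁, State.setReg_reg, if_neg (by norm_num), h26']
      constructor
      · rintro ⟨t', ht', h⟩
        exact ⟨t', by omega, h⟩
      · rintro ⟨t', ht', h⟩
        rcases Nat.lt_succ_iff_lt_or_eq.mp ht' with h' | rfl
        · exact ⟨t', h', h⟩
        · exact absurd h.1 hN
    · refine ⟨by rw [hbits]; exact hF₁, by rw [hbits]; simpa [hτ₁] using hcount, hwle, ?_, ?_⟩
      · intro t' ht'
        rw [hτ₁, State.setReg_mem, hwiff t' ht']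
        refine exists_congr fun s' => ?_
        rw [hstep]
        constructor
        · rintro ⟨h, h'⟩
          exact ⟨Or.inl h, h'⟩
        · rintro ⟨h | ⟨rfl, rfl⟩, h'⟩
          · exact ⟨h, h'⟩
          · exact absurd h'.1 hN
      · intro s' hs' t' ht' h h'
        rw [hstep] at h
        rcases h with h | ⟨rfl, rfl⟩
        · exact hcmp s' hs' t' ht' h h'
        · exact absurd h' hN
  rw [if_pos (by simpa using hNiff.mp hN)]
  refine run_ite.mpr ⟨τ.reg 26, by simp (disch := omega) [hτ₁, word_eq], ?_⟩
  by_cases hdone : τ.reg 26 ≠ 0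
  · -- `s` has already won, and so it wins again
    rw [if_pos hdone]
    obtain ⟨t₀, ht₀, hN₀, hG₀⟩ := h26'.mp hdone
    have hG : G s t := gtAt_of_lt hK hs ht ht₀ hN₀ hG₀ hN
    have hbits : rowBits N G s (t + 1) = rowBits N G s t := by
      rw [rowBits_succ, if_neg (fun h => h.2.1 t₀ ht₀ hN₀ hG₀), List.append_nil]
    refine run_store.mpr ⟨_, hidx τ₁ (by simp [hτ₁, h0]) (by simp [hτ₁, h24]) (by simp [hτ₁]), 1,
      by simp (disch := omega) [word_eq], by simp [Expr.cost, Expr.idx], by simp [hτ₁, h22],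
      by simp [hτ₁, h23], by simp [hτ₁, h24], by simpa [hτ₁] using h26, ?_, ?_⟩
    · rw [State.setMem_reg, hτ₁, State.setReg_reg, if_neg (by norm_num)]
      exact iff_of_true hdone ⟨t₀, by omega, hN₀, hG₀⟩
    · refine ⟨by rw [hbits]; exact hF₁.setMem (by simp) _ _,
        by rw [hbits]; simpa [hτ₁] using hcount, ?_, ?_, ?_⟩
      · rw [State.setMem_mem_of_ne _ _ _ hE.ne]
        exact hwle
      · intro t' ht'
        rw [State.setMem_mem_of_ne _ _ _ hE.ne, hτ₁, State.setReg_mem, hwiff t' ht']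
        refine exists_congr fun s' => ?_
        rw [hstep]
        constructor
        · rintro ⟨h, h'⟩
          exact ⟨Or.inl h, h'⟩
        · rintro ⟨h | ⟨rfl, rfl⟩, h'⟩
          · exact ⟨h, h'⟩
          · exact absurd hG h'.2
      · intro s' hs' t' ht' h h'
        rw [hstep] at h
        rw [State.setMem_mem]
        by_cases he : s' = s ∧ t' = t
        · obtain ⟨rfl, rfl⟩ := he
          rw [if_pos ⟨rfl, rfl⟩, if_pos (hGiff.mp hG)]
        · rw [if_neg (fun h => he ((hinj s' hs' t' ht').mp h.2))]
          exact hcmp s' hs' t' ht' (h.resolve_right he) h'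
  rw [if_neg hdone]
  have hw_le : τ.mem won q ≤ 1 := hwle t ht
  refine run_ite.mpr ⟨τ.mem won q, by simp (disch := omega) [hτ₁, word_eq], ?_⟩
  by_cases hwon : τ.mem won q ≠ 0
  · -- `t` has already won, and so it wins again
    rw [if_pos hwon]
    obtain ⟨s₀, hs₀, hN₀, hG₀⟩ := hwiff'.mp ((hwiff t ht).mp hwon)
    have hG : ¬G s t := not_gtAt_of_lt hK hs ht hs₀ hN₀ hG₀ hN
    have hbits : rowBits N G s (t + 1) = rowBits N G s t := by
      rw [rowBits_succ, if_neg (fun h => hG₀ (h.2.2 s₀ hs₀ hN₀)), List.append_nil]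
    refine run_store.mpr ⟨_, hidx τ₁ (by simp [hτ₁, h0]) (by simp [hτ₁, h24]) (by simp [hτ₁]), 0,
      by simp (disch := omega) [word_eq], by simp [Expr.cost, Expr.idx], by simp [hτ₁, h22],
      by simp [hτ₁, h23], by simp [hτ₁, h24], by simpa [hτ₁] using h26, ?_, ?_⟩
    · rw [State.setMem_reg, hτ₁, State.setReg_reg, if_neg (by norm_num), h26']
      constructor
      · rintro ⟨t', ht', h⟩
        exact ⟨t', by omega, h⟩
      · rintro ⟨t', ht', h⟩
        rcases Nat.lt_succ_iff_lt_or_eq.mp ht' with h' | rfl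
        · exact ⟨t', h', h⟩
        · exact absurd h.2 hG
    · refine ⟨by rw [hbits]; exact hF₁.setMem (by simp) _ _,
        by rw [hbits]; simpa [hτ₁] using hcount, ?_, ?_, ?_⟩
      · rw [State.setMem_mem_of_ne _ _ _ hE.ne]
        exact hwle
      · intro t' ht'
        rw [State.setMem_mem_of_ne _ _ _ hE.ne, hτ₁, State.setReg_mem]
        by_cases htt : t' = t
        · subst htt
          exact iff_of_true hwon ⟨s₀, Or.inl hs₀, hN₀, hG₀⟩
        · rw [hwiff t' ht']
          refine exists_congr fun s' => and_congr_left fun _ => ?_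
          omega
      · intro s' hs' t' ht' h h'
        rw [hstep] at h
        rw [State.setMem_mem]
        by_cases he : s' = s ∧ t' = t
        · obtain ⟨rfl, rfl⟩ := he
          rw [if_pos ⟨rfl, rfl⟩, if_neg (hGiff.not.mp hG)]
        · rw [if_neg (fun h => he ((hinj s' hs' t' ht').mp h.2))]
          exact hcmp s' hs' t' ht' (h.resolve_right he) h'
  rw [if_neg hwon]
  -- the question is asked
  have hdone' : ¬∃ t' < t, N s t' ∧ G s t' := fun h => hdone (h26'.mpr h)
  have hwon' : ¬∃ s' < s, N s' t ∧ ¬G s' t := fun h => hwon ((hwiff t ht).mpr (hwiff'.mpr h))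
  have hasked : Asked N G s t := by
    refine ⟨hN, fun t' ht' h h' => hdone' ⟨t', ht', h, h'⟩, fun s' hs' h => ?_⟩
    by_contra h'
    exact hwon' ⟨s', hs', h, h'⟩
  obtain ⟨b, hb⟩ : ∃ b : Bool, b = true ↔ G s t := by
    by_cases h : G s t
    · exact ⟨true, by simp [h]⟩
    · exact ⟨false, by simp [h]⟩
  have hbits : rowBits N G s (t + 1) = rowBits N G s t ++ [b] := by
    have hdb : @decide (G s t) (Classical.propDecidable _) = b :=
      Bool.eq_iff_iff.mpr ((@decide_eq_true_iff _ (Classical.propDecidable _)).trans hb.symm)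
    rw [rowBits_succ, if_pos hasked, hdb]
  have hpre : (bits N G n s ++ rowBits N G s t) ++ [b] <+: bits N G n n := by
    rw [List.append_assoc, ← hbits]
    exact bits_append_rowBits_prefix hs ht
  refine run_seq.mpr (Run.mono (hask _ b s t τ₁ hs ht hb hpre (by simpa [hτ₁] using hcount)
    (by simp [hτ₁, h24, hp_def]) (by simp [hτ₁, hq_def]) hF₁) ?_)
  rintro τ₂ c₂ ⟨hc₂, hreg, hcount₂, hbit, hmem₂, hout₂⟩
  have h0₂ : τ₂.reg 0 = n := by rw [hreg 0 (by norm_num) (by norm_num)]; simp [hτ₁, h0]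
  have h22₂ : τ₂.reg 22 = s := by rw [hreg 22 (by norm_num) (by norm_num)]; simp [hτ₁, h22]
  have h23₂ : τ₂.reg 23 = t := by rw [hreg 23 (by norm_num) (by norm_num)]; simp [hτ₁, h23]
  have h24₂ : τ₂.reg 24 = p := by rw [hreg 24 (by norm_num) (by norm_num)]; simp [hτ₁, h24]
  have h25₂ : τ₂.reg 25 = q := by rw [hreg 25 (by norm_num) (by norm_num)]; simp [hτ₁]
  have hb1 : b.toNat ≤ 1 := Bool.toNat_le b
  have hmem₂' : τ₂.mem = τ.mem := hmem₂
  have hF₂ : Frame {won, cmp} (σ.appendOut (outOf em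
      (bits N G n s ++ rowBits N G s (t + 1)))) τ₂ := by
    refine ⟨fun r hr => ?_, fun b' hb' => ?_, ?_⟩
    · rw [hreg r (by omega) (by omega)]
      exact hF₁.reg r hr
    · rw [hmem₂]
      exact hF₁.mem b' hb'
    · rw [hout₂, hF₁.out, hbits, ← List.append_assoc, outOf_append em _ [b]]
      simp [State.appendOut]
  refine run_seq.mpr (run_store.mpr ⟨_, hidx τ₂ h0₂ h24₂ h25₂, b.toNat,
    by simp (disch := omega) [hbit, word_eq], run_seq.mpr (run_assign.mpr ⟨b.toNat,
    by simp (disch := omega) [hbit, word_eq], run_store.mpr ⟨q,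
    by simp (disch := omega) [h25₂, word_eq], 1 - b.toNat,
    by simp (disch := omega) [hbit, word_eq], ?_, by simp [h22₂], by simp [h23₂], by simp [h24₂],
    by simpa using hb1, ?_, ?_⟩⟩)⟩)
  · simp only [Expr.cost, Expr.idx]
    omega
  · rw [State.setMem_reg, State.setReg_reg, if_pos rfl]
    cases b with
    | true => exact iff_of_true (by simp) ⟨t, by omega, hN, hb.mp rfl⟩
    | false =>
      refine iff_of_false (by simp) ?_
      rintro ⟨t', ht', h⟩
      rcases Nat.lt_succ_iff_lt_or_eq.mp ht' with h' | rfl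
      · exact hdone' ⟨t', h', h⟩
      · exact absurd (hb.mpr h.2) (by simp)
  · refine ⟨((hF₂.setMem (by simp) _ _).setReg (by norm_num) _).setMem (by simp) _ _, ?_, ?_, ?_, ?_⟩
    · rw [hbits, ← List.append_assoc, List.length_append]
      simp only [State.setMem_reg, State.setReg_reg, hcount₂, hτ₁, Nat.reduceEqDiff, if_false]
      rw [hcount]
      rfl
    · intro t' ht'
      rw [State.setMem_mem, State.setReg_mem, State.setMem_mem_of_ne _ _ _ hE.ne, hmem₂']
      split_ifs
      · omega
      · exact hwle t' ht'
    · intro t' ht'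
      rw [State.setMem_mem, State.setReg_mem, State.setMem_mem_of_ne _ _ _ hE.ne, hmem₂']
      by_cases htt : t' = t
      · subst htt
        rw [if_pos ⟨rfl, rfl⟩]
        cases b with
        | true =>
          refine iff_of_false (by simp) ?_
          rintro ⟨s', h, h'⟩
          rw [hstep] at h
          rcases h with h | ⟨rfl, -⟩
          · exact hwon' (hwiff'.mp ⟨s', h, h'⟩)
          · exact h'.2 (hb.mp rfl)
        | false =>
          exact iff_of_true (by simp) ⟨s, Or.inr ⟨rfl, by omega⟩, hN,
            fun h => absurd (hb.mpr h) (by simp)⟩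
      · rw [if_neg (fun h => htt (hq' t' ht' h.2)), hwiff t' ht']
        refine exists_congr fun s' => and_congr_left fun _ => ?_
        omega
    · intro s' hs' t' ht' h h'
      rw [hstep] at h
      rw [State.setMem_mem_of_ne _ _ _ hE.ne.symm, State.setReg_mem, State.setMem_mem, hmem₂']
      by_cases he : s' = s ∧ t' = t
      · obtain ⟨rfl, rfl⟩ := he
        rw [if_pos ⟨rfl, rfl⟩]
        by_cases hG : G s' t'
        · rw [if_pos (hGiff.mp hG), hb.mpr hG]
          rfl
        · rw [if_neg (hGiff.not.mp hG), Bool.eq_false_iff.mpr fun h => hG (hb.mp h)]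
          rfl
      · rw [if_neg (fun h => he ((hinj s' hs' t' ht').mp h.2))]
        exact hcmp s' hs' t' ht' (h.resolve_right he) h'

theorem run_compareRows {A A' : ℕ → ℕ} {tx ty ox oy won cmp c₀ : ℕ} {em : Bool} {σ : State}
    {ask : Cmd} (hW : n * n + 4 * n + 4 ≤ 2 ^ w) (hK : K = min k n) (hk : k ≤ 2 * n)
    (hE : CompareEnv A A' K n k tx ty ox oy won cmp σ)
    (hask : AskSpec w enc A A' K n k won cmp c₀ em σ ask) (h20 : σ.reg 20 = c₀)
    (hwon : ∀ c < n, σ.mem won c = 0) :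
    Run w enc (compareRows tx ty ox oy won cmp ask) σ fun τ t => t ≤ 130 * (n * n) + 50 * n + 10 ∧
      Frame {won, cmp} (σ.appendOut (outOf em
        (bits (MeetAt A A' k K n) (GtAt A A' K n) n n))) τ ∧
      τ.reg 20 = c₀ + (bits (MeetAt A A' k K n) (GtAt A A' K n) n n).length ∧
      ∀ p < n, ∀ q < n, Meet A A' k K p q →
        τ.mem cmp (p * n + q) = if A' q < A p then 1 else 0 := by
  refine Run.for (c := 128 * n + 20) (N := n) (fun s τ => τ.reg 22 = s ∧
    CompareInv A A' K n k won cmp c₀ em σ s 0 τ) (by omega) ?_ ?_ ?_ ?_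
  · refine ⟨by simp, (Frame.setReg ?_ (by norm_num) _), by simpa [bits, rowBits] using h20, ?_, ?_,
      ?_⟩
    · exact ⟨fun _ _ => rfl, fun _ _ => rfl, by cases em <;> simp [outOf, bits, rowBits, State.appendOut]⟩
    · intro t ht
      simp [hwon _ (ord_lt ht)]
    · intro t ht
      simp [hwon _ (ord_lt ht)]
    · simp
  · rintro j τ hj ⟨h22, hI⟩
    have h0 : τ.reg 0 = n := (hI.frame.reg 0 (by norm_num)).trans hE.n_eq
    exact ⟨h22, by simp (disch := omega) [h0, word_eq]⟩
  · rintro s τ hs - ⟨h22, hI⟩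
    have h0 : τ.reg 0 = n := (hI.frame.reg 0 (by norm_num)).trans hE.n_eq
    have hox : τ.mem ox s = RowOrder.ord A K n s := by
      rw [hI.frame.mem ox hE.ox_notMem]
      exact hE.ox_eq s hs
    have hlt : RowOrder.ord A K n s < n := ord_lt hs
    refine run_seq.mpr (run_assign.mpr ⟨RowOrder.ord A K n s,
      by simp (disch := omega) [h22, hox, word_eq], run_seq.mpr (run_assign.mpr ⟨0,
      by simp (disch := omega) [word_eq], ?_⟩)⟩)
    refine Run.for (c := 120) (N := n) (fun t τ => τ.reg 22 = s ∧ τ.reg 23 = t ∧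
      τ.reg 24 = RowOrder.ord A K n s ∧ τ.reg 26 ≤ 1 ∧
      (τ.reg 26 ≠ 0 ↔ ∃ t' < t, MeetAt A A' k K n s t' ∧ GtAt A A' K n s t') ∧
      CompareInv A A' K n k won cmp c₀ em σ s t τ) (by omega) ?_ ?_ ?_ ?_
    · refine ⟨by simp [h22], by simp, by simp, by simp, by simp, ?_⟩
      obtain ⟨hF, hcount, h₁, h₂, h₃⟩ := hI
      exact ⟨((hF.setReg (by norm_num) _).setReg (by norm_num) _).setReg (by norm_num) _,
        by simpa using hcount, h₁, h₂, h₃⟩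
    · rintro t τ ht ⟨-, h23, -, -, -, hI⟩
      have h0 : τ.reg 0 = n := (hI.frame.reg 0 (by norm_num)).trans hE.n_eq
      exact ⟨h23, by simp (disch := omega) [h0, word_eq]⟩
    · rintro t τ ht - ⟨h22, h23, h24, h26, h26', hI⟩
      refine Run.mono (run_comparePair hW hK hk hE hask hs ht h22 h23 h24 h26 h26' hI) ?_
      rintro τ' c ⟨hc, h22, h23, h24, h26, h26', hF, hcount, h₁, h₂, h₃⟩
      exact ⟨hc, h23, by simp [h22], by simp, by simp [h24], by simpa using h26,
        by simpa using h26', hF.setReg (by norm_num) _, by simpa using hcount, h₁, h₂, h₃⟩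
    · rintro τ' c hc ⟨h22, -, -, -, -, hF, hcount, hwle, hwiff, hcmp⟩
      have hbits : bits (MeetAt A A' k K n) (GtAt A A' K n) n (s + 1) ++
          rowBits (MeetAt A A' k K n) (GtAt A A' K n) (s + 1) 0 =
          bits (MeetAt A A' k K n) (GtAt A A' K n) n s ++
          rowBits (MeetAt A A' k K n) (GtAt A A' K n) s n := by
        rw [bits_succ]
        simp [rowBits]
      refine ⟨?_, h22, by simp, ?_⟩
      · simp only [Expr.cost] at hc ⊢
        omega
      · refine ⟨by rw [hbits]; exact hF.setReg (by norm_num) _,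
          by rw [hbits]; simpa using hcount, hwle, ?_, ?_⟩
        · intro t ht
          rw [State.setReg_mem, hwiff t ht]
          refine exists_congr fun s' => and_congr_left fun _ => ?_
          omega
        · intro s' hs' t ht h
          exact hcmp s' hs' t ht (by omega)
  · rintro τ t ht ⟨-, hF, hcount, -, -, hcmp⟩
    have hbits : bits (MeetAt A A' k K n) (GtAt A A' K n) n n ++
          rowBits (MeetAt A A' k K n) (GtAt A A' K n) n 0 =
          bits (MeetAt A A' k K n) (GtAt A A' K n) n n := by
        simp [rowBits]
    rw [hbits] at hF hcount
    refine ⟨ht.trans ?_, hF, hcount, ?_⟩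
    · simp only [Expr.cost]
      nlinarith
    · intro p hp q hq hM
      obtain ⟨s, hs, rfl⟩ := exists_order (known_imp (A := A) (K := K)) hp
      obtain ⟨t, ht, rfl⟩ := exists_order (known_imp (A := A') (K := K)) hq
      exact hcmp s hs t ht (Or.inl hs) hM

end WordRAM

/-! ### The common part of construction and query -/

namespace WordRAM

open RowOrder Questions

/-- The answers to all questions about two rows: first those about columns of `A` and columns
of `A'` that are not to their left, then those with the rows exchanged. -/
noncomputable def allBits (A A' : ℕ → ℕ) (k K n : ℕ) : List Bool :=
  bits (MeetAt A A' k K n) (GtAt A A' K n) n n ++ bits (MeetAt A' A k K n) (GtAt A' A K n) n n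

theorem length_allBits_le (A A' : ℕ → ℕ) (k K n : ℕ) : (allBits A A' k K n).length ≤ 4 * n := by
  have h1 := length_bits_le (N := MeetAt A A' k K n) (G := GtAt A A' K n) n
  have h2 := length_bits_le (N := MeetAt A' A k K n) (G := GtAt A' A K n) n
  rw [allBits, List.length_append]
  omega

/-- The banks used by `compareAll`. -/
def workBanks : Set ℕ := {4, 5, 6, 7, 8, 9, 10, 11}

/-- Compares the two rows with rank tables in banks `2` and `3`. The orders of the columns go to
banks `4` and `5`, the results of the comparisons to banks `10` and `11`. The questions are
counted in register `20`, from the value of `e₀`. -/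
def compareAll (e₀ : Expr) (ask ask' : Cmd) : Cmd :=
  .seq (degrees 2 6) (.seq (choose 2 4 6) (.seq (degrees 3 7) (.seq (choose 3 5 7)
    (.seq (.assign 20 e₀) (.seq (compareRows 2 3 4 5 8 10 ask) (compareRows 3 2 5 4 9 11 ask'))))))

variable {w : ℕ} {enc : List Bool} {n K k : ℕ}

theorem run_compareAll {A A' : ℕ → ℕ} {c₀ : ℕ} {em : Bool} {σ : State} {e₀ : Expr}
    {ask ask' : Cmd} (hW : n * n + 4 * n + 4 ≤ 2 ^ w) (hK : K = min k n) (hk : k ≤ 2 * n)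
    (h0 : σ.reg 0 = n) (h1 : σ.reg 1 = k)
    (htab : ∀ p < n, ∀ q < n, σ.mem 2 (p * n + q) = rk A K p q)
    (htab' : ∀ p < n, ∀ q < n, σ.mem 3 (p * n + q) = rk A' K p q)
    (h8 : ∀ c < n, σ.mem 8 c = 0) (h9 : ∀ c < n, σ.mem 9 c = 0)
    (he₀ : ∀ σ' : State, (∀ r < 20, σ'.reg r = σ.reg r) → e₀.eval w enc σ' = some c₀)
    (hask : ∀ σ', Frame workBanks σ σ' → AskSpec w enc A A' K n k 8 10 c₀ em σ' ask)
    (hask' : ∀ σ', Frame workBanks (σ.appendOut (outOf em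
        (bits (MeetAt A A' k K n) (GtAt A A' K n) n n))) σ' → AskSpec w enc A' A K n k 9 11
      (c₀ + (bits (MeetAt A A' k K n) (GtAt A A' K n) n n).length) em σ' ask') :
    Run w enc (compareAll e₀ ask ask') σ fun τ t =>
      t ≤ 460 * (n * n) + 300 * n + e₀.cost + 100 ∧
      Frame workBanks (σ.appendOut (outOf em (allBits A A' k K n))) τ ∧
      τ.reg 20 = c₀ + (allBits A A' k K n).length ∧
      (∀ p < n, ∀ q < n, Meet A A' k K p q →
        τ.mem 10 (p * n + q) = if A' q < A p then 1 else 0) ∧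
      ∀ p < n, ∀ q < n, Meet A' A k K p q →
        τ.mem 11 (p * n + q) = if A q < A' p then 1 else 0 := by
  have hKn : K ≤ n := by omega
  refine run_seq.mpr (Run.mono (run_degrees (tab := 2) (deg := 6) hW h0 hKn (by norm_num) htab) ?_)
  rintro τ₁ t₁ ⟨ht₁, hF₁, hd₁⟩
  refine run_seq.mpr (Run.mono (run_choose (tab := 2) (ord := 4) (deg := 6) (A := A) hW
    ((hF₁.reg 0 (by norm_num)).trans h0) hKn (by norm_num) (by norm_num) (by norm_num)
    (by rw [hF₁.mem 2 (by simp)]; exact htab) hd₁) ?_)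
  rintro τ₂ t₂ ⟨ht₂, hF₂, ho₂⟩
  refine run_seq.mpr (Run.mono (run_degrees (tab := 3) (deg := 7) (A := A') hW
    ((hF₂.reg 0 (by norm_num)).trans ((hF₁.reg 0 (by norm_num)).trans h0)) hKn (by norm_num)
    (by rw [hF₂.mem 3 (by simp), hF₁.mem 3 (by simp)]; exact htab')) ?_)
  rintro τ₃ t₃ ⟨ht₃, hF₃, hd₃⟩
  refine run_seq.mpr (Run.mono (run_choose (tab := 3) (ord := 5) (deg := 7) (A := A') hW
    ((hF₃.reg 0 (by norm_num)).trans ((hF₂.reg 0 (by norm_num)).trans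
      ((hF₁.reg 0 (by norm_num)).trans h0))) hKn (by norm_num) (by norm_num) (by norm_num)
    (by rw [hF₃.mem 3 (by simp), hF₂.mem 3 (by simp), hF₁.mem 3 (by simp)]; exact htab') hd₃) ?_)
  rintro τ₄ t₄ ⟨ht₄, hF₄, ho₄⟩
  have hF : Frame workBanks σ τ₄ :=
    (hF₁.mono (by simp [workBanks])).trans ((hF₂.mono (by simp [workBanks, Set.insert_subset_iff])).trans
      ((hF₃.mono (by simp [workBanks])).trans (hF₄.mono (by simp [workBanks, Set.insert_subset_iff]))))
  have m2 : τ₄.mem 2 = σ.mem 2 := hF.mem 2 (by simp [workBanks])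
  have m3 : τ₄.mem 3 = σ.mem 3 := hF.mem 3 (by simp [workBanks])
  have m4 : τ₄.mem 4 = τ₂.mem 4 := by rw [hF₄.mem 4 (by simp), hF₃.mem 4 (by simp)]
  have m8 : τ₄.mem 8 = σ.mem 8 := by
    rw [hF₄.mem 8 (by simp), hF₃.mem 8 (by simp), hF₂.mem 8 (by simp), hF₁.mem 8 (by simp)]
  have m9 : τ₄.mem 9 = σ.mem 9 := by
    rw [hF₄.mem 9 (by simp), hF₃.mem 9 (by simp), hF₂.mem 9 (by simp), hF₁.mem 9 (by simp)]
  refine run_seq.mpr (run_assign.mpr ⟨c₀, he₀ _ hF.reg, ?_⟩)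
  have hF5 := hF.setReg (r := 20) le_rfl c₀
  set τ₅ := τ₄.setReg 20 c₀ with hτ₅
  have hE : CompareEnv A A' K n k 2 3 4 5 8 10 τ₅ := by
    refine ⟨(hF5.reg 0 (by norm_num)).trans h0, (hF5.reg 1 (by norm_num)).trans h1, ?_, ?_, ?_, ?_,
      by simp, by simp, by simp, by simp, by norm_num⟩
    · rw [hτ₅, State.setReg_mem, m2]
      exact htab
    · rw [hτ₅, State.setReg_mem, m3]
      exact htab'
    · rw [hτ₅, State.setReg_mem, m4]
      exact ho₂
    · exact ho₄
  refine run_seq.mpr (Run.mono (run_compareRows hW hK hk hE (hask τ₅ hF5) (by simp [hτ₅])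
    (by rw [hτ₅, State.setReg_mem, m8]; exact h8)) ?_)
  rintro τ₆ t₆ ⟨ht₆, hF₆, hc₆, hcmp⟩
  have hF6 : Frame workBanks (σ.appendOut (outOf em
      (bits (MeetAt A A' k K n) (GtAt A A' K n) n n))) τ₆ := by
    have h := hF₆.mono (B' := workBanks) (by simp [workBanks, Set.insert_subset_iff])
    refine Frame.trans (τ := τ₅.appendOut (outOf em _)) ⟨hF5.reg, hF5.mem, ?_⟩ h
    simp only [State.appendOut, hF5.out]
  have hE' : CompareEnv A' A K n k 3 2 5 4 9 11 τ₆ := by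
    refine ⟨(hF6.reg 0 (by norm_num)).trans h0, (hF6.reg 1 (by norm_num)).trans h1, ?_, ?_, ?_, ?_,
      by simp, by simp, by simp, by simp, by norm_num⟩
    · rw [hF₆.mem 3 (by simp)]
      exact hE.ty_eq
    · rw [hF₆.mem 2 (by simp)]
      exact hE.tx_eq
    · rw [hF₆.mem 5 (by simp)]
      exact hE.oy_eq
    · rw [hF₆.mem 4 (by simp)]
      exact hE.ox_eq
  have m9' : τ₆.mem 9 = σ.mem 9 := by
    rw [hF₆.mem 9 (by simp)]
    exact m9
  refine Run.mono (run_compareRows hW hK hk hE' (hask' τ₆ hF6) hc₆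
    (by rw [m9']; exact h9)) ?_
  rintro τ₇ t₇ ⟨ht₇, hF₇, hc₇, hcmp'⟩
  refine ⟨by omega, ?_, ?_, ?_, hcmp'⟩
  · have h := hF₇.mono (B' := workBanks) (by simp [workBanks, Set.insert_subset_iff])
    refine Frame.trans (τ := τ₆.appendOut (outOf em _)) ⟨hF6.reg, hF6.mem, ?_⟩ h
    simp only [State.appendOut, allBits, hF6.out, outOf_append, List.append_assoc]
  · rw [hc₇, allBits, List.length_append, Nat.add_assoc]
  · rw [hF₇.mem 10 (by simp)]
    exact hcmp

/-! ### The construction program -/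

/-- Compares two values of the array, and emits the result. -/
def askArray (x y : ℕ) : Cmd :=
  .seq (.assign 21 (.bin .lt (.load y (.reg 25)) (.load x (.reg 24))))
    (.seq (.emit (.reg 21) (.const 1)) (.assign 20 (.bin .add (.reg 20) (.const 1))))

theorem lowBits_one (b : Bool) : lowBits b.toNat 1 = [b] := by
  cases b <;> rfl

theorem askSpec_askArray {A A' : ℕ → ℕ} {won cmp c₀ x y : ℕ} {σ : State}
    (hw : 1 ≤ w) (hW : n * n + 4 * n + 4 ≤ 2 ^ w) (hc₀ : c₀ ≤ 2 * n)
    (hx : ∀ c < n, σ.mem x c = A c ∧ A c < 2 ^ w) (hy : ∀ c < n, σ.mem y c = A' c ∧ A' c < 2 ^ w)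
    (hxB : x ∉ ({won, cmp} : Set ℕ)) (hyB : y ∉ ({won, cmp} : Set ℕ)) :
    AskSpec w enc A A' K n k won cmp c₀ true σ (askArray x y) := by
  intro L b s t τ hs ht hb hpre h20 h24 h25 hF
  have hp : RowOrder.ord A K n s < n := ord_lt hs
  have hq : RowOrder.ord A' K n t < n := ord_lt ht
  have hL := hpre.length_le
  have hL' := length_bits_le (N := MeetAt A A' k K n) (G := GtAt A A' K n) n
  rw [List.length_append, List.length_singleton] at hL
  obtain ⟨hx1, hx2⟩ := hx _ hp
  obtain ⟨hy1, hy2⟩ := hy _ hq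
  have hmx : τ.mem x = σ.mem x := hF.mem x hxB
  have hmy : τ.mem y = σ.mem y := hF.mem y hyB
  have hbt : b.toNat = if A' (RowOrder.ord A' K n t) < A (RowOrder.ord A K n s) then 1 else 0 := by
    have hb' : b = true ↔ A' (RowOrder.ord A' K n t) < A (RowOrder.ord A K n s) := hb
    cases b with
    | true => rw [if_pos (hb'.mp rfl)]; rfl
    | false => rw [if_neg fun h => absurd (hb'.mpr h) (by simp)]; rfl
  have hb1 : b.toNat ≤ 1 := Bool.toNat_le b
  refine run_seq.mpr (run_assign.mpr ⟨b.toNat, ?_, run_seq.mpr (run_emit.mpr ⟨b.toNat, ?_, 1, ?_,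
    hw, run_assign.mpr ⟨τ.reg 20 + 1, ?_, ?_, ?_⟩⟩)⟩)
  · rw [hbt] at hb1 ⊢
    simp (disch := omega) [h24, h25, hmx, hmy, hx1, hy1, word_eq]
  · simp (disch := omega) [word_eq]
  · simp (disch := omega) [word_eq]
  · simp (disch := omega) [word_eq]
  · simp [Expr.cost]
  · refine ⟨fun r h h' => by simp [h, h'], by simp, by simp, by simp, ?_⟩
    simp [outOf, lowBits_one]

/-- Copies the rows to banks `20` and `21`. -/
def copyRows : Cmd :=
  .for 22 (.reg 0) (.seq (.store 20 (.reg 22) (.load 0 (.reg 22)))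
    (.store 21 (.reg 22) (.load 1 (.reg 22))))

/-- The construction program: it runs the program `B` on copies of the two rows, and then appends the
answers to the questions and padding. Row `i` has the registers `40 + i + 2 * r` and the banks
`20 + i + 2 * b`. The construction makes no probes, and register `3`, which is to contain their offset,
stays `0`. -/
def encoder (B : Cmd) : Cmd :=
  .seq (.assign 2 (.bin .sub (.reg 1) (.bin .sub (.reg 1) (.reg 0)))) (.seq copyRows
    (.seq (.assign 40 (.reg 0)) (.seq (.assign 42 (.reg 2))
    (.seq (.assign 41 (.reg 0)) (.seq (.assign 43 (.reg 2))
    (.seq (B.ren (fun r => 40 + 2 * r) (fun b => 20 + 2 * b) 3)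
    (.seq (B.ren (fun r => 41 + 2 * r) (fun b => 21 + 2 * b) 3)
    (.seq (rankTable 0 2) (.seq (rankTable 1 3)
    (.seq (compareAll (.const 0) (askArray 0 1) (askArray 1 0))
      (.loop (.bin .lt (.reg 20) (.bin .mul (.const 4) (.reg 0)))
        (.seq (.emit (.const 0) (.const 1))
          (.assign 20 (.bin .add (.reg 20) (.const 1)))))))))))))))

/-- The values of a row, as a function on all natural numbers. -/
def rowFun {n : ℕ} (a : Fin n → ℕ) (c : ℕ) : ℕ := (List.ofFn a).getD c 0

theorem rowFun_of_lt {n : ℕ} (a : Fin n → ℕ) {c : ℕ} (hc : c < n) : rowFun a c = a ⟨c, hc⟩ := by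
  simp [rowFun, List.getD_eq_getElem?_getD, hc]

theorem rowFun_of_le {n : ℕ} (a : Fin n → ℕ) {c : ℕ} (hc : n ≤ c) : rowFun a c = 0 := by
  simp [rowFun, List.getD_eq_getElem?_getD, hc]

theorem rowFun_lt {n : ℕ} {a : Fin n → ℕ} (ha : ∀ x, a x < 2 ^ w) (c : ℕ) :
    rowFun a c < 2 ^ w := by
  rcases lt_or_ge c n with h | h
  · rw [rowFun_of_lt a h]
    exact ha _
  · rw [rowFun_of_le a h]
    positivity

theorem run_copyRows {A A' : ℕ → ℕ} {σ : State} (hW : n * n + 4 * n + 4 ≤ 2 ^ w)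
    (h0 : σ.reg 0 = n) (hA : ∀ c, σ.mem 0 c = A c) (hA' : ∀ c, σ.mem 1 c = A' c)
    (hlt : ∀ c, A c < 2 ^ w) (hlt' : ∀ c, A' c < 2 ^ w)
    (hz : ∀ c, n ≤ c → A c = 0) (hz' : ∀ c, n ≤ c → A' c = 0)
    (h20 : ∀ c, σ.mem 20 c = 0) (h21 : ∀ c, σ.mem 21 c = 0) :
    Run w enc copyRows σ fun τ t => t ≤ 20 * n + 10 ∧ (∀ r, r ≠ 22 → τ.reg r = σ.reg r) ∧
      (∀ b, b ≠ 20 → b ≠ 21 → τ.mem b = σ.mem b) ∧ (∀ c, τ.mem 20 c = A c) ∧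
      (∀ c, τ.mem 21 c = A' c) ∧ τ.out = σ.out := by
  refine Run.for (c := 10) (N := n) (fun j τ => τ.reg 22 = j ∧ (∀ r, r ≠ 22 → τ.reg r = σ.reg r) ∧
      (∀ b, b ≠ 20 → b ≠ 21 → τ.mem b = σ.mem b) ∧
      (∀ c, τ.mem 20 c = if c < j then A c else 0) ∧
      (∀ c, τ.mem 21 c = if c < j then A' c else 0) ∧ τ.out = σ.out) (by omega) ?_ ?_ ?_ ?_
  · refine ⟨by simp, fun r hr => by simp [hr], by simp, by simp [h20], by simp [h21], by simp⟩
  · rintro j τ hj ⟨h22, hr, -⟩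
    have h0' := (hr 0 (by norm_num)).trans h0
    exact ⟨h22, by simp (disch := omega) [h0', word_eq]⟩
  · rintro j τ hj - ⟨h22, hr, hb, hc, hc', ho⟩
    have h1 := hA j
    have h2 := hA' j
    have h3 := hlt j
    have h4 := hlt' j
    have m0 := hb 0 (by norm_num) (by norm_num)
    have m1 := hb 1 (by norm_num) (by norm_num)
    refine run_seq.mpr (run_store.mpr ⟨j, by simp (disch := omega) [h22, word_eq], A j,
      by simp (disch := omega) [h22, m0, h1, word_eq], run_store.mpr ⟨j,
      by simp (disch := omega) [h22, word_eq], A' j, ?_, by simp [Expr.cost], by simp [h22],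
      by simp, fun r hr' => ?_, fun b hb1 hb2 => ?_, fun c => ?_, fun c => ?_, by simp [ho]⟩⟩)
    · simp only [eval_load, eval_reg, State.setMem_reg, h22]
      rw [word_eq (by omega), Option.bind_some, State.setMem_mem_of_ne _ _ _ (by norm_num), m1, h2,
        word_eq h4]
    · simp [hr', hr r hr']
    · rw [State.setReg_mem, State.setMem_mem_of_ne _ _ _ hb2, State.setMem_mem_of_ne _ _ _ hb1,
        hb b hb1 hb2]
    · rw [State.setReg_mem, State.setMem_mem_of_ne _ _ _ (by norm_num), State.setMem_mem, hc]
      by_cases hcj : c = j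
      · simp [hcj]
      · have : c < j + 1 ↔ c < j := by omega
        simp [hcj, this]
    · rw [State.setReg_mem, State.setMem_mem, State.setMem_mem_of_ne _ _ _ (by norm_num), hc']
      by_cases hcj : c = j
      · simp [hcj]
      · have : c < j + 1 ↔ c < j := by omega
        simp [hcj, this]
  · rintro τ t ht ⟨-, hr, hb, hc, hc', ho⟩
    refine ⟨?_, hr, hb, fun c => ?_, fun c => ?_, ho⟩
    · simp only [Expr.cost] at ht
      omega
    · rw [hc]
      split_ifs with h
      · rfl
      · exact (hz c (by omega)).symm
    · rw [hc']
      split_ifs with h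
      · rfl
      · exact (hz' c (by omega)).symm

theorem run_pad {σ : State} {m : ℕ} (hn : 1 ≤ n) (hw : 1 ≤ w) (hW : n * n + 4 * n + 4 ≤ 2 ^ w)
    (h0 : σ.reg 0 = n) (h20 : σ.reg 20 = m) (hm : m ≤ 4 * n) :
    Run w enc (.loop (.bin .lt (.reg 20) (.bin .mul (.const 4) (.reg 0)))
        (.seq (.emit (.const 0) (.const 1)) (.assign 20 (.bin .add (.reg 20) (.const 1))))) σ
      fun τ t => t ≤ 60 * n + 10 ∧ τ.out = σ.out ++ List.replicate (4 * n - m) false := by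
  refine Run.mono (Run.loop (c := 8) (fun d τ => d ≤ 4 * n - m ∧ τ.reg 0 = n ∧
    τ.reg 20 = 4 * n - d ∧ τ.out = σ.out ++ List.replicate (4 * n - m - d) false) (4 * n - m)
    ⟨le_rfl, h0, by omega, by simp⟩ ?_) ?_
  · rintro d τ ⟨hd, h0, h20, ho⟩
    have h1 : (if 4 * n - d < 4 * n then 1 else 0) ≤ 1 := by split_ifs <;> simp
    refine ⟨if 4 * n - d < 4 * n then 1 else 0, ?_, fun h => ?_⟩
    · rw [eval_bin, eval_bin, eval_reg, eval_reg, eval_const, h0, h20, word_eq (by omega),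
        word_eq (by omega), word_eq (by omega)]
      simp only [Option.bind_some, BinOp.eval_mul, BinOp.eval_lt]
      rw [word_eq (by omega)]
      simp only [Option.bind_some]
      rw [word_eq (by omega)]
    · have hlt : 4 * n - d < 4 * n := by
        by_contra hlt
        simp only [hlt, if_false] at h
        exact h rfl
      refine ⟨d - 1, by omega, run_seq.mpr (run_emit.mpr ⟨0, by simp (disch := omega) [word_eq], 1,
        by simp (disch := omega) [word_eq], hw, run_assign.mpr ⟨4 * n - d + 1,
        by simp (disch := omega) [h20, word_eq], by simp [Expr.cost], by omega, by simp [h0], ?_,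
        ?_⟩⟩)⟩
      · rw [State.setReg_reg, if_pos rfl]
        omega
      · rw [State.setReg_out, ho, List.append_assoc]
        have : 4 * n - m - (d - 1) = (4 * n - m - d) + 1 := by omega
        rw [this, List.replicate_succ']
        rfl
  · rintro τ t ⟨ht, hev, d, hd, h0, h20, ho⟩
    have hd0 : d = 0 := by
      by_contra hne
      have hlt : 4 * n - d < 4 * n := by omega
      rw [eval_bin, eval_bin, eval_reg, eval_reg, eval_const, h0, h20, word_eq (by omega),
        word_eq (by omega), word_eq (by omega)] at hev
      simp only [Option.bind_some, BinOp.eval_mul, BinOp.eval_lt] at hev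
      rw [word_eq (by omega)] at hev
      simp only [Option.bind_some, hlt, if_true] at hev
      rw [word_eq (by omega)] at hev
      simp at hev
    subst hd0
    refine ⟨?_, by rw [ho, Nat.sub_zero]⟩
    simp only [Expr.cost] at ht
    omega

end WordRAM

namespace WordRAM

open RowOrder Questions

variable {w : ℕ} {enc : List Bool} {n K k : ℕ}

/-- A renamed copy of a construction program runs correctly inside a larger program, whatever the
other registers and banks contain. -/
theorem run_ren_of_builds {w₁ R C : ℕ} {B : Cmd} {a : Fin n → ℕ} {e : List Bool} {ρ β : ℕ → ℕ}
    (hw : w₁ ≤ w) (hR : B.Bdd R) (hB : Builds1D w₁ B n K a e C) (hρ : Function.Injective ρ)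
    (hβ : Function.Injective β) (hρ3 : ∀ r, ρ r ≠ 3) {σ : State} (h3 : σ.reg 3 = 0)
    (hreg : ∀ r, σ.reg (ρ r) = [n, K].getD r 0)
    (hmem : ∀ b c, σ.mem (β b) c = if b = 0 then rowFun a c else 0) :
    Run w [] (B.ren ρ β 3) σ fun τ t => t ≤ 3 * C ∧ (∀ r, (∀ s, ρ s ≠ r) → τ.reg r = σ.reg r) ∧
      (∀ b, (∀ s, β s ≠ b) → τ.mem b = σ.mem b) ∧ τ.out = σ.out ++ e := by
  obtain ⟨τ, s, hex, hout, hs⟩ := hB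
  have hS : SimEnv w₁ w [] [] ρ β 3 0 :=
    ⟨hw, hρ, hβ, hρ3, by simp, by simp, by simp⟩
  have hE : Embeds (2 ^ w₁) R ρ β (State.init [n, K] [List.ofFn a]) σ := by
    refine ⟨fun r _ => hreg r, fun b _ c _ => ?_⟩
    rw [hmem]
    cases b with
    | zero => rfl
    | succ b => simp [State.init]
  obtain ⟨l, hl, hrun⟩ := hS.exec le_rfl hex hR σ hE h3
  refine hrun.mono ?_
  rintro τ' t ⟨ht, hF⟩
  refine ⟨by omega, hF.reg, hF.mem, ?_⟩
  rw [hF.out, ← hout, hl]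
  rfl

theorem builds_encoder {w₁ C : ℕ} {B : Cmd} {A : Fin 2 → Fin n → ℕ} {e₀ e₁ : List Bool}
    (hn : 1 ≤ n) (hw₁ : w₁ ≤ w) (hw : 1 ≤ w) (hW : n * n + 4 * n + 4 ≤ 2 ^ w) (hk : k ≤ 2 * n)
    (hA : ∀ r x, A r x < 2 ^ w) (h₀ : Builds1D w₁ B n (min k n) (A 0) e₀ C)
    (h₁ : Builds1D w₁ B n (min k n) (A 1) e₁ C) :
    Builds2D w (encoder B) n k A
      (e₀ ++ e₁ ++ (allBits (rowFun (A 0)) (rowFun (A 1)) k (min k n) n ++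
        List.replicate (4 * n - (allBits (rowFun (A 0)) (rowFun (A 1)) k (min k n) n).length) false))
      (6 * C + 2000 * (n * n)) := by
  obtain ⟨R, hR⟩ := B.exists_bdd
  set V₀ := rowFun (A 0) with hV₀
  set V₁ := rowFun (A 1) with hV₁
  set K := min k n with hK
  have hnn : n ≤ n * n := Nat.le_mul_of_pos_left n hn
  have hV₀lt : ∀ c, V₀ c < 2 ^ w := rowFun_lt (hA 0)
  have hV₁lt : ∀ c, V₁ c < 2 ^ w := rowFun_lt (hA 1)
  suffices h : Run w [] (encoder B) (State.init [n, k] [List.ofFn (A 0), List.ofFn (A 1)])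
      fun τ t => τ.out = e₀ ++ e₁ ++ (allBits V₀ V₁ k K n ++
        List.replicate (4 * n - (allBits V₀ V₁ k K n).length) false) ∧
        t ≤ 6 * C + 2000 * (n * n) by
    obtain ⟨τ, t, h1, h2, h3⟩ := h
    exact ⟨τ, t, h1, h2, h3⟩
  set σ := State.init [n, k] [List.ofFn (A 0), List.ofFn (A 1)] with hσ
  have g0 : σ.reg 0 = n := rfl
  have g1 : σ.reg 1 = k := rfl
  have gr : ∀ r, 2 ≤ r → σ.reg r = 0 := by
    intro r hr
    obtain ⟨r, rfl⟩ := Nat.exists_eq_add_of_le' hr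
    rfl
  have gm0 : σ.mem 0 = V₀ := rfl
  have gm1 : σ.mem 1 = V₁ := rfl
  have gm : ∀ b, 2 ≤ b → ∀ c, σ.mem b c = 0 := by
    intro b hb c
    obtain ⟨b, rfl⟩ := Nat.exists_eq_add_of_le' hb
    rfl
  have hKe : k - (k - n) = K := by omega
  refine run_seq.mpr (run_assign.mpr ⟨K, by simp (disch := omega) [g0, g1, word_eq, hKe], ?_⟩)
  refine run_seq.mpr (Run.mono (run_copyRows (A := V₀) (A' := V₁) hW (by simp [g0])
    (by simp [gm0]) (by simp [gm1]) hV₀lt hV₁lt (fun c => rowFun_of_le _) (fun c => rowFun_of_le _)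
    (by simp [gm 20]) (by simp [gm 21])) ?_)
  rintro σ₁ t₁ ⟨ht₁, hr₁, hm₁, h20₁, h21₁, ho₁⟩
  have r0 : σ₁.reg 0 = n := by rw [hr₁ 0 (by norm_num)]; simp [g0]
  have r2 : σ₁.reg 2 = K := by rw [hr₁ 2 (by norm_num)]; simp
  refine run_seq.mpr (run_assign.mpr ⟨n, by simp (disch := omega) [r0, word_eq],
    run_seq.mpr (run_assign.mpr ⟨K, by simp (disch := omega) [r2, word_eq],
    run_seq.mpr (run_assign.mpr ⟨n, by simp (disch := omega) [r0, word_eq],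
    run_seq.mpr (run_assign.mpr ⟨K, by simp (disch := omega) [r2, word_eq], ?_⟩)⟩)⟩)⟩)
  set σ₂ := (((σ₁.setReg 40 n).setReg 42 K).setReg 41 n).setReg 43 K with hσ₂
  have hr₂ : ∀ r, σ₂.reg r = if r = 43 then K else if r = 41 then n else if r = 42 then K else
      if r = 40 then n else if r = 22 then σ₁.reg 22 else if r = 2 then K else σ.reg r := by
    intro r
    simp only [hσ₂, State.setReg_reg]
    by_cases h22 : r = 22
    · subst h22
      simp
    · rw [hr₁ r h22, State.setReg_reg]
      simp [h22]
  have hm₂ : ∀ b c, σ₂.mem b c = if b = 20 then V₀ c else if b = 21 then V₁ c else σ.mem b c := by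
    intro b c
    change σ₁.mem b c = _
    by_cases hb : b = 20
    · simp [hb, h20₁]
    · by_cases hb' : b = 21
      · simp [hb', h21₁]
      · rw [hm₁ b hb hb']
        simp [hb, hb']
  have ho₂ : σ₂.out = [] := by
    change σ₁.out = _
    rw [ho₁]
    rfl
  -- the program `B` runs on the first row
  refine run_seq.mpr (Run.mono (run_ren_of_builds hw₁ hR h₀ (ρ := fun r => 40 + 2 * r)
    (β := fun b => 20 + 2 * b) (fun a b h => by simpa using h) (fun a b h => by simpa using h)
    (fun r => by simp; omega) (by simp [hr₂, gr]) (fun r => ?_) (fun b c => ?_)) ?_)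
  · rcases r with _ | _ | r
    · simp [hr₂]
    · simp [hr₂]
    · rw [hr₂, gr _ (by omega), if_neg (by omega), if_neg (by omega), if_neg (by omega),
        if_neg (by omega), if_neg (by omega), if_neg (by omega)]
      rfl
  · rw [hm₂]
    rcases b with _ | b
    · simp [hV₀]
    · rw [gm _ (by omega)]
      simp
      omega
  rintro σ₃ t₃ ⟨ht₃, hr₃, hm₃, ho₃⟩
  -- the program `B` runs on the second row
  refine run_seq.mpr (Run.mono (run_ren_of_builds hw₁ hR h₁ (ρ := fun r => 41 + 2 * r)
    (β := fun b => 21 + 2 * b) (fun a b h => by simpa using h) (fun a b h => by simpa using h)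
    (fun r => by simp; omega) (by rw [hr₃ _ (by intro s; omega)]; simp [hr₂, gr])
    (fun r => ?_) (fun b c => ?_)) ?_)
  · rw [hr₃ _ (by intro s; omega)]
    rcases r with _ | _ | r
    · simp [hr₂]
    · simp [hr₂]
    · rw [hr₂, gr _ (by omega), if_neg (by omega), if_neg (by omega), if_neg (by omega),
        if_neg (by omega), if_neg (by omega), if_neg (by omega)]
      rfl
  · rw [hm₃ _ (by intro s; omega), hm₂]
    rcases b with _ | b
    · simp [hV₁]
    · rw [gm _ (by omega)]
      simp
      omega
  rintro σ₄ t₄ ⟨ht₄, hr₄, hm₄, ho₄⟩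
  have hr₄' : ∀ r < 20, σ₄.reg r = if r = 2 then K else σ.reg r := by
    intro r hr
    rw [hr₄ r (by intro s; omega), hr₃ r (by intro s; omega), hr₂]
    simp [show r ≠ 43 by omega, show r ≠ 41 by omega, show r ≠ 42 by omega, show r ≠ 40 by omega,
      show r ≠ 22 by omega]
  have hm₄' : ∀ b < 20, σ₄.mem b = σ.mem b := by
    intro b hb
    rw [hm₄ b (by intro s; omega), hm₃ b (by intro s; omega)]
    funext c
    rw [hm₂]
    simp [show b ≠ 20 by omega, show b ≠ 21 by omega]
  have ho₄' : σ₄.out = e₀ ++ e₁ := by rw [ho₄, ho₃, ho₂, List.nil_append]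
  have s0 : σ₄.reg 0 = n := by rw [hr₄' 0 (by norm_num)]; simp [g0]
  have s1 : σ₄.reg 1 = k := by rw [hr₄' 1 (by norm_num)]; simp [g1]
  have s2 : σ₄.reg 2 = K := by rw [hr₄' 2 (by norm_num)]; simp
  have hKn : K ≤ n := min_le_right _ _
  -- the rank tables
  refine run_seq.mpr (Run.mono (run_rankTable (src := 0) (dst := 2) (A := V₀) hW s0 s2 hKn
    (by norm_num) (fun c hc => ⟨by rw [hm₄' 0 (by norm_num), gm0], hV₀lt c⟩)) ?_)
  rintro σ₅ t₅ ⟨ht₅, hF₅, htab⟩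
  refine run_seq.mpr (Run.mono (run_rankTable (src := 1) (dst := 3) (A := V₁) hW
    ((hF₅.reg 0 (by norm_num)).trans s0) ((hF₅.reg 2 (by norm_num)).trans s2) hKn (by norm_num)
    (fun c hc => ⟨by rw [hF₅.mem 1 (by simp), hm₄' 1 (by norm_num), gm1], hV₁lt c⟩)) ?_)
  rintro σ₆ t₆ ⟨ht₆, hF₆, htab'⟩
  have m0 : σ₆.mem 0 = V₀ := by
    rw [hF₆.mem 0 (by simp), hF₅.mem 0 (by simp), hm₄' 0 (by norm_num), gm0]
  have m1 : σ₆.mem 1 = V₁ := by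
    rw [hF₆.mem 1 (by simp), hF₅.mem 1 (by simp), hm₄' 1 (by norm_num), gm1]
  have hlen := length_bits_le (N := MeetAt V₀ V₁ k K n) (G := GtAt V₀ V₁ K n) n
  -- the questions
  refine run_seq.mpr (Run.mono (run_compareAll (c₀ := 0) (em := true) (A := V₀) (A' := V₁) hW hK hk
    ((hF₆.reg 0 (by norm_num)).trans ((hF₅.reg 0 (by norm_num)).trans s0))
    ((hF₆.reg 1 (by norm_num)).trans ((hF₅.reg 1 (by norm_num)).trans s1))
    (by rw [hF₆.mem 2 (by simp)]; exact htab) htab'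
    (fun c _ => by rw [hF₆.mem 8 (by simp), hF₅.mem 8 (by simp), hm₄' 8 (by norm_num),
      gm 8 (by norm_num)])
    (fun c _ => by rw [hF₆.mem 9 (by simp), hF₅.mem 9 (by simp), hm₄' 9 (by norm_num),
      gm 9 (by norm_num)])
    (fun σ' _ => by simp (disch := omega) [word_eq])
    (fun σ' hF => askSpec_askArray hw hW (by omega)
      (fun c _ => ⟨by rw [hF.mem 0 (by simp [workBanks]), m0], hV₀lt c⟩)
      (fun c _ => ⟨by rw [hF.mem 1 (by simp [workBanks]), m1], hV₁lt c⟩) (by simp) (by simp))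
    (fun σ' hF => askSpec_askArray hw hW (by omega)
      (fun c _ => ⟨by rw [hF.mem 1 (by simp [workBanks])]; exact congrFun m1 c, hV₁lt c⟩)
      (fun c _ => ⟨by rw [hF.mem 0 (by simp [workBanks])]; exact congrFun m0 c, hV₀lt c⟩)
      (by simp) (by simp))) ?_)
  rintro σ₇ t₇ ⟨ht₇, hF₇, hc₇, -, -⟩
  have s0' : σ₇.reg 0 = n := (hF₇.reg 0 (by norm_num)).trans
    ((hF₆.reg 0 (by norm_num)).trans ((hF₅.reg 0 (by norm_num)).trans s0))
  rw [Nat.zero_add] at hc₇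
  refine Run.mono (run_pad hn hw hW s0' hc₇ (length_allBits_le _ _ _ _ _)) ?_
  rintro σ₈ t₈ ⟨ht₈, ho₈⟩
  refine ⟨?_, ?_⟩
  · rw [ho₈, hF₇.out, State.appendOut, hF₆.out, hF₅.out, ho₄']
    simp [outOf]
  · simp only [Expr.cost] at ht₇ ⊢
    omega

end WordRAM

/-! ### Merging two sorted lists -/

open RowOrder WordRAM in
theorem IsSortedTopK.isTop {n K : ℕ} {v : Fin n → ℕ} {i j : Fin n} {L : List (Fin n)}
    {f : ℕ → ℕ} (h : IsSortedTopK v (Finset.Icc i j) K L)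
    (hf : ∀ l (hl : l < L.length), f l = (L[l] : ℕ)) : IsTop (rowFun v) K i j f := by
  obtain ⟨hpw, hlen, hmem, hlt⟩ := h
  have hv : ∀ c : Fin n, rowFun v c = v c := fun c => rowFun_of_lt v c.2
  rw [Fin.card_Icc] at hlen
  refine ⟨fun l hl => ?_, fun l hl l' hl' => ?_, fun c hc hc' hne l hl => ?_⟩
  · rw [hf l (by omega)]
    have := hmem _ (List.getElem_mem (show l < L.length by omega))
    simpa using this
  · rw [hf l (by omega), hf l' (by omega), hv, hv]
    exact List.pairwise_iff_getElem.mp hpw _ _ _ _ hl'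
  · have hcn : c < n := hc'.trans_lt j.2
    rw [hf l (by omega), hv]
    have := hlt _ (List.getElem_mem (show l < L.length by omega)) ⟨c, hcn⟩
      (by simp only [Finset.mem_Icc, Fin.le_def]; omega) (fun hm => by
        obtain ⟨l', hl', he⟩ := List.getElem_of_mem hm
        refine hne l' (by omega) ?_
        rw [hf l' hl', he])
    rwa [← hv] at this

namespace RowOrder

/-- A state of the merging of the lists `F 0` and `F 1`, of lengths `N 0` and `N 1`, of columns of
two rows with values `V 0` and `V 1`: the first `c r` elements of the list of row `r` have been moved
to the merged list `L`. -/
structure Merging {n : ℕ} (V F : Fin 2 → ℕ → ℕ) (N c : Fin 2 → ℕ) (L : List (Fin 2 × Fin n)) :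
    Prop where
  pairwise : L.Pairwise fun x y => V y.1 y.2 < V x.1 x.2
  mem_iff : ∀ x, x ∈ L ↔ ∃ s < c x.1, F x.1 s = x.2
  lt_of_mem : ∀ x ∈ L, ∀ r s, c r ≤ s → s < N r → V r (F r s) < V x.1 x.2
  length : L.length = c 0 + c 1
  le : ∀ r, c r ≤ N r

variable {n : ℕ} {V F : Fin 2 → ℕ → ℕ} {N c : Fin 2 → ℕ} {L : List (Fin 2 × Fin n)}

theorem Merging.nil : Merging V F N 0 ([] : List (Fin 2 × Fin n)) :=
  ⟨by simp, by simp, by simp, by simp, by simp⟩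

theorem Merging.step (h : Merging V F N c L)
    (hV : ∀ r, ∀ s < N r, ∀ s' < s, V r (F r s) < V r (F r s')) (r : Fin 2) (hr : c r < N r)
    (hlt : ∀ r', r' ≠ r → c r' < N r' → V r' (F r' (c r')) < V r (F r (c r))) (x : Fin n)
    (hx : F r (c r) = x) : Merging V F N (Function.update c r (c r + 1)) (L ++ [(r, x)]) where
  pairwise := by
    rw [List.pairwise_append]
    refine ⟨h.pairwise, by simp, fun y hy z hz => ?_⟩
    rw [List.mem_singleton] at hz
    subst hz
    have := h.lt_of_mem y hy r (c r) le_rfl hr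
    rwa [hx] at this
  mem_iff y := by
    rw [List.mem_append, h.mem_iff, List.mem_singleton]
    obtain ⟨r', y⟩ := y
    by_cases hrr : r' = r
    · subst hrr
      simp only [Function.update_self, Prod.mk.injEq, true_and]
      constructor
      · rintro (⟨s, hs, he⟩ | rfl)
        · exact ⟨s, by omega, he⟩
        · exact ⟨c r', by omega, hx⟩
      · rintro ⟨s, hs, he⟩
        rcases Nat.lt_succ_iff_lt_or_eq.mp hs with hs' | rfl
        · exact Or.inl ⟨s, hs', he⟩
        · exact Or.inr (Fin.ext (he.symm.trans hx))
    · simp [hrr]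
  lt_of_mem y hy r' s hs hs' := by
    have hs2 : c r' ≤ s := by
      refine le_trans ?_ hs
      by_cases hrr : r' = r
      · subst hrr
        simp
      · simp [hrr]
    rw [List.mem_append, List.mem_singleton] at hy
    rcases hy with hy | rfl
    · exact h.lt_of_mem y hy r' s hs2 hs'
    · simp only [← hx]
      by_cases hrr : r' = r
      · subst hrr
        rw [Function.update_self] at hs
        exact hV r' s hs' _ hs
      · refine lt_of_le_of_lt ?_ (hlt r' hrr (hs2.trans_lt hs'))
        rcases hs2.eq_or_lt with he | hlt'
        · rw [he]
        · exact (hV r' s hs' _ hlt').le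
  length := by
    rw [List.length_append, h.length]
    fin_cases r <;> simp <;> omega
  le r' := by
    by_cases hrr : r' = r
    · subst hrr
      rw [Function.update_self]
      exact hr
    · simpa [hrr] using h.le r'

/-- Once sufficiently many elements have been merged, they form the answer to the query on the two
rows. An element that is missing from the list of its own row can only be large if this list is
exhausted; then the list of the row makes up the whole answer. -/
theorem Merging.isSortedTopK {k K : ℕ} {i j : Fin 2} {a b : Fin n} (h : Merging V F N c L)
    (hij : i ≤ j) (hK : K = min k n) (hF : ∀ r, IsTop (V r) K a b (F r))
    (hN : ∀ r, N r = if i ≤ r ∧ r ≤ j then min K (b + 1 - a) else 0)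
    (hc : c 0 + c 1 = min k (N 0 + N 1)) :
    IsSortedTopK (fun p : Fin 2 × Fin n => V p.1 p.2) (Finset.Icc i j ×ˢ Finset.Icc a b) k L := by
  have hNr : ∀ r, 0 < N r → (i ≤ r ∧ r ≤ j) ∧ N r = min K (b + 1 - a) := by
    intro r hr
    have := hN r
    split_ifs at this with hr'
    · exact ⟨hr', this⟩
    · omega
  refine ⟨h.pairwise, ?_, ?_, ?_⟩
  · have hb := b.2
    rw [h.length, hc, Finset.card_product, Fin.card_Icc, Fin.card_Icc, hN, hN]
    fin_cases i <;> fin_cases j <;> simp at hij ⊢ <;> omega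
  · rintro ⟨r, x⟩ hx
    obtain ⟨s, hs, he⟩ := (h.mem_iff _).mp hx
    have hle := h.le r
    simp only at hs he
    obtain ⟨h1, h2⟩ := hNr r (by omega)
    have := (hF r).mem s (by omega)
    rw [he] at this
    exact Finset.mem_product.mpr ⟨Finset.mem_Icc.mpr h1, Finset.mem_Icc.mpr this⟩
  · rintro p hp ⟨r, x⟩ hq hq'
    simp only [Finset.mem_product, Finset.mem_Icc, Fin.le_def] at hq
    have hNr' : N r = min K (b + 1 - a) := (hN r).trans (if_pos hq.1)
    simp only
    by_cases hex : ∃ s < N r, F r s = x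
    · obtain ⟨s, hs, he⟩ := hex
      rw [← he]
      refine h.lt_of_mem p hp r s ?_ hs
      by_contra hlt
      exact hq' ((h.mem_iff _).mpr ⟨s, by simpa using hlt, he⟩)
    · push Not at hex
      have hlt := (hF r).lt_of_ne x hq.2.1 hq.2.2 (by rw [← hNr']; exact hex)
      rw [← hNr'] at hlt
      rcases (h.le r).lt_or_eq with hcr | hcr
      · exact (hlt _ hcr).trans (h.lt_of_mem p hp r _ le_rfl hcr)
      · have hKlt : K < b + 1 - a := by
          by_contra hK'
          obtain ⟨l, hl, he⟩ := (hF r).exists_of_le (not_lt.mp hK') hq.2.1 hq.2.2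
          exact hex l (by omega) he
        have hb := b.2
        have hpr : p.1 = r := by
          by_contra hpr
          obtain ⟨s, hs, -⟩ := (h.mem_iff p).mp hp
          have h01 : c 0 + c 1 = c p.1 + c r := by
            generalize p.1 = t at hpr
            fin_cases t <;> fin_cases r <;> simp at hpr ⊢
            omega
          omega
        obtain ⟨s, hs, he⟩ := (h.mem_iff p).mp hp
        rw [hpr] at hs he
        have := hlt s (by omega)
        rw [hpr]
        rwa [he] at this

end RowOrder

/-! ### Loops without a bound on the running time -/

namespace WordRAM

open RowOrder

variable {w : ℕ} {enc : List Bool} {σ : State}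

theorem Run.loop_untimed {e : Expr} {p : Cmd} (Inv : ℕ → State → Prop) (N : ℕ) (h0 : Inv N σ)
    (hstep : ∀ d τ, Inv d τ → ∃ v, e.eval w enc τ = some v ∧
      (v ≠ 0 → ∃ d', d = d' + 1 ∧ Run w enc p τ fun τ' _ => Inv d' τ')) :
    Run w enc (.loop e p) σ fun τ _ => e.eval w enc τ = some 0 ∧ ∃ d, Inv d τ := by
  induction N generalizing σ with
  | zero =>
    obtain ⟨v, hv, h⟩ := hstep _ _ h0
    by_cases hv0 : v = 0
    · subst hv0
      exact ⟨_, _, .loopStop e p σ hv, hv, _, h0⟩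
    · obtain ⟨d', hd, -⟩ := h hv0
      omega
  | succ N ih =>
    obtain ⟨v, hv, h⟩ := hstep _ _ h0
    by_cases hv0 : v = 0
    · subst hv0
      exact ⟨_, _, .loopStop e p σ hv, hv, _, h0⟩
    · obtain ⟨d', hd, τ, s, hex, hI⟩ := h hv0
      obtain rfl : N = d' := by omega
      obtain ⟨ρ, t, hex', h3⟩ := ih hI
      exact ⟨ρ, _, .loopStep e p σ τ ρ v s t hv hv0 hex hex', h3⟩

theorem Run.for_untimed {i N : ℕ} {e : Expr} {p : Cmd} {Q : State → Prop}
    (Inv : ℕ → State → Prop) (hN : N < 2 ^ w) (h0 : Inv 0 (σ.setReg i 0))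
    (he : ∀ j τ, j ≤ N → Inv j τ → τ.reg i = j ∧ e.eval w enc τ = some N)
    (hstep : ∀ j τ, j < N → τ.reg i = j → Inv j τ → Run w enc p τ fun τ' _ =>
      τ'.reg i = j ∧ Inv (j + 1) (τ'.setReg i (j + 1)))
    (hQ : ∀ τ, Inv N τ → Q τ) :
    Run w enc (.for i e p) σ fun τ _ => Q τ := by
  have hpos : 0 < 2 ^ w := by positivity
  unfold Cmd.for
  rw [run_seq, run_assign]
  refine ⟨0, by rw [eval_const, word_eq hpos], ?_⟩
  refine Run.mono (Run.loop_untimed (fun d τ => ∃ j, j + d = N ∧ Inv j τ) N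
    ⟨0, by simp, h0⟩ ?_) ?_
  · rintro d τ ⟨j, hj, hI⟩
    obtain ⟨hi, hev⟩ := he j τ (by omega) hI
    have hlt : (if j < N then 1 else 0) < 2 ^ w := by
      split_ifs
      · omega
      · exact hpos
    refine ⟨if j < N then 1 else 0, ?_, ?_⟩
    · rw [eval_bin, eval_reg, hi, hev, word_eq (by omega)]
      exact word_eq hlt
    · intro hv
      have hjN : j < N := by
        by_contra h
        simp [h] at hv
      refine ⟨d - 1, by omega, ?_⟩
      rw [run_seq]
      refine Run.mono (hstep j τ hjN hi hI) ?_
      rintro τ' t ⟨hi', hI'⟩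
      rw [run_assign]
      refine ⟨j + 1, ?_, j + 1, by omega, hI'⟩
      rw [eval_bin, eval_reg, eval_const, hi', word_eq (by omega), word_eq (by omega)]
      exact word_eq (show j + 1 < 2 ^ w by omega)
  · rintro τ t ⟨hev, d, j, hj, hI⟩
    obtain ⟨hi, hev'⟩ := he j τ (by omega) hI
    have : j = N := by
      by_contra hne
      have hjN : j < N := by omega
      rw [eval_bin, eval_reg, hi, hev', word_eq (by omega)] at hev
      simp only [Option.bind_some, BinOp.eval, hjN, if_true] at hev
      rw [word_eq (by omega)] at hev
      simp at hev
    subst this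
    exact hQ _ hI

/-! ### Queries to one row -/

/-- The number `(2 * n) ^ c`, where `n` is the contents of register `0`. -/
def Expr.power : ℕ → Expr
  | 0 => .const 1
  | c + 1 => .bin .mul (.power c) (.bin .mul (.const 2) (.reg 0))

theorem eval_power {n c : ℕ} (hn : 1 ≤ n) (h0 : σ.reg 0 = n) (hc : 1 ≤ c)
    (h : (2 * n) ^ c < 2 ^ w) : (Expr.power c).eval w enc σ = some ((2 * n) ^ c) := by
  have h2n : 2 * n < 2 ^ w := lt_of_le_of_lt (Nat.le_self_pow (by omega) _) h
  clear hc
  induction c with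
  | zero => exact word_eq (by omega)
  | succ c ih =>
    have hle : (2 * n) ^ c ≤ (2 * n) ^ (c + 1) := Nat.pow_le_pow_right (by omega) (by omega)
    rw [Expr.power, eval_bin, ih (hle.trans_lt h), eval_bin, eval_const, eval_reg, h0,
      word_eq (by omega), word_eq (by omega)]
    simp only [Option.bind_some, BinOp.eval_mul]
    rw [word_eq h2n, Option.bind_some, ← pow_succ, word_eq h]

theorem two_pow_wordSize_le {n : ℕ} (hn : 1 ≤ n) (c : ℕ) : 2 ^ wordSize c n ≤ (2 * n) ^ c := by
  rw [wordSize, Nat.mul_comm, pow_mul, pow_succ]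
  have := Nat.pow_log_le_self 2 (show n ≠ 0 by omega)
  exact Nat.pow_le_pow_left (by omega) _

/-- Sets `R` registers to zero. -/
def clearRegs : ℕ → Cmd
  | 0 => .skip
  | R + 1 => .seq (clearRegs R) (.assign (40 + R) (.const 0))

/-- Sets a cell to zero in each of `R` banks. -/
def clearCells : ℕ → Cmd
  | 0 => .skip
  | R + 1 => .seq (clearCells R) (.store (20 + R) (.reg 28) (.const 0))

theorem run_clearRegs (R : ℕ) : Run w enc (clearRegs R) σ fun τ _ =>
    (∀ r, τ.reg r = if 40 ≤ r ∧ r < 40 + R then 0 else σ.reg r) ∧ τ.mem = σ.mem := by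
  induction R with
  | zero =>
    refine run_skip.mpr ⟨fun r => ?_, rfl⟩
    rw [if_neg (by omega)]
  | succ R ih =>
    refine run_seq.mpr (ih.mono ?_)
    rintro τ t ⟨hr, hm⟩
    refine run_assign.mpr ⟨0, word_eq (by positivity), fun r => ?_, hm⟩
    rw [State.setReg_reg, hr]
    split_ifs <;> first | rfl | omega

theorem run_clearCells (R : ℕ) (h28 : σ.reg 28 < 2 ^ w) : Run w enc (clearCells R) σ fun τ _ =>
    τ.reg = σ.reg ∧
      ∀ b a, τ.mem b a = if (20 ≤ b ∧ b < 20 + R) ∧ a = σ.reg 28 then 0 else σ.mem b a := by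
  induction R with
  | zero =>
    refine run_skip.mpr ⟨rfl, fun b a => ?_⟩
    rw [if_neg (by omega)]
  | succ R ih =>
    refine run_seq.mpr (ih.mono ?_)
    rintro τ t ⟨hr, hm⟩
    refine run_store.mpr ⟨σ.reg 28, by rw [eval_reg, hr, word_eq h28], 0,
      word_eq (by positivity), hr, fun b a => ?_⟩
    rw [State.setMem_mem, hm]
    split_ifs <;> first | rfl | omega

/-- Runs the query program `Q`, with its registers and banks below `R`, in a separate and cleared
part of the machine, on the part of the encoding that starts at the address in register `11`. The
ends of the range are in registers `12` and `13`, and the answer is written to bank `20`. All cells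
with addresses below `(2 * n) ^ (c + 1)` are cleared: these are more than `Q` can address with words of
`c * (log n + 1)` bits, and, even if `c = 0`, include all cells that the answer occupies. -/
def query (Q : Cmd) (c R : ℕ) : Cmd :=
  .seq (clearRegs R) (.seq (.for 28 (.power (c + 1)) (clearCells R))
    (.seq (.assign 40 (.reg 0)) (.seq (.assign 41 (.reg 2)) (.seq (.assign 42 (.reg 12))
      (.seq (.assign 43 (.reg 13)) (.seq (.assign 44 (.reg 3))
        (Q.ren (fun r => 40 + r) (fun b => 20 + b) 11)))))))

variable {n K T c R : ℕ}

/-- The part of the encoding at `off`, of length `S`, represents the row `V`, via the query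
program `Q`: all queries are answered correctly, whatever the machine has done before. -/
def Represents (w : ℕ) (enc : List Bool) (Q : Cmd) (c n K S R : ℕ) (V : ℕ → ℕ) (off : ℕ) : Prop :=
  ∀ (i j : ℕ), i ≤ j → j < n → ∀ σ : State, σ.reg 0 = n → σ.reg 2 = K → σ.reg 3 = S →
    σ.reg 11 = off → σ.reg 12 = i → σ.reg 13 = j → Run w enc (query Q c R) σ fun τ _ =>
      (∀ r < 40, r ≠ 28 → τ.reg r = σ.reg r) ∧ (∀ b < 20, τ.mem b = σ.mem b) ∧
      IsTop V K i j (τ.mem 20)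

theorem represents_of_answers {Q : Cmd} {a : Fin n → ℕ} {e : List Bool} {off : ℕ}
    (hn : 1 ≤ n) (hQ : Q.Bdd R) (hR : 5 ≤ R) (hP : (2 * n) ^ (c + 1) < 2 ^ w) (hK : K < 2 ^ w)
    (hw : wordSize c n ≤ w) (hlt : enc.length < 2 ^ w)
    (hle : off + e.length ≤ enc.length) (hpart : (enc.drop off).take e.length = e)
    (hA : ∀ i j : Fin n, i ≤ j → Answers1D (wordSize c n) Q n K a e i j T) :
    Represents w enc Q c n K e.length R (rowFun a) off := by
  intro i j hij hj σ h0 h2 h3 h11 h12 h13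
  obtain ⟨τ₀, s, hex, -, L, hL, hτ₀⟩ := hA ⟨i, hij.trans_lt hj⟩ ⟨j, hj⟩ hij
  have h2n : 2 * n < 2 ^ w := lt_of_le_of_lt (Nat.le_self_pow (by omega) _) hP
  refine run_seq.mpr ((run_clearRegs R).mono ?_)
  rintro σ₁ t₁ ⟨hr₁, hm₁⟩
  have hr₁' : ∀ r < 40, σ₁.reg r = σ.reg r := fun r hr => by rw [hr₁, if_neg (by omega)]
  refine run_seq.mpr (Run.for_untimed (N := (2 * n) ^ (c + 1)) (fun j τ => τ.reg 28 = j ∧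
    (∀ r, r ≠ 28 → τ.reg r = σ₁.reg r) ∧ ∀ b a, τ.mem b a =
      if (20 ≤ b ∧ b < 20 + R) ∧ a < j then 0 else σ.mem b a) hP ?_ ?_ ?_ ?_)
  · refine ⟨by simp, fun r hr => by simp [hr], fun b a => ?_⟩
    rw [State.setReg_mem, hm₁, if_neg (by omega)]
  · rintro j τ hj ⟨h28, hr, -⟩
    exact ⟨h28, eval_power hn (by rw [hr 0 (by norm_num), hr₁' 0 (by norm_num), h0]) (by omega) hP⟩
  · rintro j τ hj h28 ⟨-, hr, hm⟩
    refine (run_clearCells R (by omega)).mono ?_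
    rintro τ' t ⟨hr', hm'⟩
    refine ⟨by rw [hr', h28], by simp, fun r h => by simp [h, hr', hr], fun b a => ?_⟩
    rw [State.setReg_mem, hm', hm, h28]
    split_ifs <;> first | rfl | omega
  rintro σ₂ ⟨-, hr₂, hm₂⟩
  have g0 : σ₂.reg 0 = n := by rw [hr₂ 0 (by norm_num), hr₁' 0 (by norm_num), h0]
  have g2 : σ₂.reg 2 = K := by rw [hr₂ 2 (by norm_num), hr₁' 2 (by norm_num), h2]
  have g3 : σ₂.reg 3 = e.length := by rw [hr₂ 3 (by norm_num), hr₁' 3 (by norm_num), h3]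
  have g11 : σ₂.reg 11 = off := by rw [hr₂ 11 (by norm_num), hr₁' 11 (by norm_num), h11]
  have g12 : σ₂.reg 12 = i := by rw [hr₂ 12 (by norm_num), hr₁' 12 (by norm_num), h12]
  have g13 : σ₂.reg 13 = j := by rw [hr₂ 13 (by norm_num), hr₁' 13 (by norm_num), h13]
  refine run_seq.mpr (run_assign.mpr ⟨n, by simp (disch := omega) [g0, word_eq],
    run_seq.mpr (run_assign.mpr ⟨K, by simp (disch := omega) [g2, word_eq],
    run_seq.mpr (run_assign.mpr ⟨i, by simp (disch := omega) [g12, word_eq],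
    run_seq.mpr (run_assign.mpr ⟨j, by simp (disch := omega) [g13, word_eq],
    run_seq.mpr (run_assign.mpr ⟨e.length, by simp (disch := omega) [g3, word_eq],
      ?_⟩)⟩)⟩)⟩)⟩)
  set σ₃ := ((((σ₂.setReg 40 n).setReg 41 K).setReg 42 i).setReg 43 j).setReg 44 e.length with hσ₃
  have hr₃ : ∀ r < 40, σ₃.reg r = σ₂.reg r := by
    intro r hr
    simp [hσ₃, show r ≠ 40 by omega, show r ≠ 41 by omega, show r ≠ 42 by omega,
      show r ≠ 43 by omega, show r ≠ 44 by omega]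
  have hm₃ : σ₃.mem = σ₂.mem := rfl
  have hS : SimEnv (wordSize c n) w e enc (fun r => 40 + r) (fun b => 20 + b) 11 off :=
    ⟨hw, fun a b h => by simpa using h, fun a b h => by simpa using h, fun r => by omega, hlt, hle,
      hpart⟩
  have hE : Embeds ((2 * n) ^ (c + 1)) R (fun r => 40 + r) (fun b => 20 + b)
      (State.init [n, K, i, j, e.length] []) σ₃ := by
    refine ⟨fun r hr => ?_, fun b hb a ha => ?_⟩
    · rcases r with _ | _ | _ | _ | _ | r
      · simp [hσ₃, State.init]
      · simp [hσ₃, State.init]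
      · simp [hσ₃, State.init]
      · simp [hσ₃, State.init]
      · simp [hσ₃, State.init]
      · have : σ₃.reg (40 + (r + 5)) = σ₂.reg (40 + (r + 5)) := by
          simp only [hσ₃, State.setReg_reg]
          rw [if_neg (by omega), if_neg (by omega), if_neg (by omega), if_neg (by omega),
            if_neg (by omega)]
        refine this.trans ?_
        rw [hr₂ _ (by omega), hr₁, if_pos (by omega)]
        rfl
    · rw [hm₃, hm₂, if_pos (by omega)]
      rfl
  have hM : 2 ^ wordSize c n ≤ (2 * n) ^ (c + 1) :=
    (two_pow_wordSize_le hn c).trans (Nat.pow_le_pow_right (by omega) (by omega))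
  obtain ⟨l, -, hrun⟩ := hS.exec hM hex hQ σ₃ hE ((hr₃ 11 (by norm_num)).trans g11)
  refine hrun.mono ?_
  rintro τ t ⟨-, hF⟩
  refine ⟨fun r hr hr28 => ?_, fun b hb => ?_, ?_⟩
  · rw [hF.reg r (by intro s; omega), hr₃ r hr, hr₂ r hr28, hr₁' r hr]
  · rw [hF.mem b (by intro s; omega), hm₃]
    funext a
    rw [hm₂, if_neg (by omega)]
  · refine hL.isTop (f := τ.mem 20) fun l hl => ?_
    have hlen := hL.2.1
    rw [Fin.card_Icc] at hlen
    have hln : l < (2 * n) ^ (c + 1) := by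
      have h1 : 2 * n ≤ (2 * n) ^ (c + 1) := Nat.le_self_pow (by omega) _
      simp only at hlen
      omega
    rw [← hτ₀ l hl]
    exact hF.embeds.mem 0 (by omega) l hln

end WordRAM

/-! ### Tables and lists obtained by queries to one row -/

namespace RowOrder

theorem IsTop.congr {A : ℕ → ℕ} {K a b : ℕ} {f g : ℕ → ℕ} (h : IsTop A K a b f)
    (hfg : ∀ l < min K (b + 1 - a), g l = f l) : IsTop A K a b g where
  mem l hl := by
    rw [hfg l hl]
    exact h.mem l hl
  anti l hl l' hl' := by
    rw [hfg l hl, hfg l' (hl'.trans hl)]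
    exact h.anti l hl l' hl'
  lt_of_ne c hc hc' hne l hl := by
    rw [hfg l hl]
    exact h.lt_of_ne c hc hc' (fun l' hl' => by rw [← hfg l' hl']; exact hne l' hl') l hl

end RowOrder

namespace WordRAM

open RowOrder

/-- Registers below `12` and banks below `20` other than `dst` are unchanged. -/
structure Keeps (dst : ℕ) (σ τ : State) : Prop where
  reg : ∀ r < 12, τ.reg r = σ.reg r
  mem : ∀ b < 20, b ≠ dst → τ.mem b = σ.mem b

/-- The length of the answer to a query, for the ends of the range in registers `12` and `13`. -/
def Expr.answerLength : Expr :=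
  .bin .sub (.reg 2) (.bin .sub (.reg 2) (.bin .sub (.bin .add (.reg 13) (.const 1)) (.reg 12)))

/-- Determines the rank of the column in register `14` on the range spanned by this column and the
column in register `15`. -/
def queryRank (Q : Cmd) (c R dst : ℕ) : Cmd :=
  .seq (.assign 12 (.bin .sub (.reg 14) (.bin .sub (.reg 14) (.reg 15))))
    (.seq (.assign 13 (.bin .add (.reg 14) (.bin .sub (.reg 15) (.reg 14))))
    (.seq (query Q c R) (.seq (.assign 16 (.reg 2))
    (.seq (.for 17 .answerLength
        (.ite (.bin .eq (.load 20 (.reg 17)) (.reg 14)) (.assign 16 (.reg 17)) .skip))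
      (.store dst (.idx 14 15) (.reg 16))))))

/-- Writes the rank table of a row to bank `dst`, by queries to the row. -/
def queryTable (Q : Cmd) (c R dst : ℕ) : Cmd :=
  .for 14 (.reg 0) (.for 15 (.reg 0) (queryRank Q c R dst))

/-- Writes the answer to the query to bank `dst`, for the range given by registers `9` and `10`. -/
def queryList (Q : Cmd) (c R dst : ℕ) : Cmd :=
  .seq (.assign 12 (.reg 9)) (.seq (.assign 13 (.reg 10)) (.seq (query Q c R)
    (.for 14 .answerLength (.store dst (.reg 14) (.load 20 (.reg 14))))))

variable {w : ℕ} {enc : List Bool} {Q : Cmd} {n K S c R off dst : ℕ} {V : ℕ → ℕ}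

theorem eval_answerLength {τ : State} {a b : ℕ} (hW : n * n + 4 * n + 4 ≤ 2 ^ w) (hK : K ≤ n)
    (hb : b < n) (hab : a ≤ b) (h2 : τ.reg 2 = K) (h12 : τ.reg 12 = a) (h13 : τ.reg 13 = b) :
    Expr.answerLength.eval w enc τ = some (min K (b + 1 - a)) := by
  have : K - (K - (b + 1 - a)) = min K (b + 1 - a) := by omega
  simp (disch := omega) [Expr.answerLength, h2, h12, h13, word_eq, this]

theorem run_queryRank {σ : State} {p q : ℕ} (hW : n * n + 4 * n + 4 ≤ 2 ^ w) (hK : K ≤ n)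
    (hV : Represents w enc Q c n K S R V off) (hdst : dst < 20) (h0 : σ.reg 0 = n)
    (h2 : σ.reg 2 = K) (h3 : σ.reg 3 = S) (h11 : σ.reg 11 = off) (h14 : σ.reg 14 = p)
    (h15 : σ.reg 15 = q) (hp : p < n) (hq : q < n) :
    Run w enc (queryRank Q c R dst) σ fun τ _ => Keeps dst σ τ ∧ τ.reg 14 = p ∧ τ.reg 15 = q ∧
      ∀ a, τ.mem dst a = if a = p * n + q then rk V K p q else σ.mem dst a := by
  have hpn := idx_lt hp hq
  have e1 : p - (p - q) = min p q := by omega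
  have e2 : p + (q - p) = max p q := by omega
  have hmax : max p q < n := by omega
  refine run_seq.mpr (run_assign.mpr ⟨min p q, by simp (disch := omega) [h14, h15, word_eq, e1],
    run_seq.mpr (run_assign.mpr ⟨max p q, by simp (disch := omega) [h14, h15, word_eq, e2],
    run_seq.mpr (Run.mono (hV (min p q) (max p q) (by omega) hmax _ (by simp [h0])
      (by simp [h2]) (by simp [h3]) (by simp [h11]) (by simp) (by simp)) ?_)⟩)⟩)
  rintro σ₁ t₁ ⟨hr₁, hm₁, hT⟩
  have g0 : σ₁.reg 0 = n := by rw [hr₁ 0 (by norm_num) (by norm_num)]; simp [h0]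
  have g2 : σ₁.reg 2 = K := by rw [hr₁ 2 (by norm_num) (by norm_num)]; simp [h2]
  have g12 : σ₁.reg 12 = min p q := by rw [hr₁ 12 (by norm_num) (by norm_num)]; simp
  have g13 : σ₁.reg 13 = max p q := by rw [hr₁ 13 (by norm_num) (by norm_num)]; simp
  have g14 : σ₁.reg 14 = p := by rw [hr₁ 14 (by norm_num) (by norm_num)]; simp [h14]
  have g15 : σ₁.reg 15 = q := by rw [hr₁ 15 (by norm_num) (by norm_num)]; simp [h15]
  refine run_seq.mpr (run_assign.mpr ⟨K, by simp (disch := omega) [g2, word_eq], ?_⟩)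
  refine run_seq.mpr (Run.for_untimed (N := min K (max p q + 1 - min p q)) (fun l τ =>
    τ.reg 17 = l ∧ (∀ r < 16, τ.reg r = σ₁.reg r) ∧ τ.mem = σ₁.mem ∧
      (∀ l' < l, σ₁.mem 20 l' = p → τ.reg 16 = l') ∧
      ((∀ l' < l, σ₁.mem 20 l' ≠ p) → τ.reg 16 = K)) (by omega) ?_ ?_ ?_ ?_)
  · refine ⟨by simp, fun r hr => ?_, rfl, by simp, by simp⟩
    simp [show r ≠ 17 by omega, show r ≠ 16 by omega]
  · rintro l τ hl ⟨h17, hr, -⟩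
    exact ⟨h17, eval_answerLength hW hK hmax (by omega) (by rw [hr 2 (by norm_num), g2])
      (by rw [hr 12 (by norm_num), g12]) (by rw [hr 13 (by norm_num), g13])⟩
  · rintro l τ hl h17 ⟨-, hr, hm, h16, h16'⟩
    have hmem := hT.mem l hl
    have k14 : τ.reg 14 = p := by rw [hr 14 (by norm_num), g14]
    have hle : (if σ₁.mem 20 l = p then 1 else 0) ≤ 1 := by split_ifs <;> simp
    refine run_ite.mpr ⟨if σ₁.mem 20 l = p then 1 else 0, ?_, ?_⟩
    · simp (disch := omega) [h17, k14, hm, word_eq]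
    · by_cases hl' : σ₁.mem 20 l = p
      · rw [if_pos (by simp [hl'])]
        refine run_assign.mpr ⟨l, by simp (disch := omega) [h17, word_eq], by simp [h17], by simp,
          fun r h => ?_, hm, fun l₂ h₂ he => ?_, fun h => absurd hl' (h l (by omega))⟩
        · simp [show r ≠ 17 by omega, show r ≠ 16 by omega, hr r h]
        · simpa using hT.inj hl (by omega) (hl'.trans he.symm)
      · rw [if_neg (by simp [hl'])]
        refine run_skip.mpr ⟨h17, by simp, fun r h => ?_, hm, fun l₂ h₂ he => ?_, fun h => ?_⟩
        · simp [show r ≠ 17 by omega, hr r h]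
        · have : l₂ ≠ l := fun h => hl' (h ▸ he)
          simpa using h16 l₂ (by omega) he
        · simpa using h16' fun l₂ h₂ => h l₂ (by omega)
  rintro σ₂ ⟨-, hr₂, hm₂, h16, h16'⟩
  have hrk : σ₂.reg 16 = rk V K p q := by
    by_cases hex : ∃ l < min K (max p q + 1 - min p q), σ₁.mem 20 l = p
    · obtain ⟨l, hl, he⟩ := hex
      rw [h16 l hl he, hT.rk_of_eq hl he]
    · push Not at hex
      rw [h16' hex, hT.rk_of_ne hex]
  have hrkK : rk V K p q ≤ K := min_le_left _ _
  have i0 : σ₂.reg 0 = n := by rw [hr₂ 0 (by norm_num), g0]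
  have i14 : σ₂.reg 14 = p := by rw [hr₂ 14 (by norm_num), g14]
  have i15 : σ₂.reg 15 = q := by rw [hr₂ 15 (by norm_num), g15]
  have hpn' : p * n ≤ p * n + q := Nat.le_add_right _ _
  refine run_store.mpr ⟨p * n + q, by simp (disch := omega) [Expr.idx, i0, i14, i15, word_eq],
    rk V K p q, by simp (disch := omega) [hrk, word_eq], ⟨fun r hr => ?_, fun b hb hbd => ?_⟩, i14,
    i15, fun a => ?_⟩
  · rw [State.setMem_reg, hr₂ r (by omega), hr₁ r (by omega) (by omega)]
    simp [show r ≠ 12 by omega, show r ≠ 13 by omega]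
  · rw [State.setMem_mem_of_ne _ _ _ hbd, hm₂, hm₁ b hb]
    rfl
  · rw [State.setMem_mem, hm₂, hm₁ dst hdst]
    simp

theorem run_queryTable {σ : State} (hW : n * n + 4 * n + 4 ≤ 2 ^ w) (hK : K ≤ n)
    (hV : Represents w enc Q c n K S R V off) (hdst : dst < 20) (h0 : σ.reg 0 = n)
    (h2 : σ.reg 2 = K) (h3 : σ.reg 3 = S) (h11 : σ.reg 11 = off) :
    Run w enc (queryTable Q c R dst) σ fun τ _ => Keeps dst σ τ ∧
      ∀ p < n, ∀ q < n, τ.mem dst (p * n + q) = rk V K p q := by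
  refine Run.for_untimed (N := n) (fun j τ => τ.reg 14 = j ∧ Keeps dst σ τ ∧
    ∀ p < j, ∀ q < n, τ.mem dst (p * n + q) = rk V K p q) (by omega) ?_ ?_ ?_ ?_
  · exact ⟨by simp, ⟨fun r hr => by simp [show r ≠ 14 by omega], fun b _ _ => rfl⟩, by simp⟩
  · rintro j τ hj ⟨h14, hk, -⟩
    exact ⟨h14, by simp (disch := omega) [hk.reg 0 (by norm_num), h0, word_eq]⟩
  · rintro p τ hp h14 ⟨-, hk, htab⟩
    refine Run.for_untimed (N := n) (fun j τ' => τ'.reg 15 = j ∧ τ'.reg 14 = p ∧ Keeps dst σ τ' ∧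
      (∀ p' < p, ∀ q < n, τ'.mem dst (p' * n + q) = rk V K p' q) ∧
      ∀ q < j, τ'.mem dst (p * n + q) = rk V K p q) (by omega) ?_ ?_ ?_ ?_
    · exact ⟨by simp, by simp [h14], ⟨fun r hr => by simp [show r ≠ 15 by omega, hk.reg r hr],
        hk.mem⟩, htab, by simp⟩
    · rintro j τ' hj ⟨h15, -, hk', -⟩
      exact ⟨h15, by simp (disch := omega) [hk'.reg 0 (by norm_num), h0, word_eq]⟩
    · rintro q τ' hq h15 ⟨-, h14', hk', ht, ht'⟩
      refine (run_queryRank hW hK hV hdst ((hk'.reg 0 (by norm_num)).trans h0)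
        ((hk'.reg 2 (by norm_num)).trans h2) ((hk'.reg 3 (by norm_num)).trans h3)
        ((hk'.reg 11 (by norm_num)).trans h11) h14' h15 hp hq).mono ?_
      rintro τ₂ t ⟨hk₂, j14, j15, hm⟩
      refine ⟨j15, by simp, by simp [j14], ⟨fun r hr => ?_, fun b hb hbd => ?_⟩,
        fun p' hp' q' hq' => ?_, fun q' hq' => ?_⟩
      · simp [show r ≠ 15 by omega, hk₂.reg r hr, hk'.reg r hr]
      · rw [State.setReg_mem, hk₂.mem b hb hbd, hk'.mem b hb hbd]
      · rw [State.setReg_mem, hm, if_neg (fun h => by have := (idx_inj hq' hq).mp h; omega),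
          ht p' hp' q' hq']
      · rw [State.setReg_mem, hm]
        split_ifs with h
        · rw [((idx_inj (by omega) hq).mp h).2]
        · exact ht' q' (by have : q' ≠ q := fun he => h (by rw [he]); omega)
    · rintro τ' ⟨-, h14', hk', ht, ht'⟩
      refine ⟨h14', by simp, ⟨fun r hr => by simp [show r ≠ 14 by omega, hk'.reg r hr], hk'.mem⟩,
        fun p' hp' q hq => ?_⟩
      rcases Nat.lt_succ_iff_lt_or_eq.mp hp' with h | rfl
      · exact ht p' h q hq
      · exact ht' q hq
  · rintro τ ⟨-, hk, ht⟩
    exact ⟨hk, ht⟩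

theorem run_queryList {σ : State} {a b : ℕ} (hW : n * n + 4 * n + 4 ≤ 2 ^ w) (hK : K ≤ n)
    (hV : Represents w enc Q c n K S R V off) (hdst : dst < 20) (h0 : σ.reg 0 = n)
    (h2 : σ.reg 2 = K) (h3 : σ.reg 3 = S) (h11 : σ.reg 11 = off) (h9 : σ.reg 9 = a)
    (h10 : σ.reg 10 = b) (hab : a ≤ b) (hb : b < n) :
    Run w enc (queryList Q c R dst) σ fun τ _ => Keeps dst σ τ ∧ IsTop V K a b (τ.mem dst) := by
  refine run_seq.mpr (run_assign.mpr ⟨a, by simp (disch := omega) [h9, word_eq],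
    run_seq.mpr (run_assign.mpr ⟨b, by simp (disch := omega) [h10, word_eq],
    run_seq.mpr (Run.mono (hV a b hab hb _ (by simp [h0])
      (by simp [h2]) (by simp [h3]) (by simp [h11]) (by simp) (by simp)) ?_)⟩)⟩)
  rintro σ₁ t₁ ⟨hr₁, hm₁, hT⟩
  have g2 : σ₁.reg 2 = K := by rw [hr₁ 2 (by norm_num) (by norm_num)]; simp [h2]
  have g12 : σ₁.reg 12 = a := by rw [hr₁ 12 (by norm_num) (by norm_num)]; simp
  have g13 : σ₁.reg 13 = b := by rw [hr₁ 13 (by norm_num) (by norm_num)]; simp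
  refine Run.for_untimed (N := min K (b + 1 - a)) (fun l τ => τ.reg 14 = l ∧
    (∀ r < 14, τ.reg r = σ₁.reg r) ∧ (∀ b', b' ≠ dst → τ.mem b' = σ₁.mem b') ∧
    ∀ l' < l, τ.mem dst l' = σ₁.mem 20 l') (by omega) ?_ ?_ ?_ ?_
  · exact ⟨by simp, fun r hr => by simp [show r ≠ 14 by omega], fun _ _ => rfl, by simp⟩
  · rintro l τ hl ⟨h14, hr, -⟩
    exact ⟨h14, eval_answerLength hW hK hb hab (by rw [hr 2 (by norm_num), g2])
      (by rw [hr 12 (by norm_num), g12]) (by rw [hr 13 (by norm_num), g13])⟩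
  · rintro l τ hl h14 ⟨-, hr, hm, hd⟩
    have hmem := hT.mem l hl
    have m20 := hm 20 (by omega)
    refine run_store.mpr ⟨l, by simp (disch := omega) [h14, word_eq], σ₁.mem 20 l,
      by simp (disch := omega) [h14, m20, word_eq], by simp [h14], by simp, fun r h => ?_,
      fun b' hb' => ?_, fun l' hl' => ?_⟩
    · simp [show r ≠ 14 by omega, hr r h]
    · rw [State.setReg_mem, State.setMem_mem_of_ne _ _ _ hb', hm b' hb']
    · rw [State.setReg_mem, State.setMem_mem]
      by_cases h : l' = l
      · simp [h]
      · rw [if_neg (by simp [h]), hd l' (by omega)]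
  · rintro τ ⟨-, hr, hm, hd⟩
    refine ⟨⟨fun r h => ?_, fun b' hb' hbd => ?_⟩, hT.congr hd⟩
    · rw [hr r (by omega), hr₁ r (by omega) (by omega)]
      simp [show r ≠ 12 by omega, show r ≠ 13 by omega]
    · rw [hm b' hbd, hm₁ b' hb']
      rfl

end WordRAM

/-! ### The query program -/

namespace WordRAM

open RowOrder Questions

variable {w : ℕ} {enc : List Bool} {n K k : ℕ}

/-- Reads the next answer from the encoding. -/
def askString : Cmd :=
  .seq (.assign 21 (.probe (.reg 20) (.const 1))) (.assign 20 (.bin .add (.reg 20) (.const 1)))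

theorem askSpec_askString {A A' : ℕ → ℕ} {won cmp c₀ : ℕ} {σ : State} {pre post : List Bool}
    (hw : 1 ≤ w) (hlt : enc.length < 2 ^ w) (hc₀ : pre.length = c₀)
    (henc : enc = pre ++ bits (MeetAt A A' k K n) (GtAt A A' K n) n n ++ post) :
    AskSpec w enc A A' K n k won cmp c₀ false σ askString := by
  rintro L b s t τ hs ht hb ⟨M, hM⟩ h20 h24 h25 hF
  have h1w : 1 < 2 ^ w := Nat.one_lt_two_pow (by omega)
  rw [← hM] at henc
  have hlen : enc.length = c₀ + L.length + 1 + M.length + post.length := by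
    rw [henc]
    simp only [List.length_append, List.length_singleton]
    omega
  have hdrop : enc.drop (c₀ + L.length) = b :: (M ++ post) := by
    have h : enc = (pre ++ L) ++ b :: (M ++ post) := by
      rw [henc]
      simp
    rw [h, ← hc₀, ← List.length_append, List.drop_left]
  refine run_seq.mpr (run_assign.mpr ⟨b.toNat, ?_, run_assign.mpr ⟨τ.reg 20 + 1,
    by simp (disch := omega) [word_eq], by simp [Expr.cost], ?_⟩⟩)
  · simp only [Expr.eval, Option.bind_eq_bind]
    rw [word_eq (by omega), word_eq h1w, Option.bind_some, Option.bind_some, if_pos (by omega), h20,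
      hdrop]
    simp [bitsToNat]
  · exact ⟨fun r h h' => by simp [h, h'], by simp, by simp, by simp, by simp [outOf]⟩

/-- Decides into register `19` whether the next element of the merged list comes from row `0`. The
lists of the two rows are in banks `12` and `13`, their lengths in registers `14` and `15`, and the
numbers of elements that have been moved in registers `16` and `17`. -/
def chooseRow : Cmd :=
  .ite (.bin .lt (.reg 16) (.reg 14))
    (.ite (.bin .lt (.reg 17) (.reg 15))
      (.seq (.assign 22 (.load 12 (.reg 16))) (.seq (.assign 23 (.load 13 (.reg 17)))
        (.ite (.bin .lt (.reg 23) (.reg 22))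
          (.assign 19 (.bin .sub (.const 1) (.load 11 (.idx 23 22))))
          (.assign 19 (.load 10 (.idx 22 23))))))
      (.assign 19 (.const 1)))
    (.assign 19 (.const 0))

/-- Moves the next element of the list in bank `src` to the answer. -/
def moveHead (row src cnt : ℕ) : Cmd :=
  .seq (.store 0 (.reg 18) (.const row)) (.seq (.store 1 (.reg 18) (.load src (.reg cnt)))
    (.assign cnt (.bin .add (.reg cnt) (.const 1))))

/-- Merges the lists of the two rows. -/
def mergeLists : Cmd :=
  .seq (.assign 16 (.const 0)) (.seq (.assign 17 (.const 0))
    (.for 18 (.bin .sub (.reg 1) (.bin .sub (.reg 1) (.bin .add (.reg 14) (.reg 15))))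
      (.seq chooseRow (.ite (.reg 19) (moveHead 0 12 16) (moveHead 1 13 17)))))

theorem run_chooseRow {σ : State} {V F : Fin 2 → ℕ → ℕ} {N c : Fin 2 → ℕ} {a b : ℕ}
    (hW : n * n + 4 * n + 4 ≤ 2 ^ w) (hV : ∀ p < n, ∀ q < n, V 0 p ≠ V 1 q)
    (hF : ∀ r, IsTop (V r) K a b (F r)) (hN : ∀ r, N r ≤ min K (b + 1 - a)) (hb : b < n)
    (hcN : ∀ r, c r ≤ N r) (hc : c 0 + c 1 < min k (N 0 + N 1))
    (h0 : σ.reg 0 = n) (h14 : σ.reg 14 = N 0)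
    (h15 : σ.reg 15 = N 1) (h16 : σ.reg 16 = c 0) (h17 : σ.reg 17 = c 1)
    (h12 : σ.mem 12 = F 0) (h13 : σ.mem 13 = F 1)
    (h10 : ∀ p < n, ∀ q < n, Meet (V 0) (V 1) k K p q →
      σ.mem 10 (p * n + q) = if V 1 q < V 0 p then 1 else 0)
    (h11 : ∀ p < n, ∀ q < n, Meet (V 1) (V 0) k K p q →
      σ.mem 11 (p * n + q) = if V 0 q < V 1 p then 1 else 0) :
    Run w enc chooseRow σ fun τ _ => (∀ r < 19, τ.reg r = σ.reg r) ∧ τ.mem = σ.mem ∧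
      ((τ.reg 19 ≠ 0 ∧ τ.reg 19 < 2 ^ w ∧ c 0 < N 0 ∧
          (c 1 < N 1 → V 1 (F 1 (c 1)) < V 0 (F 0 (c 0)))) ∨
        (τ.reg 19 = 0 ∧ c 1 < N 1 ∧ (c 0 < N 0 → V 0 (F 0 (c 0)) < V 1 (F 1 (c 1))))) := by
  have hN0 := hN 0
  have hN1 := hN 1
  have hc0 := hcN 0
  have hc1 := hcN 1
  refine run_ite.mpr ⟨if c 0 < N 0 then 1 else 0, ?_, ?_⟩
  · have hle : (if c 0 < N 0 then 1 else 0) ≤ 1 := by split_ifs <;> simp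
    simp (disch := omega) [h16, h14, word_eq]
  by_cases hlt0 : c 0 < N 0
  swap
  · rw [if_neg (by simp [hlt0])]
    refine run_assign.mpr ⟨0, by simp (disch := omega) [word_eq], fun r hr => ?_, rfl, Or.inr
      ⟨by simp, by omega, fun h => absurd h hlt0⟩⟩
    simp [show r ≠ 19 by omega]
  rw [if_pos (by simp [hlt0])]
  refine run_ite.mpr ⟨if c 1 < N 1 then 1 else 0, ?_, ?_⟩
  · have hle : (if c 1 < N 1 then 1 else 0) ≤ 1 := by split_ifs <;> simp
    simp (disch := omega) [h17, h15, word_eq]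
  by_cases hlt1 : c 1 < N 1
  swap
  · rw [if_neg (by simp [hlt1])]
    refine run_assign.mpr ⟨1, by simp (disch := omega) [word_eq], fun r hr => ?_, rfl, Or.inl
      ⟨by simp, by rw [State.setReg_reg, if_pos rfl]; omega, hlt0, fun h => absurd h hlt1⟩⟩
    simp [show r ≠ 19 by omega]
  rw [if_pos (by simp [hlt1])]
  have hp := (hF 0).mem (c 0) (by omega)
  have hq := (hF 1).mem (c 1) (by omega)
  have hrk0 := fun x => (hF 0).rk_le (l := c 0) (q := x) (by omega)
  have hrk1 := fun x => (hF 1).rk_le (l := c 1) (q := x) (by omega)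
  set p := F 0 (c 0) with hpdef
  set q := F 1 (c 1) with hqdef
  have hne := hV p (by omega) q (by omega)
  have hle0 := hrk0 q hq.1 hq.2
  have hle1 := hrk1 p hp.1 hp.2
  refine run_seq.mpr (run_assign.mpr ⟨p, by simp (disch := omega) [h16, h12, ← hpdef, word_eq],
    run_seq.mpr (run_assign.mpr ⟨q, by simp (disch := omega) [h17, h13, ← hqdef, word_eq],
    run_ite.mpr ⟨if q < p then 1 else 0, ?_, ?_⟩⟩)⟩)
  · have hle : (if q < p then 1 else 0) ≤ 1 := by split_ifs <;> simp
    simp (disch := omega) [word_eq]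
  by_cases hqp : q < p
  · rw [if_pos (by simp [hqp])]
    have hm := h11 q (by omega) p (by omega) ⟨hqp.le, by omega⟩
    have hidx := idx_lt (show q < n by omega) (show p < n by omega)
    have hqn : q * n ≤ q * n + p := Nat.le_add_right _ _
    have hle : (if V 0 p < V 1 q then 1 else 0) ≤ 1 := by split_ifs <;> simp
    refine run_assign.mpr ⟨1 - if V 0 p < V 1 q then 1 else 0, ?_, fun r hr => ?_, rfl, ?_⟩
    · simp (disch := omega) [Expr.idx, h0, hm, word_eq]
    · simp [show r ≠ 19 by omega, show r ≠ 22 by omega, show r ≠ 23 by omega]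
    · by_cases hv : V 0 p < V 1 q
      · exact Or.inr ⟨by simp [hv], hlt1, fun _ => hv⟩
      · exact Or.inl ⟨by simp [hv], by rw [State.setReg_reg, if_pos rfl]; omega, hlt0, fun _ => by omega⟩
  · rw [if_neg (by simp [hqp])]
    have hm := h10 p (by omega) q (by omega) ⟨by omega, by omega⟩
    have hidx := idx_lt (show p < n by omega) (show q < n by omega)
    have hpn : p * n ≤ p * n + q := Nat.le_add_right _ _
    have hle : (if V 1 q < V 0 p then 1 else 0) ≤ 1 := by split_ifs <;> simp
    refine run_assign.mpr ⟨if V 1 q < V 0 p then 1 else 0, ?_, fun r hr => ?_, rfl, ?_⟩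
    · simp (disch := omega) [Expr.idx, h0, hm, word_eq]
    · simp [show r ≠ 19 by omega, show r ≠ 22 by omega, show r ≠ 23 by omega]
    · by_cases hv : V 1 q < V 0 p
      · exact Or.inl ⟨by simp [hv], by rw [State.setReg_reg, if_pos rfl]; omega, hlt0, fun _ => hv⟩
      · exact Or.inr ⟨by simp [hv], hlt1, fun _ => by omega⟩

theorem run_moveHead {σ : State} {row src cnt l m v : ℕ} (hW : n * n + 4 * n + 4 ≤ 2 ^ w)
    (hrow : row ≤ 1) (hl : l ≤ 2 * n) (hm : m ≤ n) (hv : v < n) (h18 : σ.reg 18 = l)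
    (hcnt : σ.reg cnt = m) (hsrc : σ.mem src m = v) (hs : 2 ≤ src) :
    Run w enc (moveHead row src cnt) σ fun τ _ => τ.reg cnt = m + 1 ∧
      (∀ r, r ≠ cnt → τ.reg r = σ.reg r) ∧ (∀ b, 2 ≤ b → τ.mem b = σ.mem b) ∧
      (∀ l', τ.mem 0 l' = if l' = l then row else σ.mem 0 l') ∧
      ∀ l', τ.mem 1 l' = if l' = l then v else σ.mem 1 l' := by
  have hsrc' : (σ.setMem 0 l row).mem src m = v := by
    rw [State.setMem_mem_of_ne _ _ _ (by omega), hsrc]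
  refine run_seq.mpr (run_store.mpr ⟨l, by simp (disch := omega) [h18, word_eq], row,
    by simp (disch := omega) [word_eq], run_seq.mpr (run_store.mpr ⟨l,
    by simp (disch := omega) [h18, word_eq], v,
    by simp (disch := omega) [hcnt, hsrc', word_eq], run_assign.mpr ⟨m + 1,
    by simp (disch := omega) [hcnt, word_eq], by simp, fun r hr => by simp [hr], fun b hb => ?_,
    fun l' => ?_, fun l' => ?_⟩⟩)⟩)
  · rw [State.setReg_mem, State.setMem_mem_of_ne _ _ _ (by omega),
      State.setMem_mem_of_ne _ _ _ (by omega)]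
  · rw [State.setReg_mem, State.setMem_mem_of_ne _ _ _ (by norm_num), State.setMem_mem]
    simp
  · rw [State.setReg_mem, State.setMem_mem, State.setMem_mem_of_ne _ _ _ (by norm_num)]
    simp

/-- What `mergeLists` has achieved after `l` rounds. -/
def MergeInv (n : ℕ) (V F : Fin 2 → ℕ → ℕ) (N : Fin 2 → ℕ) (σ : State) (l : ℕ) (τ : State) : Prop :=
  τ.reg 18 = l ∧ (∀ r < 16, τ.reg r = σ.reg r) ∧ (∀ b, 2 ≤ b → τ.mem b = σ.mem b) ∧
    ∃ (c : Fin 2 → ℕ) (L : List (Fin 2 × Fin n)), Merging V F N c L ∧ L.length = l ∧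
      τ.reg 16 = c 0 ∧ τ.reg 17 = c 1 ∧
      ∀ l' (h : l' < L.length), τ.mem 0 l' = (L[l'].1 : ℕ) ∧ τ.mem 1 l' = (L[l'].2 : ℕ)

theorem run_mergeLists {σ : State} {V F : Fin 2 → ℕ → ℕ} {N : Fin 2 → ℕ} {a b : ℕ}
    (hW : n * n + 4 * n + 4 ≤ 2 ^ w) (hK : K ≤ n) (hk : k ≤ 2 * n)
    (hV : ∀ p < n, ∀ q < n, V 0 p ≠ V 1 q)
    (hF : ∀ r, IsTop (V r) K a b (F r)) (hN : ∀ r, N r ≤ min K (b + 1 - a)) (hb : b < n)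
    (h0 : σ.reg 0 = n) (h1 : σ.reg 1 = k) (h14 : σ.reg 14 = N 0) (h15 : σ.reg 15 = N 1)
    (h12 : σ.mem 12 = F 0) (h13 : σ.mem 13 = F 1)
    (h10 : ∀ p < n, ∀ q < n, Meet (V 0) (V 1) k K p q →
      σ.mem 10 (p * n + q) = if V 1 q < V 0 p then 1 else 0)
    (h11 : ∀ p < n, ∀ q < n, Meet (V 1) (V 0) k K p q →
      σ.mem 11 (p * n + q) = if V 0 q < V 1 p then 1 else 0) :
    Run w enc mergeLists σ fun τ _ => ∃ (c : Fin 2 → ℕ) (L : List (Fin 2 × Fin n)),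
      Merging V F N c L ∧ c 0 + c 1 = min k (N 0 + N 1) ∧
      ∀ l' (h : l' < L.length), τ.mem 0 l' = (L[l'].1 : ℕ) ∧ τ.mem 1 l' = (L[l'].2 : ℕ) := by
  have hN0 := hN 0
  have hN1 := hN 1
  refine run_seq.mpr (run_assign.mpr ⟨0, by simp (disch := omega) [word_eq],
    run_seq.mpr (run_assign.mpr ⟨0, by simp (disch := omega) [word_eq], ?_⟩)⟩)
  refine Run.for_untimed (N := min k (N 0 + N 1)) (MergeInv n V F N σ) (by omega) ?_ ?_ ?_ ?_
  · refine ⟨by simp, fun r hr => ?_, fun _ _ => rfl, 0, [], Merging.nil, rfl, by simp, by simp,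
      by simp⟩
    simp [show r ≠ 16 by omega, show r ≠ 17 by omega, show r ≠ 18 by omega]
  · rintro l τ hl ⟨h18, hr, -⟩
    have e : k - (k - (N 0 + N 1)) = min k (N 0 + N 1) := by omega
    exact ⟨h18, by simp (disch := omega) [hr 1 (by norm_num), hr 14 (by norm_num),
      hr 15 (by norm_num), h1, h14, h15, word_eq, e]⟩
  · rintro l τ hl h18 ⟨-, hr, hm, c, L, hM, hLl, h16, h17, hout⟩
    have hcl := hM.length
    refine run_seq.mpr ((run_chooseRow (k := k) hW hV hF hN hb hM.le (by omega)
      ((hr 0 (by norm_num)).trans h0) ((hr 14 (by norm_num)).trans h14)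
      ((hr 15 (by norm_num)).trans h15) h16 h17 ((hm 12 (by norm_num)).trans h12)
      ((hm 13 (by norm_num)).trans h13) (by rw [hm 10 (by norm_num)]; exact h10)
      (by rw [hm 11 (by norm_num)]; exact h11)).mono ?_)
    rintro τ₁ t₁ ⟨hr₁, hm₁, hcase⟩
    have hanti : ∀ r, ∀ s < N r, ∀ s' < s, V r (F r s) < V r (F r s') := fun r s hs s' hs' =>
      (hF r).anti s (hs.trans_le (hN r)) s' hs'
    -- the part of the invariant that depends on the row
    have hstep : ∀ (r : Fin 2) (τ' : State), (hcr : c r < N r) →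
        (∀ r', r' ≠ r → c r' < N r' → V r' (F r' (c r')) < V r (F r (c r))) →
        τ'.reg 16 = Function.update c r (c r + 1) 0 → τ'.reg 17 = Function.update c r (c r + 1) 1 →
        (∀ r < 16, τ'.reg r = σ.reg r) → (∀ b, 2 ≤ b → τ'.mem b = σ.mem b) →
        (∀ l', τ'.mem 0 l' = if l' = l then (r : ℕ) else τ.mem 0 l') →
        (∀ l', τ'.mem 1 l' = if l' = l then F r (c r) else τ.mem 1 l') →
        MergeInv n V F N σ (l + 1) (τ'.setReg 18 (l + 1)) := by
      intro r τ' hcr hlt h16' h17' hr' hm' hm0 hm1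
      have hmem := (hF r).mem (c r) (hcr.trans_le (hN r))
      refine ⟨by simp, fun r'' hr'' => by simp [show r'' ≠ 18 by omega, hr' r'' hr''], hm', _, _,
        hM.step hanti r hcr hlt ⟨F r (c r), by omega⟩ rfl, by simp [hLl], by simpa using h16',
        by simpa using h17', fun l' hl' => ?_⟩
      rw [State.setReg_mem, hm0, hm1]
      rw [List.length_append, List.length_singleton] at hl'
      by_cases h : l' = l
      · subst h
        simp [← hLl]
      · rw [if_neg h, if_neg h, List.getElem_append_left (by omega)]
        exact hout l' (by omega)
    have k18 : τ₁.reg 18 = l := (hr₁ 18 (by norm_num)).trans h18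
    rcases hcase with ⟨h19, h19', hlt0, hcmp⟩ | ⟨h19, hlt1, hcmp⟩
    · have hp := (hF 0).mem (c 0) (by omega)
      refine run_ite.mpr ⟨τ₁.reg 19, by simp (disch := omega) [word_eq], ?_⟩
      rw [if_pos h19]
      refine (run_moveHead (l := l) (m := c 0) (v := F 0 (c 0)) hW (by norm_num) (by omega)
        (by omega) (by omega) k18 ((hr₁ 16 (by norm_num)).trans h16)
        (by rw [hm₁, hm 12 (by norm_num), h12]) (by norm_num)).mono ?_
      rintro τ₂ t₂ ⟨hc₂, hr₂, hm₂, h0₂, h1₂⟩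
      refine ⟨by rw [hr₂ 18 (by norm_num), k18], hstep 0 τ₂ hlt0 (fun r' hr' h => ?_)
        (by simpa using hc₂) ?_ (fun r h => ?_) (fun b' h => ?_) (by simpa [hm₁] using h0₂)
        (by simpa [hm₁] using h1₂)⟩
      · obtain rfl : r' = 1 := by omega
        exact hcmp h
      · rw [hr₂ 17 (by norm_num), hr₁ 17 (by norm_num), h17]
        simp
      · rw [hr₂ r (by omega), hr₁ r (by omega), hr r h]
      · rw [hm₂ b' h, hm₁, hm b' h]
    · have hq := (hF 1).mem (c 1) (by omega)
      refine run_ite.mpr ⟨0, by simp (disch := omega) [h19, word_eq], ?_⟩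
      rw [if_neg (by simp)]
      refine (run_moveHead (l := l) (m := c 1) (v := F 1 (c 1)) hW (by norm_num) (by omega)
        (by omega) (by omega) k18 ((hr₁ 17 (by norm_num)).trans h17)
        (by rw [hm₁, hm 13 (by norm_num), h13]) (by norm_num)).mono ?_
      rintro τ₂ t₂ ⟨hc₂, hr₂, hm₂, h0₂, h1₂⟩
      refine ⟨by rw [hr₂ 18 (by norm_num), k18], hstep 1 τ₂ hlt1 (fun r' hr' h => ?_) ?_
        (by simpa using hc₂) (fun r h => ?_) (fun b' h => ?_) (by simpa [hm₁] using h0₂)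
        (by simpa [hm₁] using h1₂)⟩
      · obtain rfl : r' = 0 := by omega
        exact hcmp h
      · rw [hr₂ 16 (by norm_num), hr₁ 16 (by norm_num), h16]
        simp
      · rw [hr₂ r (by omega), hr₁ r (by omega), hr r h]
      · rw [hm₂ b' h, hm₁, hm b' h]
  · rintro τ ⟨-, -, -, c, L, hM, hLl, -, -, hout⟩
    exact ⟨c, L, hM, by rw [← hM.length, hLl], hout⟩

end WordRAM

namespace WordRAM

open RowOrder Questions

variable {w : ℕ} {enc : List Bool} {n K k : ℕ}

/-- The query program: it rebuilds the rank tables of the two rows by queries to the rows, repeats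
the comparisons of the construction with the stored answers, and merges the answers to the
query on the two rows. The program `Q` is the query program for one row, with its
registers and banks below `R`; its words have `c * (log n + 1)` bits. Register `2` contains
`min k n`, register `3` the length of the encoding of a row, registers `7` to `10` the query, and
register `11` the position of the encoding of the current row. -/
def decoder (Q : Cmd) (c R : ℕ) : Cmd :=
  .seq (.assign 7 (.reg 2)) (.seq (.assign 8 (.reg 3)) (.seq (.assign 9 (.reg 4))
    (.seq (.assign 10 (.reg 5))
    (.seq (.assign 2 (.bin .sub (.reg 1) (.bin .sub (.reg 1) (.reg 0))))
    (.seq (.assign 3 (.bin .div (.bin .sub (.reg 6) (.bin .mul (.const 4) (.reg 0))) (.const 2)))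
    (.seq (.assign 11 (.const 0)) (.seq (queryTable Q c R 2)
    (.seq (.assign 11 (.reg 3)) (.seq (queryTable Q c R 3)
    (.seq (compareAll (.bin .mul (.const 2) (.reg 3)) askString askString)
    (.seq (.assign 11 (.const 0)) (.seq (queryList Q c R 12)
    (.seq (.assign 11 (.reg 3)) (.seq (queryList Q c R 13)
    (.seq (.assign 12 (.reg 9)) (.seq (.assign 13 (.reg 10))
    (.seq (.assign 14 (.bin .mul (.bin .sub (.const 1) (.reg 7)) .answerLength))
    (.seq (.assign 15 (.bin .mul (.reg 8) .answerLength)) mergeLists))))))))))))))))))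

@[simp]
theorem BinOp.eval_div (x y : ℕ) : BinOp.div.eval x y = x / y := rfl

theorem answers_decoder {A : Fin 2 → Fin n → ℕ} {e₀ e₁ rest : List Bool} {Q : Cmd} {S c R : ℕ}
    (hn : 1 ≤ n) (hw : 1 ≤ w) (hW : n * n + 4 * n + 4 ≤ 2 ^ w) (hK : K = min k n) (hk : k ≤ 2 * n)
    (hlt : enc.length < 2 ^ w) (hA : ∀ x y, A 0 x ≠ A 1 y) (hS₀ : e₀.length = S)
    (hS₁ : e₁.length = S)
    (henc : enc = e₀ ++ e₁ ++ (allBits (rowFun (A 0)) (rowFun (A 1)) k K n ++ rest))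
    (hrest : (allBits (rowFun (A 0)) (rowFun (A 1)) k K n).length + rest.length = 4 * n)
    (h₀ : Represents w enc Q c n K S R (rowFun (A 0)) 0)
    (h₁ : Represents w enc Q c n K S R (rowFun (A 1)) S) {i j : Fin 2} {a b : Fin n} (hij : i ≤ j)
    (hab : a ≤ b) : Answers2D w (decoder Q c R) n k A enc i j a b := by
  have hKn : K ≤ n := by omega
  have hlen : enc.length = 2 * S + 4 * n := by
    rw [henc]
    simp only [List.length_append]
    omega
  suffices h : Run w enc (decoder Q c R) (State.init [n, k, i, j, a, b, enc.length] [])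
      fun τ _ => ∃ L : List (Fin 2 × Fin n),
        IsSortedTopK (fun p => A p.1 p.2) (Finset.Icc i j ×ˢ Finset.Icc a b) k L ∧
        ∀ l (h : l < L.length), τ.mem 0 l = (L[l].1 : ℕ) ∧ τ.mem 1 l = (L[l].2 : ℕ) by
    obtain ⟨τ, t, hex, hL⟩ := h
    exact ⟨τ, t, hex, hL⟩
  set σ := State.init [n, k, i, j, a, b, enc.length] [] with hσ
  have g0 : σ.reg 0 = n := rfl
  have g1 : σ.reg 1 = k := rfl
  have g2 : σ.reg 2 = i := rfl
  have g3 : σ.reg 3 = j := rfl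
  have g4 : σ.reg 4 = a := rfl
  have g5 : σ.reg 5 = b := rfl
  have g6 : σ.reg 6 = enc.length := rfl
  have gm : ∀ b c, σ.mem b c = 0 := fun _ _ => rfl
  have hi := i.2
  have hj := j.2
  have ha := a.2
  have hb := b.2
  have hKe : k - (k - n) = K := by omega
  have hSe : (enc.length - 4 * n) / 2 = S := by omega
  refine run_seq.mpr (run_assign.mpr ⟨i, by simp (disch := omega) [g2, word_eq],
    run_seq.mpr (run_assign.mpr ⟨j, by simp (disch := omega) [g3, word_eq],
    run_seq.mpr (run_assign.mpr ⟨a, by simp (disch := omega) [g4, word_eq],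
    run_seq.mpr (run_assign.mpr ⟨b, by simp (disch := omega) [g5, word_eq],
    run_seq.mpr (run_assign.mpr ⟨K, by simp (disch := omega) [g0, g1, word_eq, hKe],
    run_seq.mpr (run_assign.mpr ⟨S, by simp (disch := omega) [g0, g6, word_eq, hSe],
      ?_⟩)⟩)⟩)⟩)⟩)⟩)
  set σ₀ := (((((σ.setReg 7 i).setReg 8 j).setReg 9 a).setReg 10 b).setReg 2 K).setReg 3 S with hσ₀
  have s0 : σ₀.reg 0 = n := by simp [hσ₀, g0]
  have s1 : σ₀.reg 1 = k := by simp [hσ₀, g1]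
  have s2 : σ₀.reg 2 = K := by simp [hσ₀]
  have s3 : σ₀.reg 3 = S := by simp [hσ₀]
  have s7 : σ₀.reg 7 = i := by simp [hσ₀]
  have s8 : σ₀.reg 8 = j := by simp [hσ₀]
  have s9 : σ₀.reg 9 = a := by simp [hσ₀]
  have s10 : σ₀.reg 10 = b := by simp [hσ₀]
  have sm : ∀ b c, σ₀.mem b c = 0 := gm
  clear_value σ₀
  clear hσ₀ g0 g1 g2 g3 g4 g5 g6 gm hσ
  clear_value σ
  -- the rank tables
  refine run_seq.mpr (run_assign.mpr ⟨0, by simp (disch := omega) [word_eq], ?_⟩)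
  refine run_seq.mpr ((run_queryTable (dst := 2) hW hKn h₀ (by norm_num) (by simp [s0])
    (by simp [s2]) (by simp [s3]) (by simp)).mono ?_)
  rintro σ₁ t₁ ⟨hk₁, htab₀⟩
  have r₁ : ∀ r < 11, σ₁.reg r = σ₀.reg r := fun r hr => by
    rw [hk₁.reg r (by omega)]
    simp [show r ≠ 11 by omega]
  refine run_seq.mpr (run_assign.mpr ⟨S, by
    simp (disch := omega) [r₁ 3 (by norm_num), s3, word_eq], ?_⟩)
  refine run_seq.mpr ((run_queryTable (dst := 3) hW hKn h₁ (by norm_num)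
    (by simp [r₁ 0 (by norm_num), s0]) (by simp [r₁ 2 (by norm_num), s2])
    (by simp [r₁ 3 (by norm_num), s3]) (by simp)).mono ?_)
  rintro σ₂ t₂ ⟨hk₂, htab₁⟩
  have r₂ : ∀ r < 11, σ₂.reg r = σ₀.reg r := fun r hr => by
    rw [hk₂.reg r (by omega)]
    simp [show r ≠ 11 by omega, r₁ r hr]
  have m₂ : ∀ b < 20, b ≠ 2 → b ≠ 3 → σ₂.mem b = σ₀.mem b := fun b h h2 h3 => by
    rw [hk₂.mem b h h3, State.setReg_mem, hk₁.mem b h h2]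
    rfl
  -- the comparisons, with the stored answers
  refine run_seq.mpr (Run.mono (run_compareAll (c₀ := 2 * S) (em := false) (A := rowFun (A 0))
    (A' := rowFun (A 1)) hW hK hk ((r₂ 0 (by norm_num)).trans s0) ((r₂ 1 (by norm_num)).trans s1)
    (by rw [hk₂.mem 2 (by norm_num) (by norm_num)]; exact htab₀) htab₁
    (fun c _ => by rw [m₂ 8 (by norm_num) (by norm_num) (by norm_num), sm])
    (fun c _ => by rw [m₂ 9 (by norm_num) (by norm_num) (by norm_num), sm])
    (fun σ' hr => by
      simp (disch := omega) [hr 3 (by norm_num), r₂ 3 (by norm_num), s3, word_eq])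
    (fun σ' _ => askSpec_askString (pre := e₀ ++ e₁) (post :=
      bits (MeetAt (rowFun (A 1)) (rowFun (A 0)) k K n) (GtAt (rowFun (A 1)) (rowFun (A 0)) K n) n n
        ++ rest) hw hlt (by rw [List.length_append]; omega)
      (by rw [henc, allBits]; simp only [List.append_assoc]))
    (fun σ' _ => askSpec_askString (pre := e₀ ++ e₁ ++
      bits (MeetAt (rowFun (A 0)) (rowFun (A 1)) k K n) (GtAt (rowFun (A 0)) (rowFun (A 1)) K n) n n)
      (post := rest) hw hlt (by rw [List.length_append, List.length_append]; omega)
      (by rw [henc, allBits]; simp only [List.append_assoc]))) ?_)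
  rintro σ₃ t₃ ⟨-, hF₃, -, hcmp, hcmp'⟩
  have r₃ : ∀ r < 11, σ₃.reg r = σ₀.reg r := fun r hr => (hF₃.reg r (by omega)).trans (r₂ r hr)
  -- the answers of the two rows
  refine run_seq.mpr (run_assign.mpr ⟨0, by simp (disch := omega) [word_eq], ?_⟩)
  refine run_seq.mpr ((run_queryList (dst := 12) (a := a) (b := b) hW hKn h₀ (by norm_num)
    (by simp [r₃ 0 (by norm_num), s0]) (by simp [r₃ 2 (by norm_num), s2])
    (by simp [r₃ 3 (by norm_num), s3]) (by simp) (by simp [r₃ 9 (by norm_num), s9])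
    (by simp [r₃ 10 (by norm_num), s10]) hab hb).mono ?_)
  rintro σ₄ t₄ ⟨hk₄, hT₀⟩
  have r₄ : ∀ r < 11, σ₄.reg r = σ₀.reg r := fun r hr => by
    rw [hk₄.reg r (by omega)]
    simp [show r ≠ 11 by omega, r₃ r hr]
  refine run_seq.mpr (run_assign.mpr ⟨S, by
    simp (disch := omega) [r₄ 3 (by norm_num), s3, word_eq], ?_⟩)
  refine run_seq.mpr ((run_queryList (dst := 13) (a := a) (b := b) hW hKn h₁ (by norm_num)
    (by simp [r₄ 0 (by norm_num), s0]) (by simp [r₄ 2 (by norm_num), s2])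
    (by simp [r₄ 3 (by norm_num), s3]) (by simp) (by simp [r₄ 9 (by norm_num), s9])
    (by simp [r₄ 10 (by norm_num), s10]) hab hb).mono ?_)
  rintro σ₅ t₅ ⟨hk₅, hT₁⟩
  have r₅ : ∀ r < 11, σ₅.reg r = σ₀.reg r := fun r hr => by
    rw [hk₅.reg r (by omega)]
    simp [show r ≠ 11 by omega, r₄ r hr]
  have m₅ : ∀ b < 12, σ₅.mem b = σ₃.mem b := fun b h => by
    rw [hk₅.mem b (by omega) (by omega), State.setReg_mem, hk₄.mem b (by omega) (by omega)]
    rfl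
  have m12 : σ₅.mem 12 = σ₄.mem 12 := hk₅.mem 12 (by norm_num) (by norm_num)
  -- the merging
  refine run_seq.mpr (run_assign.mpr ⟨a, by
      simp (disch := omega) [r₅ 9 (by norm_num), s9, word_eq],
    run_seq.mpr (run_assign.mpr ⟨b, by
      simp (disch := omega) [r₅ 10 (by norm_num), s10, word_eq], ?_⟩)⟩)
  set N : Fin 2 → ℕ := fun r => if i ≤ r ∧ r ≤ j then min K (b + 1 - a) else 0 with hN
  have hNle : ∀ r, N r ≤ min K (b + 1 - a) := fun r => by
    simp only [hN]
    split_ifs <;> omega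
  have hN0 : (1 - (i : ℕ)) * min K (b + 1 - a) = N 0 := by
    simp only [hN]
    clear hN hNle s7 s8 hi hj
    fin_cases i <;> fin_cases j <;> simp at hij ⊢
  have hN1 : (j : ℕ) * min K (b + 1 - a) = N 1 := by
    simp only [hN]
    clear hN hNle hN0 s7 s8 hi hj
    fin_cases i <;> fin_cases j <;> simp at hij ⊢
  clear_value N
  have hNn0 := hNle 0
  have hNn1 := hNle 1
  have e1 := fun τ h2 h12 h13 => eval_answerLength (τ := τ) (enc := enc) hW hKn hb hab h2 h12 h13
  refine run_seq.mpr (run_assign.mpr ⟨N 0, ?_, run_seq.mpr (run_assign.mpr ⟨N 1, ?_, ?_⟩)⟩)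
  · rw [eval_bin, e1 _ (by simp [r₅ 2 (by norm_num), s2]) (by simp) (by simp)]
    simp (disch := omega) [r₅ 7 (by norm_num), s7, word_eq, hN0]
  · rw [eval_bin, e1 _ (by simp [r₅ 2 (by norm_num), s2]) (by simp) (by simp)]
    simp (disch := omega) [r₅ 8 (by norm_num), s8, word_eq, hN1]
  refine (run_mergeLists (k := k) (V := fun r => rowFun (A r)) (F := ![σ₄.mem 12, σ₅.mem 13])
    (N := N) (a := a) (b := b) hW hKn hk ?_ ?_ hNle hb (by simp [r₅ 0 (by norm_num), s0])
    (by simp [r₅ 1 (by norm_num), s1]) (by simp) (by simp) (by simp [m12]) (by simp) ?_ ?_).mono ?_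
  · intro p hp q hq
    rw [rowFun_of_lt _ hp, rowFun_of_lt _ hq]
    exact hA _ _
  · rw [Fin.forall_fin_two]
    exact ⟨hT₀, hT₁⟩
  · simp only [State.setReg_mem, m₅ 10 (by norm_num)]
    exact hcmp
  · simp only [State.setReg_mem, m₅ 11 (by norm_num)]
    exact hcmp'
  · rintro τ t ⟨c', L, hM, hc, hout⟩
    refine ⟨L, ?_, hout⟩
    have h := hM.isSortedTopK (i := i) (j := j) (a := a) (b := b) hij hK
      (Fin.forall_fin_two.mpr ⟨hT₀, hT₁⟩) (fun r => by rw [hN]) hc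
    have hfun : (fun p : Fin 2 × Fin n => rowFun (A p.1) p.2) = fun p => A p.1 p.2 := by
      funext p
      exact rowFun_of_lt _ p.2.2
    rw [← hfun]
    exact h

end WordRAM

/-! ### Word size and total cost -/

open WordRAM

theorem two_mul_pow_lt_two_pow_wordSize {n c d : ℕ} (hn : 1 ≤ n) (hd : 1 ≤ d) (h : 2 * d ≤ c) :
    (2 * n) ^ d < 2 ^ wordSize c n := by
  have h1 : n < 2 ^ (Nat.log 2 n + 1) := Nat.lt_pow_succ_log_self (by norm_num) n
  have h2 : 2 * n < 2 ^ (2 * (Nat.log 2 n + 1)) := by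
    rw [Nat.mul_comm 2 (_ + 1), pow_mul]
    nlinarith
  calc (2 * n) ^ d < (2 ^ (2 * (Nat.log 2 n + 1))) ^ d := Nat.pow_lt_pow_left h2 (by omega)
    _ = 2 ^ wordSize (2 * d) n := by rw [wordSize, ← pow_mul]; ring_nf
    _ ≤ _ := Nat.pow_le_pow_right (by norm_num) (Nat.mul_le_mul_right _ h)

theorem mainTheorem1 :
    ∃ K : ℕ, ∀ (u : ℕ) (S T C : ℕ → ℕ → ℕ), HasEncoding1D u S T C →
      ∃ (B Q : WordRAM.Cmd) (c : ℕ), ∀ n k : ℕ, 1 ≤ n → 1 ≤ k → k ≤ 2 * n →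
        ∀ A : Fin 2 → Fin n → ℕ,
          Function.Injective (fun p : Fin 2 × Fin n => A p.1 p.2) →
          (∀ r x, A r x < 2 ^ WordRAM.wordSize u n) →
          ∃ e : List Bool,
            e.length = 2 * S n (min k n) + 4 * n ∧
            e.length < 2 ^ WordRAM.wordSize c n ∧
            Builds2D (WordRAM.wordSize c n) B n k A e
              (K * (C n (min k n) + k ^ 2 * n ^ 2 + k * n * T n (min k n))) ∧
            ∀ (i j : Fin 2) (a b : Fin n), i ≤ j → a ≤ b →
              Answers2D (WordRAM.wordSize c n) Q n k A e i j a b := by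
  -- the constant covers `6 * C + 2000 * n ^ 2`, the running time of `encoder B`
  refine ⟨2006, fun u S T C ⟨B, Q, c₁, h⟩ => ?_⟩
  obtain ⟨R, hR⟩ := Q.exists_bdd
  -- The word size makes room for the address space of `Q`, the elements of the array, the positions in
  -- the string, and the tables. With the bound `R + 5` on the registers and banks of `Q`, its input
  -- registers and its output bank are among those that are simulated.
  refine ⟨encoder B, decoder Q c₁ (R + 5), 2 * c₁ + u + 8, fun n k hn hk hk2 A hA hAu => ?_⟩
  have hinj : ∀ r, Function.Injective (A r) := fun r x y hxy => by
    have := hA (a₁ := (r, x)) (a₂ := (r, y)) hxy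
    simpa using this
  have hne : ∀ x y, A 0 x ≠ A 1 y := fun x y hxy => by
    have := hA (a₁ := (0, x)) (a₂ := (1, y)) hxy
    simp at this
  obtain ⟨e₀, hS₀, he₀, hB₀, hQ₀⟩ := h n (min k n) (by omega) (by omega) (A 0) (hinj 0) (hAu 0)
  obtain ⟨e₁, hS₁, he₁, hB₁, hQ₁⟩ := h n (min k n) (by omega) (by omega) (A 1) (hinj 1) (hAu 1)
  have hmono : ∀ {c}, c ≤ 2 * c₁ + u + 8 → wordSize c n ≤ wordSize (2 * c₁ + u + 8) n :=
    fun hc => Nat.mul_le_mul_right _ hc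
  have hw₁ : wordSize c₁ n ≤ wordSize (2 * c₁ + u + 8) n := hmono (by omega)
  have hw : 1 ≤ wordSize (2 * c₁ + u + 8) n := Nat.mul_pos (by omega) (by omega)
  have hpow : (2 * n) ^ (c₁ + 1) < 2 ^ wordSize (2 * c₁ + u + 8) n :=
    two_mul_pow_lt_two_pow_wordSize hn (by omega) (by omega)
  have hpow' : (2 * n) ^ (c₁ + 4) < 2 ^ wordSize (2 * c₁ + u + 8) n :=
    two_mul_pow_lt_two_pow_wordSize hn (by omega) (by omega)
  have hpow4 : (2 * n) ^ 4 < 2 ^ wordSize (2 * c₁ + u + 8) n :=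
    two_mul_pow_lt_two_pow_wordSize hn (by omega) (by omega)
  have hW : n * n + 4 * n + 4 ≤ 2 ^ wordSize (2 * c₁ + u + 8) n := by
    refine le_trans ?_ hpow4.le
    have : (2 * n) ^ 4 = 16 * (n * n) * (n * n) := by ring
    rw [this]
    nlinarith [Nat.mul_le_mul hn hn]
  have hAw : ∀ r x, A r x < 2 ^ wordSize (2 * c₁ + u + 8) n := fun r x =>
    (hAu r x).trans_le (Nat.pow_le_pow_right (by norm_num) (hmono (by omega)))
  have hbits := length_allBits_le (rowFun (A 0)) (rowFun (A 1)) k (min k n) n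
  set bs := allBits (rowFun (A 0)) (rowFun (A 1)) k (min k n) n with hbs
  set e := e₀ ++ e₁ ++ (bs ++ List.replicate (4 * n - bs.length) false) with he
  have hlen : e.length = 2 * S n (min k n) + 4 * n := by
    simp only [he, List.length_append, List.length_replicate]
    omega
  have hlt : e.length < 2 ^ wordSize (2 * c₁ + u + 8) n := by
    refine lt_of_le_of_lt ?_ hpow'
    have h1 := two_pow_wordSize_le hn c₁
    have h2 : 1 ≤ (2 * n) ^ c₁ := Nat.one_le_pow _ _ (by omega)
    have h3 : (2 * n) ^ (c₁ + 4) = (2 * n) ^ c₁ * (16 * (n * n) * (n * n)) := by ring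
    have h4 : n ≤ n * n := Nat.le_mul_of_pos_left n hn
    have h5 : n * n ≤ (n * n) * (n * n) := Nat.le_mul_of_pos_left _ (by omega)
    have h6 : (2 * n) ^ c₁ * (16 * n) ≤ (2 * n) ^ (c₁ + 4) := by
      rw [h3]
      exact Nat.mul_le_mul_left _ (by nlinarith)
    nlinarith [Nat.mul_le_mul h2 hn]
  refine ⟨e, hlen, hlt, ?_, fun i j a b hij hab => ?_⟩
  · obtain ⟨τ, s, hex, hout, hs⟩ := builds_encoder hn hw₁ hw hW hk2 hAw hB₀ hB₁
    refine ⟨τ, s, hex, hout, hs.trans ?_⟩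
    have hk1 : 1 ≤ k ^ 2 := Nat.one_le_pow _ _ hk
    nlinarith [Nat.mul_le_mul_right (n * n) hk1, Nat.zero_le (k * n * T n (min k n))]
  · have hR' : Q.Bdd (R + 5) := Cmd.Bdd.mono (by omega) _ hR
    have hKw : min k n < 2 ^ wordSize (2 * c₁ + u + 8) n := by omega
    have hrep₀ := represents_of_answers (off := 0) hn hR' (by omega) hpow hKw hw₁ hlt (by omega)
      (by rw [he, List.drop_zero, List.append_assoc, List.take_left]) hQ₀
    have hrep₁ := represents_of_answers (off := S n (min k n)) hn hR' (by omega) hpow hKw hw₁ hlt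
      (by omega)
      (by rw [he, ← hS₀, List.append_assoc, List.drop_left, List.take_left]) hQ₁
    rw [hS₀] at hrep₀
    rw [hS₁] at hrep₁
    refine answers_decoder hn hw hW rfl hk2 hlt hne hS₀ hS₁ he ?_ hrep₀ hrep₁ hij hab
    change bs.length + (List.replicate (4 * n - bs.length) false).length = 4 * n
    rw [List.length_replicate]
    omega
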